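/- Let $N\ge 0$, $M\ge 1$ be integers and $L^2=L^2([0,1]^N,\mathbb C^M)$. For $1\le j\le N$ let $\langle\cdot\rangle_j=\int_{[0,1]^j}\cdot\,dk_1\dots dk_j$, and write $\mathbf k_j=(k_{j+1},\dots,k_N)\in[0,1]^{N-j}$. Let $\mathcal H$ be the (non-closed) subalgebra of the bounded operators on $L^2$ generated by the operators of multiplication by continuous $M\times M$ matrix-valued functions on $[0,1]^N$ and by $\langle\cdot\rangle_1,\dots,\langle\cdot\rangle_N$. Every $\mathcal A\in\mathcal H$ can be written as $$\mathcal A u=A_0u+\sum_{j=1}^N A_j\langle B_ju\rangle_j,\qquad u\in L^2,\tag{1}$$ with continuous matrix-valued functions on $[0,1]^N$: $A_0$ of size $M\times M$, $A_j$ of size $M\times M_j$, $B_j$ of size $M_j\times M$, where the $M_j$ are positive integers. Define $$\|\mathcal A\|_{\rm tr}=\sum_{j=0}^N\max_{\mathbf k_j\in[0,1]^{N-j}}g_j(\mathbf k_j),$$ where $g_j(\mathbf k_j)$ is the sum, with algebraic multiplicity, of the square roots of the (non-negative) eigenvalues of $C_j(\mathbf k_j)$, with $C_0=A_0^*A_0$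 and $C_j=\langle B_jB_j^*\rangle_j\langle A_j^*A_j\rangle_j$ for $j\ge1$. Let $\mathcal C=\prod_{j=0}^N C([0,1]^{N-j},\mathbb C)$ be the Banach algebra with componentwise operations and norm $\|f\|_{\rm c}=\max_j\max_{\mathbf k_j}|f_j(\mathbf k_j)|$. For invertible $\mathcal A\in\mathcal H$ as in (1) let $\pi(\mathcal A)=(\pi_0,\dots,\pi_N)\in\mathcal C$, where $\pi_0=\det A_0$, $A_{j,0}=A_0^{-1}A_j$, and, for $r=1,\dots,N$, $$\pi_r=\det E_r,\quad E_r=I+\langle B_rA_{r,r-1}\rangle_r,\quad A_{j,r}=A_{j,r-1}-A_{r,r-1}E_r^{-1}\langle B_rA_{j,r-1}\rangle_r\quad(j>r).$$ For $\mathcal A\in\mathcal H$ let $\tau(\mathcal A)=\lim_{t\to0}\big(\pi(\mathcal I+t\mathcal A)-\pi(\mathcal I)\big)/t$ in $\mathcal C$. Then $\|\cdot\|_{\rm tr}$ and $\pi$ do not depend on the choice of the representation (1), and: 1. $\|\cdot\|_{\rm tr}$ is a norm on $\mathcal H$ with $\|\mathcal A\mathcal B\|_{\rm tr}\le\|\mathcal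 A\|_{\rm tr}\|\mathcal B\|_{\rm tr}$ and $\|\mathcal A\|\le\|\mathcal A\|_{\rm tr}$, where $\|\cdot\|$ is the operator norm. 2. The completion $\overline{\mathcal H}$ of $\mathcal H$ under $\|\cdot\|_{\rm tr}$ is a Banach algebra (with submultiplicative norm $\|\cdot\|_{\rm tr}$), and the inclusion of $\mathcal H$ into the bounded operators on $L^2$ extends to an algebra homomorphism on $\overline{\mathcal H}$, under which $\|\mathcal A\|\le\|\mathcal A\|_{\rm tr}$ for all $\mathcal A\in\overline{\mathcal H}$. 3. $\tau$ extends to a continuous linear map $\tau:\overline{\mathcal H}\to\mathcal C$ of norm exactly $1$, with $\tau(\mathcal I)=(M,0,\dots,0)$, and $\pi$ extends to a continuous map $\pi:{\rm Inv}(\overline{\mathcal H})\to{\rm Inv}(\mathcal C)$ between the groups of invertible elements. 4. For all $\mathcal A\in\overline{\mathcal H}$ and $\lambda\in\mathbb C$ with $|\lambda|>\|\mathcal A\|_{\rm tr}$, the element $\lambda\mathcal I-\mathcal A$ is invertible in $\overline{\mathcal H}$, the series below converges in $\mathcal C$, and $$\ln\pi(\lambda\mathcal I-\mathcal A)=(\ln\lambda)\,\tau(\mathcal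 I)-\sum_{n=1}^\infty\frac{\tau(\mathcal A^n)}{n\lambda^n}$$ componentwise, in the sense that for every value of $\ln\lambda$ the exponential of the right-hand side equals $\pi(\lambda\mathcal I-\mathcal A)$. -/

import Mathlib

open MeasureTheory Filter Topology Matrix
open scoped unitInterval

namespace PeriodicDefect

noncomputable section

/-- The cube `[0,1]^n` (product topology, Lebesgue measure). -/
abbrev Cube (n : ℕ) : Type := Fin n → I

/-- The point of `[0,1]^N` with first `n` coordinates `s` and remaining coordinates `k`. -/
def glue {N : ℕ} (n : ℕ) (s : Cube n) (k : Cube (N - n)) : Cube N := fun i =>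
  if h : i.1 < n then s ⟨i.1, h⟩ else k ⟨i.1 - n, by omega⟩

/-- The last `N - n` coordinates of a point of `[0,1]^N`. -/
def tail {N : ℕ} (n : ℕ) (k : Cube N) : Cube (N - n) := fun i => k ⟨i.1 + n, by omega⟩

/-- `⟨F⟩_n`: the entrywise integral of a matrix-valued function over the first `n` variables,
as a function of the remaining ones. -/
def avgMat {N : ℕ} {p q : ℕ} (n : ℕ) (F : Cube N → Matrix (Fin p) (Fin q) ℂ)
    (k : Cube (N - n)) : Matrix (Fin p) (Fin q) ℂ :=
  Matrix.of fun a b => ∫ s : Cube n, F (glue n s k) a b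

/-- `⟨f⟩_n`: the coordinatewise integral of a vector-valued function over the first `n` variables,
as a function of the remaining ones. -/
def avgVec {N : ℕ} {p : ℕ} (n : ℕ) (f : Cube N → Fin p → ℂ) (k : Cube (N - n)) : Fin p → ℂ :=
  fun a => ∫ s : Cube n, f (glue n s k) a

/-- The Hilbert space `L²([0,1]^N, ℂ^M)`. -/
abbrev L2 (N M : ℕ) : Type :=
  Lp (EuclideanSpace ℂ (Fin M)) 2 (volume : Measure (Cube N))

/-- `T` is the operator of multiplication by the continuous matrix-valued function `A`. -/
def IsMul {N M : ℕ} (A : C(Cube N, Matrix (Fin M) (Fin M) ℂ)) (T : L2 N M →L[ℂ] L2 N M) : Prop :=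
  ∀ u : L2 N M, ∀ᵐ k ∂(volume : Measure (Cube N)), (T u k).ofLp = A k *ᵥ (u k).ofLp

/-- `T` is the operator `⟨·⟩_n` of integration over the first `n` variables. -/
def IsAvg {N M : ℕ} (n : ℕ) (T : L2 N M →L[ℂ] L2 N M) : Prop :=
  ∀ u : L2 N M, ∀ᵐ k ∂(volume : Measure (Cube N)),
    (T u k).ofLp = avgVec n (fun k' => (u k').ofLp) (tail n k)

/-- The (non-closed) algebra `H_{N,M}` generated by the operators of multiplication by continuous
matrix-valued functions and by the integral operators `⟨·⟩_1, …, ⟨·⟩_N`. -/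
def H (N M : ℕ) : Subalgebra ℂ (L2 N M →L[ℂ] L2 N M) :=
  Algebra.adjoin ℂ ({T | ∃ A, IsMul A T} ∪ {T | ∃ j : Fin N, IsAvg (j.1 + 1) T})

/-- The coefficients of an expression `A₀ u + A₁⟨B₁ u⟩₁ + … + A_N⟨B_N u⟩_N`.
The index `j : Fin N` stands for the index `j + 1 ∈ {1, …, N}`. -/
structure OpForm (N M : ℕ) where
  A0 : C(Cube N, Matrix (Fin M) (Fin M) ℂ)
  m : Fin N → ℕ
  m_pos : ∀ j, 0 < m j
  A : ∀ j, C(Cube N, Matrix (Fin M) (Fin (m j)) ℂ)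
  B : ∀ j, C(Cube N, Matrix (Fin (m j)) (Fin M) ℂ)

variable {N M : ℕ}

/-- `T u = A₀ u + A₁⟨B₁ u⟩₁ + … + A_N⟨B_N u⟩_N` for all `u`. -/
def OpForm.Represents (a : OpForm N M) (T : L2 N M →L[ℂ] L2 N M) : Prop :=
  ∀ u : L2 N M, ∀ᵐ k ∂(volume : Measure (Cube N)),
    (T u k).ofLp = a.A0 k *ᵥ (u k).ofLp +
      ∑ j : Fin N, a.A j k *ᵥ
        avgVec (j.1 + 1) (fun k' => a.B j k' *ᵥ (u k').ofLp) (tail (j.1 + 1) k)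

/-- The functions `A_{j,r}` of the elimination scheme: `A_{j,0} = A₀⁻¹ A_j` and
`A_{j,r+1} = A_{j,r} - A_{r+1,r} E_{r+1}⁻¹ ⟨B_{r+1} A_{j,r}⟩_{r+1}`, where
`E_{r+1} = I + ⟨B_{r+1} A_{r+1,r}⟩_{r+1}`. -/
def OpForm.red (a : OpForm N M) : ℕ → (j : Fin N) → Cube N → Matrix (Fin M) (Fin (a.m j)) ℂ
  | 0 => fun j k => (a.A0 k)⁻¹ * a.A j k
  | r + 1 => fun j k =>
      if h : r < N then
        a.red r j k - a.red r ⟨r, h⟩ k *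
          (1 + avgMat (r + 1) (fun k' => a.B ⟨r, h⟩ k' * a.red r ⟨r, h⟩ k') (tail (r + 1) k))⁻¹ *
          avgMat (r + 1) (fun k' => a.B ⟨r, h⟩ k' * a.red r j k') (tail (r + 1) k)
      else a.red r j k

/-- `E_{j+1} = I + ⟨B_{j+1} A_{j+1,j}⟩_{j+1}`. -/
def OpForm.E (a : OpForm N M) (j : Fin N) (k : Cube (N - (j.1 + 1))) :
    Matrix (Fin (a.m j)) (Fin (a.m j)) ℂ :=
  1 + avgMat (j.1 + 1) (fun k' => a.B j k' * a.red j.1 j k') k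

/-- A point of `[0,1]^{N-0}` as a point of `[0,1]^N`. -/
def full {N : ℕ} (k : Cube (N - (0 : Fin (N + 1)).1)) : Cube N := fun i => k ⟨i.1, by simp⟩

/-- The determinants `π₀ = det A₀`, `π_j = det E_j` (`1 ≤ j ≤ N`); `π_j` is a function of
the last `N - j` variables. -/
def OpForm.det (a : OpForm N M) : (j : Fin (N + 1)) → Cube (N - j.1) → ℂ :=
  Fin.cases (motive := fun j : Fin (N + 1) => Cube (N - j.1) → ℂ)
    (fun k => (a.A0 (full k)).det) (fun j k => (a.E j k).det)

/-- The sum of the square roots of the (non-negative) eigenvalues of a matrix, counted with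
algebraic multiplicity. -/
def sumSqrtEig {p : ℕ} (C : Matrix (Fin p) (Fin p) ℂ) : ℝ :=
  (C.charpoly.roots.map fun z => Real.sqrt z.re).sum

/-- The functions `g_j`: sums of the square roots of the eigenvalues of
`C₀ = A₀* A₀` and of `C_j = ⟨B_j B_j*⟩_j ⟨A_j* A_j⟩_j`, `1 ≤ j ≤ N`. -/
def OpForm.g (a : OpForm N M) : (j : Fin (N + 1)) → Cube (N - j.1) → ℝ :=
  Fin.cases (motive := fun j : Fin (N + 1) => Cube (N - j.1) → ℝ)
    (fun k => sumSqrtEig ((a.A0 (full k))ᴴ * a.A0 (full k)))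
    (fun j k => sumSqrtEig
      (avgMat (j.1 + 1) (fun k' => a.B j k' * (a.B j k')ᴴ) k *
        avgMat (j.1 + 1) (fun k' => (a.A j k')ᴴ * a.A j k') k))

/-- `∑_j max g_j`. -/
def OpForm.trNorm (a : OpForm N M) : ℝ := ∑ j, ⨆ k, a.g j k

open Classical in
/-- The trace norm of an operator, computed from some representation of it. -/
def trNorm (A : H N M) : ℝ :=
  if h : ∃ a : OpForm N M, a.Represents A.1 then h.choose.trNorm else 0

open Classical in
/-- The vector-valued determinant `π = (π₀, …, π_N)` of an operator, computed from some
representation of it (meaningful for invertible operators). -/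
def opDet (A : H N M) : (j : Fin (N + 1)) → Cube (N - j.1) → ℂ :=
  if h : ∃ a : OpForm N M, a.Represents A.1 then h.choose.det else 0

/-- `f` is the trace `τ(A) = lim_{t → 0} (π(1 + t A) - π(1)) / t`; the limit is taken in the
sup-norm of each component. -/
def IsTrace (A : H N M) (f : (j : Fin (N + 1)) → Cube (N - j.1) → ℂ) : Prop :=
  ∀ j, TendstoUniformly
    (fun (t : ℂ) (k : Cube (N - j.1)) => (opDet (1 + t • A) j k - opDet (1 : H N M) j k) / t)
    (f j) (𝓝[≠] 0)

/-- The commutative Banach algebra `C₀ × … × C_N` with `C_j = C([0,1]^{N-j}, ℂ)`,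
componentwise operations and the norm `max_j max_k |f_j(k)|`. -/
abbrev CAlg (N : ℕ) : Type := (j : Fin (N + 1)) → C(Cube (N - j.1), ℂ)

/-- `ι` exhibits the Banach algebra `K` as a completion of `H_{N,M}` under the trace norm. -/
structure IsTrCompletion {K : Type*} [NormedRing K] [NormedAlgebra ℂ K] (ι : H N M →ₐ[ℂ] K) :
    Prop where
  complete : CompleteSpace K
  norm_eq : ∀ A : H N M, ‖ι A‖ = trNorm A
  dense : DenseRange ι

end

end PeriodicDefect

open PeriodicDefect

namespace PeriodicDefect

noncomputable section

/-! ### Averages over the first coordinates -/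

section

/-! Call `u ↦ α⟨⟨β, u⟩⟩_n` an elementary operator of degree `n`; multiplications have degree 0.
Freeze the last `N - j` coordinates at those of `k`. Then the terms of degree below `j` act inside
the fiber (`low`), the terms of degree `j` become an operator of finite rank (`fib`), and higher
degrees are ignored. All fibers are modelled inside the one space `L2 N M`, with coefficients that
depend on the first `j` coordinates only.

Degrees multiply by taking the maximum, so `low` is multiplicative and `fib (AB) = fib A fib B + low
A fib B + fib A low B` (`exists_isProd`). A peaking argument (`exists_peak`, `actPart_eq_zero`)
shows that these fiber operators depend on the operator alone and not on its representation.

Norm: `g_j` at `k` is the nuclear norm of `fib j k` (`OpForm.Represents.g_tail`), which is described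
by duality with finite rank operators. The product formula and the ideal property of the nuclear
norm bound each degree of `AB`, and the bounds add up to the product of the norms. Fubini over the
fibers gives the comparison with the operator norm.

Determinant: `π_j` at `k` is the Fredholm determinant of `low⁻¹ (low + fib)`, with unital versions
`psi`, `phi` of the two factors (`OpForm.Represents.det_tail`). The elimination scheme is the
recursive computation of `(A_0 + … + A_r⟨B_r·⟩_r)⁻¹ A_j` (`OpForm.Represents.exists_red`). Hence `π`
is independent of the representation and multiplicative. The same elimination inverts, inside the
incomplete algebra `H`, every operator whose fiber operators are invertible, in particular `1 + C`
with `trNorm C < 1`.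

Trace and logarithm: `τ_j` is the trace of `fib j k`, bounded by the nuclear norm. It is the
derivative of the determinant at the identity; by multiplicativity the logarithmic derivative of
`π(1 + tC)` is `τ((1 + tC)⁻¹ C)`, and integration gives `π(1 + C) = exp τ(ln(1 + C))`
(`fiberDet_one_add_eq_exp`).

Completion: `τ` extends by continuity. An invertible `U` has some invertible `A` in `H` with `A⁻¹U`
near 1, and `π(U) = π(A) exp τ(ln(A⁻¹U))` extends `π` continuously (`IsTrCompletion.detK_eq`). The
choice `A = λ` yields the final formula. -/

instance isOpenPosMeasure_unitInterval : Measure.IsOpenPosMeasure (volume : Measure I) := by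
  refine ⟨fun U hU hne h0 => ?_⟩
  obtain ⟨W, hW, rfl⟩ := isOpen_induced_iff.1 hU
  obtain ⟨x, hx⟩ := hne
  -- The given point may be an endpoint of `I`; a nearby point of the open interval lies in a
  -- nonempty open subset of `ℝ`.
  have hxc : (x : ℝ) ∈ closure (Set.Ioo (0 : ℝ) 1) := by
    rw [closure_Ioo (by norm_num)]; exact x.2
  obtain ⟨y, hyW, hy⟩ := mem_closure_iff.1 hxc W hW hx
  have h1 : volume (W ∩ Set.Ioo (0 : ℝ) 1) ≠ 0 :=
    ((hW.inter isOpen_Ioo).measure_pos volume ⟨y, hyW, hy⟩).ne'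
  apply h1
  have h2 : (volume : Measure I) (Subtype.val ⁻¹' W)
      = volume (Subtype.val '' (Subtype.val ⁻¹' W : Set I)) :=
    comap_subtype_coe_apply measurableSet_Icc _ _
  refine measure_mono_null ?_ (h2.symm.trans h0)
  rintro z ⟨hz, hz'⟩
  exact ⟨⟨z, hz'.1.le, hz'.2.le⟩, hz, rfl⟩

/-- The point with coordinates `s i` for `i < n` and `k i` for `i ≥ n`. -/
def mix {N : ℕ} (n : ℕ) (s k : Cube N) : Cube N := fun i => if i.1 < n then s i else k i

variable {N M : ℕ}

lemma continuous_mix (n : ℕ) : Continuous fun p : Cube N × Cube N => mix n p.1 p.2 := by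
  refine continuous_pi fun i => ?_
  by_cases h : i.1 < n <;> simp only [mix, h, if_true, if_false] <;> fun_prop

lemma mix_mix_of_le {i j : ℕ} (h : i ≤ j) (t s k : Cube N) :
    mix i t (mix j s k) = mix j (mix i t s) k := by
  funext l; simp only [mix]; split_ifs <;> first | rfl | omega

lemma mix_mix_of_ge {i j : ℕ} (h : j ≤ i) (t s k : Cube N) :
    mix i t (mix j s k) = mix i t k := by
  funext l; simp only [mix]; split_ifs <;> first | rfl | omega

lemma mix_zero (s k : Cube N) : mix 0 s k = k := by
  funext l; simp [mix]

lemma mix_of_le {n : ℕ} (h : N ≤ n) (s k : Cube N) : mix n s k = s := by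
  funext l; simp [mix, l.2.trans_le h]

/-- Each coordinate of the mixture comes from exactly one of two independent uniform points, so the
mixture is uniform. This is Fubini for the splitting of the coordinates, without leaving `Cube N`.
-/
lemma measurePreserving_mix (n : ℕ) : MeasurePreserving
    (fun p : Cube N × Cube N => mix n p.1 p.2) (volume.prod volume) volume := by
  refine ⟨(continuous_mix n).measurable, ?_⟩
  symm
  refine Measure.pi_eq fun t ht => ?_
  rw [Measure.map_apply (continuous_mix n).measurable (MeasurableSet.univ_pi ht)]
  have hpre : (fun p : Cube N × Cube N => mix n p.1 p.2) ⁻¹' (Set.univ.pi t)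
      = (Set.univ.pi fun i => if i.1 < n then t i else Set.univ) ×ˢ
        (Set.univ.pi fun i => if i.1 < n then Set.univ else t i) := by
    ext p
    simp only [Set.mem_preimage, Set.mem_pi, Set.mem_univ, true_imp_iff, Set.mem_prod, mix]
    constructor
    · intro h
      constructor <;> intro i <;> have := h i <;> split_ifs with hi <;> simp_all
    · rintro ⟨h1, h2⟩ i
      have := h1 i; have := h2 i; split_ifs with hi <;> simp_all
  rw [hpre, Measure.prod_prod, volume_pi, Measure.pi_pi, Measure.pi_pi,
    ← Finset.prod_mul_distrib]
  refine Finset.prod_congr rfl fun i _ => ?_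
  split_ifs <;> simp

/-- Restriction of a point of the cube to its first `n` coordinates. -/
def head {N : ℕ} {n : ℕ} (h : n ≤ N) (s : Cube N) : Cube n := fun i => s ⟨i.1, i.2.trans_le h⟩

lemma continuous_head {n : ℕ} (h : n ≤ N) : Continuous (head h) := by
  unfold head; fun_prop

lemma measurePreserving_head {n : ℕ} (h : n ≤ N) :
    MeasurePreserving (head h) (volume : Measure (Cube N)) volume := by
  refine ⟨(continuous_head h).measurable, ?_⟩
  symm
  refine Measure.pi_eq fun t ht => ?_
  rw [Measure.map_apply (continuous_head h).measurable (MeasurableSet.univ_pi ht)]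
  have hpre : head h ⁻¹' (Set.univ.pi t)
      = Set.univ.pi fun i : Fin N => if hi : i.1 < n then t ⟨i.1, hi⟩ else Set.univ := by
    ext p
    simp only [Set.mem_preimage, Set.mem_pi, Set.mem_univ, true_imp_iff, head]
    constructor
    · intro h i
      split_ifs with hi
      · exact h ⟨i, hi⟩
      · trivial
    · intro h1 i
      have := h1 ⟨i.1, i.2.trans_le h⟩
      simpa [i.2] using this
  rw [hpre, volume_pi, Measure.pi_pi]
  obtain ⟨d, rfl⟩ := Nat.exists_eq_add_of_le h
  rw [Fin.prod_univ_add]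
  have : ∏ i : Fin d, (volume : Measure I)
      (if hi : (Fin.natAdd n i).1 < n then t ⟨(Fin.natAdd n i).1, hi⟩ else Set.univ) = 1 := by
    refine Finset.prod_eq_one fun i _ => ?_
    simp
  rw [this, mul_one]
  refine Finset.prod_congr rfl fun i _ => ?_
  simp

lemma glue_head_tail {n : ℕ} (h : n ≤ N) (s k : Cube N) :
    glue n (head h s) (tail n k) = mix n s k := by
  funext i
  simp only [glue, head, tail, mix]
  split_ifs with hi
  · rfl
  · congr 1; ext; simp; omega

/-- A point of the cube with prescribed last coordinates. -/
def ext (n : ℕ) (κ : Cube (N - n)) : Cube N := glue n (fun _ => 0) κ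

lemma continuous_ext (n : ℕ) : Continuous (ext n : Cube (N - n) → Cube N) := by
  refine continuous_pi fun i => ?_
  by_cases h : i.1 < n <;> simp only [ext, glue, h, dif_pos, dif_neg, not_false_eq_true] <;> fun_prop

lemma tail_ext {n : ℕ} (κ : Cube (N - n)) : tail n (ext n κ) = κ := by
  funext i
  simp [tail, ext, glue]

lemma full_tail (k : Cube N) : full (tail 0 k : Cube (N - 0)) = k := by
  funext i; simp [full, tail]

/-- The integral over the first `n` coordinates, as a function of all coordinates. -/
def avg (n : ℕ) (g : Cube N → ℂ) (k : Cube N) : ℂ := ∫ s, g (mix n s k)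

/-- Bridge from integrals over `Cube n` to `avg`: the additional dummy coordinates integrate to one.
-/
lemma integral_glue {n : ℕ} (h : n ≤ N) {g : Cube N → ℂ} (hg : Measurable g) (k : Cube N) :
    ∫ s, g (glue n s (tail n k)) = avg n g k := by
  have hm : Measurable fun s : Cube n => glue n s (tail n k) := by
    refine measurable_pi_lambda _ fun i => ?_
    by_cases hi : i.1 < n <;> simp only [glue, hi, dif_pos, dif_neg, not_false_eq_true] <;> fun_prop
  unfold avg
  have := integral_map (μ := (volume : Measure (Cube N))) (continuous_head h).aemeasurable
    (f := fun s => g (glue n s (tail n k))) (hg.comp hm).aestronglyMeasurable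
  rw [(measurePreserving_head h).map_eq] at this
  simpa only [glue_head_tail] using this

lemma continuous_avg (n : ℕ) {g : Cube N → ℂ} (hg : Continuous g) : Continuous (avg n g) := by
  have := continuous_parametric_integral_of_continuous (μ := (volume : Measure (Cube N)))
    (f := fun (k s : Cube N) => g (mix n s k))
    (hg.comp ((continuous_mix n).comp continuous_swap)) isCompact_univ
  rw [Measure.restrict_univ] at this
  exact this

lemma avg_mix {i n : ℕ} (h : i ≤ n) (g : Cube N → ℂ) (s k : Cube N) :
    avg n g (mix i s k) = avg n g k := by
  simp only [avg, mix_mix_of_ge h]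

lemma integrable_of_continuous {F : Type*} [NormedAddCommGroup F] {g : Cube N → F}
    (hg : Continuous g) :
    Integrable g volume := hg.integrable_of_hasCompactSupport (HasCompactSupport.of_compactSpace g)

lemma continuous_mix_left (n : ℕ) (k : Cube N) : Continuous fun s : Cube N => mix n s k :=
  (continuous_mix n).comp (by fun_prop : Continuous fun s : Cube N => (s, k))

lemma integral_avg (n : ℕ) {g : Cube N → ℂ} (hg : Continuous g) :
    ∫ k, avg n g k = ∫ k, g k := by
  have h : ∫ p : Cube N × Cube N, g (mix n p.1 p.2) ∂(volume.prod volume) = ∫ k, g k := by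
    rw [← integral_map (measurePreserving_mix n).measurable.aemeasurable
      hg.aestronglyMeasurable, (measurePreserving_mix n).map_eq]
  rw [← h, integral_prod_symm]
  · rfl
  · exact (measurePreserving_mix n).integrable_comp_of_integrable (integrable_of_continuous hg)

/-- The tower property of conditional expectations: `integral_avg` applied to the fiber through `k`.
-/
lemma avg_avg {i j : ℕ} (h : i ≤ j) {g : Cube N → ℂ} (hg : Continuous g) :
    avg j (avg i g) = avg j g := by
  funext k
  have := integral_avg i (g := fun s => g (mix j s k)) (hg.comp (continuous_mix_left j k))
  simp only [avg, ← mix_mix_of_le h] at this ⊢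
  exact this

lemma avg_mul_avg {i j : ℕ} (h : i ≤ j) (g f : Cube N → ℂ) (k : Cube N) :
    avg i (fun k => g k * avg j f k) k = avg i g k * avg j f k := by
  simp only [avg, mix_mix_of_ge h]
  rw [← integral_mul_const]

/-- Conditional expectations are symmetric: both sides equal the average over `j` variables of `avg
i g * avg i f`. -/
lemma avg_mul_avg_symm {i j : ℕ} (h : i ≤ j) {g f : Cube N → ℂ} (hg : Continuous g)
    (hf : Continuous f) (k : Cube N) :
    avg j (fun k => g k * avg i f k) k = avg j (fun k => avg i g k * f k) k := by
  have hg' := continuous_avg i hg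
  have hf' := continuous_avg i hf
  rw [← avg_avg h (g := fun k => g k * avg i f k) (hg.mul hf'),
    ← avg_avg h (g := fun k => avg i g k * f k) (hg'.mul hf)]
  congr 1
  funext l
  rw [avg_mul_avg le_rfl]
  simp only [mul_comm (avg i g _) (f _)]
  rw [avg_mul_avg le_rfl, mul_comm]

/-! ### Elementary operators on continuous functions -/

/-- Continuous vector-valued functions on the cube. -/
abbrev V (N M : ℕ) : Type := C(Cube N, EuclideanSpace ℂ (Fin M))

/-- Restriction to a fiber: the last coordinates of the variable are frozen at those of `k`. -/
def frz (n : ℕ) (k : Cube N) : V N M →ₗ[ℂ] V N M where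
  toFun f := ⟨fun s => f (mix n s k), f.continuous.comp (continuous_mix_left n k)⟩
  map_add' _ _ := rfl
  map_smul' _ _ := rfl

@[simp] lemma frz_apply (n : ℕ) (k : Cube N) (f : V N M) (s : Cube N) :
    frz n k f s = f (mix n s k) := rfl

/-- The pointwise inner product. -/
def ip (β f : V N M) : C(Cube N, ℂ) := ⟨fun k => inner ℂ (β k) (f k), by fun_prop⟩

/-- `avg` as a map on continuous functions. -/
def avgC (n : ℕ) (g : C(Cube N, ℂ)) : C(Cube N, ℂ) := ⟨avg n g, continuous_avg n g.continuous⟩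

lemma avg_add (n : ℕ) {f g : Cube N → ℂ} (hf : Continuous f) (hg : Continuous g) (k : Cube N) :
    avg n (fun k => f k + g k) k = avg n f k + avg n g k :=
  integral_add (integrable_of_continuous (hf.comp (continuous_mix_left n k)))
    (integrable_of_continuous (hg.comp (continuous_mix_left n k)))

lemma avg_const_mul (n : ℕ) (c : ℂ) (g : Cube N → ℂ) (k : Cube N) :
    avg n (fun k => c * g k) k = c * avg n g k := integral_const_mul _ _

/-- The operator `f ↦ α ⟨⟨β, f⟩⟩_n` on continuous functions. -/
def act (n : ℕ) (α β : V N M) : V N M →ₗ[ℂ] V N M where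
  toFun f := avgC n (ip β f) • α
  map_add' f g := by
    ext1 k
    have : avg n (ip β (f + g)) k = avg n (ip β f) k + avg n (ip β g) k := by
      rw [← avg_add n (ip β f).continuous (ip β g).continuous]
      simp [ip]
    change avg n (ip β (f + g)) k • α k = avg n (ip β f) k • α k + avg n (ip β g) k • α k
    rw [this, add_smul]
  map_smul' c f := by
    ext1 k
    have : avg n (ip β (c • f)) k = c * avg n (ip β f) k := by
      rw [← avg_const_mul]
      simp [ip]
    change avg n (ip β (c • f)) k • α k = c • avg n (ip β f) k • α k
    rw [this, mul_smul]

lemma act_apply (n : ℕ) (α β f : V N M) (k : Cube N) :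
    act n α β f k = avg n (ip β f) k • α k := rfl

lemma frz_act_of_le {i j : ℕ} (h : i ≤ j) (k : Cube N) (α β f : V N M) :
    frz j k (act i α β f) = act i (frz j k α) (frz j k β) (frz j k f) := by
  ext1 s
  simp only [frz_apply, act_apply, avg, mix_mix_of_le h]
  rfl

/-- The inner average does not depend on the first `j` variables, hence comes out of the average
over the first `i`. The left factor of lower degree is absorbed into `α'`. -/
lemma act_act_of_le {i j : ℕ} (h : i ≤ j) (α β α' β' f : V N M) :
    act i α β (act j α' β' f) = act j (act i α β α') β' f := by
  ext1 k
  simp only [act_apply]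
  have : avg i (ip β (act j α' β' f)) k
      = avg i (fun k => ip β α' k * avg j (ip β' f) k) k := by
    congr 1; funext k
    simp [ip, act_apply, mul_comm]
  rw [this, avg_mul_avg h, smul_smul, mul_comm]

lemma conj_avg_ip (n : ℕ) (α β : V N M) (k : Cube N) :
    starRingEnd ℂ (avg n (ip α β) k) = avg n (ip β α) k := by
  simp only [avg, ← integral_conj, ip, ContinuousMap.coe_mk, inner_conj_symm]

/-- Mirror image of `act_act_of_le`: by symmetry of the average the right factor of lower degree
moves as an adjoint onto `β`. -/
lemma act_act_of_ge {i j : ℕ} (h : j ≤ i) (α β α' β' f : V N M) :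
    act i α β (act j α' β' f) = act i α (act j β' α' β) f := by
  ext1 k
  simp only [act_apply]
  congr 1
  have h1 : avg i (ip β (act j α' β' f)) k
      = avg i (fun k => ip β α' k * avg j (ip β' f) k) k := by
    congr 1; funext k
    simp [ip, act_apply, mul_comm]
  have h2 : avg i (ip (act j β' α' β) f) k
      = avg i (fun k => avg j (ip β α') k * ip β' f k) k := by
    congr 1; funext k
    rw [← conj_avg_ip]
    simp [ip, act_apply, mul_comm]
  rw [h1, h2, avg_mul_avg_symm h (ip β α').continuous (ip β' f).continuous]

/-- The embedding of continuous functions into `L²`. -/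
def J : V N M →L[ℂ] L2 N M := ContinuousMap.toLp 2 volume ℂ

lemma J_dense : DenseRange (J : V N M →L[ℂ] L2 N M) :=
  ContinuousMap.toLp_denseRange _ _ _ (by simp)

/-- The measure charges every nonempty open set, so continuous functions that agree almost
everywhere agree. -/
lemma J_injective : Function.Injective (J : V N M →L[ℂ] L2 N M) :=
  ContinuousMap.toLp_injective volume

lemma coeFn_J (f : V N M) : (J f : Cube N → EuclideanSpace ℂ (Fin M)) =ᵐ[volume] f :=
  ContinuousMap.coeFn_toLp volume f

lemma inner_J (f g : V N M) : inner ℂ (J f) (J g) = ∫ k, ip f g k := by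
  rw [L2.inner_def]
  refine integral_congr_ae ?_
  filter_upwards [coeFn_J f, coeFn_J g] with k h1 h2
  rw [h1, h2]; rfl

end

/-! ### Nuclear norm bounds -/

section

open InnerProductSpace

/-- The characteristic polynomials of `AB` and `BA` agree up to powers of `X`, and the root 0
contributes `√0 = 0`. -/
lemma sumSqrtEig_mul_comm {p q : ℕ} (A : Matrix (Fin p) (Fin q) ℂ) (B : Matrix (Fin q) (Fin p) ℂ) :
    sumSqrtEig (A * B) = sumSqrtEig (B * A) := by
  have h := congrArg (fun P : Polynomial ℂ => (P.roots.map fun z : ℂ => Real.sqrt z.re).sum)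
    (Matrix.charpoly_mul_comm' A B)
  have h0 : ∀ (n : ℕ) (P : Polynomial ℂ), P ≠ 0 →
      (((Polynomial.X ^ n * P).roots).map fun z : ℂ => Real.sqrt z.re).sum
        = (P.roots.map fun z : ℂ => Real.sqrt z.re).sum := by
    intro n P hP
    rw [Polynomial.roots_mul (mul_ne_zero (pow_ne_zero _ Polynomial.X_ne_zero) hP)]
    simp [Multiset.map_nsmul, Multiset.sum_nsmul]
  simp only [h0 _ _ (Matrix.charpoly_monic _).ne_zero] at h
  exact h

lemma sumSqrtEig_of_isHermitian {p : ℕ} {S : Matrix (Fin p) (Fin p) ℂ} (hS : S.IsHermitian) :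
    sumSqrtEig S = ∑ i, Real.sqrt (hS.eigenvalues i) := by
  rw [sumSqrtEig, hS.roots_charpoly_eq_eigenvalues, Multiset.map_map]
  rfl

variable {E : Type*} [NormedAddCommGroup E] [InnerProductSpace ℂ E]

/-- `C` bounds the trace norm of `T`, by duality with finite rank operators. -/
def NucLe (T : E →L[ℂ] E) (C : ℝ) : Prop :=
  ∀ (n : ℕ) (ξ η : Fin n → E),
    ‖∑ i, inner ℂ (η i) (T (ξ i))‖ ≤ C * ‖∑ i, rankOne ℂ (ξ i) (η i)‖

lemma NucLe.add {T S : E →L[ℂ] E} {C D : ℝ} (hT : NucLe T C) (hS : NucLe S D) :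
    NucLe (T + S) (C + D) := by
  intro n ξ η
  simp only [_root_.add_apply, inner_add_right, Finset.sum_add_distrib, add_mul]
  exact (norm_add_le _ _).trans (add_le_add (hT n ξ η) (hS n ξ η))

lemma NucLe.smul {T : E →L[ℂ] E} {C : ℝ} (hT : NucLe T C) (c : ℂ) :
    NucLe (c • T) (‖c‖ * C) := by
  intro n ξ η
  simp only [_root_.smul_apply, inner_smul_right, ← Finset.mul_sum, norm_mul, mul_assoc]
  exact mul_le_mul_of_nonneg_left (hT n ξ η) (norm_nonneg _)

lemma NucLe.mono {T : E →L[ℂ] E} {C D : ℝ} (hT : NucLe T C) (h : C ≤ D) : NucLe T D :=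
  fun n ξ η => (hT n ξ η).trans (mul_le_mul_of_nonneg_right h (norm_nonneg _))

/-- The test operator is the single rank one operator built from `x` and `T x`. -/
lemma NucLe.norm_le {T : E →L[ℂ] E} {C : ℝ} (hC : 0 ≤ C) (hT : NucLe T C) : ‖T‖ ≤ C := by
  refine T.opNorm_le_bound hC fun x => ?_
  have h := hT 1 (fun _ => x) (fun _ => T x)
  simp only [Fin.sum_univ_one, norm_rankOne] at h
  rw [inner_self_eq_norm_sq_to_K, norm_pow, RCLike.norm_ofReal, abs_norm] at h
  rcases (norm_nonneg (T x)).eq_or_lt with h0 | h0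
  · rw [← h0]; positivity
  · exact le_of_mul_le_mul_right (by nlinarith) h0

lemma NucLe.mul_left [CompleteSpace E] {T : E →L[ℂ] E} {C : ℝ} (hC : 0 ≤ C) (hT : NucLe T C)
    (S : E →L[ℂ] E) : NucLe (S * T) (‖S‖ * C) := by
  intro n ξ η
  have h := hT n ξ (fun i => S.adjoint (η i))
  simp only [ContinuousLinearMap.adjoint_inner_left] at h
  refine h.trans ?_
  have : ∑ i, rankOne ℂ (ξ i) (S.adjoint (η i)) = (∑ i, rankOne ℂ (ξ i) (η i)) * S := by
    rw [Finset.sum_mul]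
    refine Finset.sum_congr rfl fun i _ => ?_
    ext z
    simp [ContinuousLinearMap.adjoint_inner_left]
  rw [this]
  calc _ ≤ C * (‖∑ i, rankOne ℂ (ξ i) (η i)‖ * ‖S‖) :=
        mul_le_mul_of_nonneg_left (norm_mul_le _ _) hC
    _ = _ := by ring

lemma NucLe.mul_right {T : E →L[ℂ] E} {C : ℝ} (hC : 0 ≤ C) (hT : NucLe T C)
    (S : E →L[ℂ] E) : NucLe (T * S) (C * ‖S‖) := by
  intro n ξ η
  have h := hT n (fun i => S (ξ i)) η
  refine h.trans ?_
  have : ∑ i, rankOne ℂ (S (ξ i)) (η i) = S * (∑ i, rankOne ℂ (ξ i) (η i)) := by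
    rw [Finset.mul_sum]
    refine Finset.sum_congr rfl fun i _ => ?_
    ext z
    simp
  rw [this, mul_assoc]
  exact mul_le_mul_of_nonneg_left (norm_mul_le _ _) hC

lemma NucLe.zero : NucLe (0 : E →L[ℂ] E) 0 := by
  intro n ξ η; simp

lemma NucLe.mul [CompleteSpace E] {T S : E →L[ℂ] E} {C D : ℝ} (hC : 0 ≤ C) (hD : 0 ≤ D)
    (hT : NucLe T C) (hS : NucLe S D) :
    NucLe (T * S) (C * D) :=
  (hS.mul_left hD T).mono (mul_le_mul_of_nonneg_right (hT.norm_le hC) hD)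

lemma nucLe_rankOne (a b : E) : NucLe (rankOne ℂ a b) (‖a‖ * ‖b‖) := by
  intro n ξ η
  have h : ∑ i, inner ℂ (η i) (rankOne ℂ a b (ξ i))
      = inner ℂ b ((∑ i, rankOne ℂ (ξ i) (η i)) a) := by
    simp only [_root_.sum_apply, rankOne_apply, inner_sum, inner_smul_right]
    exact Finset.sum_congr rfl fun i _ => mul_comm _ _
  rw [h]
  refine (norm_inner_le_norm _ _).trans ?_
  calc _ ≤ ‖b‖ * (‖∑ i, rankOne ℂ (ξ i) (η i)‖ * ‖a‖) :=
        mul_le_mul_of_nonneg_left (ContinuousLinearMap.le_opNorm _ _) (norm_nonneg _)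
    _ = _ := by ring

lemma nucLe_sum {ι : Type*} (s : Finset ι) {T : ι → E →L[ℂ] E} {C : ι → ℝ}
    (h : ∀ i ∈ s, NucLe (T i) (C i)) : NucLe (∑ i ∈ s, T i) (∑ i ∈ s, C i) := by
  classical
  induction s using Finset.induction_on with
  | empty => simpa using NucLe.zero
  | insert i s hi ih =>
    rw [Finset.sum_insert hi, Finset.sum_insert hi]
    exact (h i (Finset.mem_insert_self _ _)).add
      (ih fun j hj => h j (Finset.mem_insert_of_mem hj))

/-- The finite rank operator `∑ |a_c⟩⟨b_c|`. -/
def finRank {m : ℕ} (a b : Fin m → E) : E →L[ℂ] E := ∑ c, rankOne ℂ (a c) (b c)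

lemma finRank_apply {m : ℕ} (a b : Fin m → E) (x : E) :
    finRank a b x = ∑ c, inner ℂ (b c) x • a c := by
  simp [finRank]

/-- Singular value decomposition of `T = finRank a b`, which vanishes on the orthogonal complement
of `F = span b`. In an orthonormal basis of `F` let `R` be the matrix of the functionals `⟨b_c, ·⟩`.
Then `T*T` restricted to `F` has the matrix `S = Rᴴ (gram a) R`, while `gram b = R Rᴴ`, so `gram b *
gram a` and `S` have the same nonzero eigenvalues. The `y i` are eigenvectors of `S`, with
orthogonal images whose squared norms are the eigenvalues. -/
lemma exists_singular_vectors {m : ℕ} (a b : Fin m → E) :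
    ∃ (r : ℕ) (y : Fin r → E), Orthonormal ℂ y ∧
      (∀ c, ∑ i, inner ℂ (y i) (b c) • y i = b c) ∧
      (∀ i j, i ≠ j → inner ℂ (finRank a b (y i)) (finRank a b (y j)) = 0) ∧
      sumSqrtEig (gram ℂ b * gram ℂ a) = ∑ i, ‖finRank a b (y i)‖ := by
  set F : Submodule ℂ E := Submodule.span ℂ (Set.range b) with hF
  have : FiniteDimensional ℂ F := FiniteDimensional.span_of_finite ℂ (Set.finite_range b)
  have hbF : ∀ c, b c ∈ F := fun c => Submodule.subset_span ⟨c, rfl⟩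
  set e := stdOrthonormalBasis ℂ F
  set R : Matrix (Fin m) (Fin (Module.finrank ℂ F)) ℂ := Matrix.of fun c l => inner ℂ (b c) (e l : E)
    with hR
  have hgb : gram ℂ b = R * Rᴴ := by
    ext c d
    have := e.sum_inner_mul_inner ⟨b c, hbF c⟩ ⟨b d, hbF d⟩
    simp only [Submodule.coe_inner] at this
    simp [Matrix.mul_apply, hR, gram, ← this]
  set S := Rᴴ * gram ℂ a * R with hSdef
  have hga : (gram ℂ a).IsHermitian := by
    ext c d; simp [gram]
  have hS : S.IsHermitian := by
    rw [Matrix.IsHermitian, hSdef, conjTranspose_mul, conjTranspose_mul, conjTranspose_conjTranspose,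
      hga.eq, Matrix.mul_assoc]
  have hsum : sumSqrtEig (gram ℂ b * gram ℂ a) = ∑ i, Real.sqrt (hS.eigenvalues i) := by
    rw [hgb, Matrix.mul_assoc, sumSqrtEig_mul_comm, ← sumSqrtEig_of_isHermitian hS]
  set y0 := hS.eigenvectorBasis.map e.repr.symm with hy0
  have hT : ∀ v : EuclideanSpace ℂ (Fin (Module.finrank ℂ F)),
      finRank a b (e.repr.symm v : E) = ∑ c, (R *ᵥ v.ofLp) c • a c := by
    intro v
    rw [finRank_apply]
    refine Finset.sum_congr rfl fun c _ => ?_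
    congr 1
    have : ((e.repr.symm v : F) : E) = ∑ l, v l • (e l : E) := by
      rw [← e.sum_repr_symm]; simp
    rw [this, inner_sum]
    simp [Matrix.mulVec, dotProduct, hR, inner_smul_right, mul_comm]
  have hTT : ∀ v w : EuclideanSpace ℂ (Fin (Module.finrank ℂ F)),
      inner ℂ (finRank a b (e.repr.symm v : E)) (finRank a b (e.repr.symm w : E))
        = star v.ofLp ⬝ᵥ (S *ᵥ w.ofLp) := by
    intro v w
    have h1 : star v.ofLp ⬝ᵥ (S *ᵥ w.ofLp)
        = star (R *ᵥ v.ofLp) ⬝ᵥ (gram ℂ a *ᵥ (R *ᵥ w.ofLp)) := by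
      rw [star_mulVec, ← dotProduct_mulVec, mulVec_mulVec, mulVec_mulVec, hSdef, Matrix.mul_assoc]
    rw [hT, hT, h1, sum_inner]
    simp only [inner_sum, inner_smul_left, inner_smul_right, dotProduct, Matrix.mulVec, gram,
      Matrix.of_apply, Pi.star_apply, Finset.mul_sum]
    refine Finset.sum_congr rfl fun c _ => Finset.sum_congr rfl fun d _ => ?_
    simp only [RCLike.star_def]
    rw [Finset.sum_mul]
    refine Finset.sum_congr rfl fun i _ => ?_
    ring
  have hyT : ∀ i j, inner ℂ (finRank a b (y0 i : E)) (finRank a b (y0 j : E))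
      = if i = j then (hS.eigenvalues j : ℂ) else 0 := by
    intro i j
    have h1 : (y0 i) = e.repr.symm (hS.eigenvectorBasis i) := by simp [hy0]
    have h2 : (y0 j) = e.repr.symm (hS.eigenvectorBasis j) := by simp [hy0]
    rw [h1, h2, hTT, hS.mulVec_eigenvectorBasis, dotProduct_smul, dotProduct_comm,
      ← EuclideanSpace.inner_eq_star_dotProduct,
      orthonormal_iff_ite.1 hS.eigenvectorBasis.orthonormal]
    split_ifs <;> simp
  refine ⟨_, fun i => (y0 i : E), ?_, ?_, ?_, ?_⟩
  · exact y0.orthonormal.comp_linearIsometry F.subtypeₗᵢ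
  · intro c
    have := congrArg (Subtype.val) (y0.sum_repr' ⟨b c, hbF c⟩)
    simpa using this
  · intro i j hij
    rw [hyT, if_neg hij]
  · rw [hsum]
    refine Finset.sum_congr rfl fun i _ => ?_
    have := hyT i i
    rw [if_pos rfl, inner_self_eq_norm_sq_to_K] at this
    have h2 : ‖finRank a b (y0 i : E)‖ ^ 2 = hS.eigenvalues i :=
      Complex.ofReal_injective (by push_cast; exact this)
    rw [← h2, Real.sqrt_sq (norm_nonneg _)]

lemma finRank_eq_of_sum {m r : ℕ} (a b : Fin m → E) (y : Fin r → E)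
    (h : ∀ c, ∑ i, inner ℂ (y i) (b c) • y i = b c) :
    finRank a b = finRank (fun i => finRank a b (y i)) y := by
  ext x
  rw [finRank_apply, finRank_apply]
  have : ∀ c, inner ℂ (b c) x = ∑ i, inner ℂ (b c) (y i) * inner ℂ (y i) x := by
    intro c
    conv_lhs => rw [← h c, sum_inner]
    refine Finset.sum_congr rfl fun i _ => ?_
    rw [inner_smul_left, inner_conj_symm]
  simp only [this, Finset.sum_smul, finRank_apply, Finset.smul_sum, smul_smul]
  rw [Finset.sum_comm]
  refine Finset.sum_congr rfl fun i _ => Finset.sum_congr rfl fun c _ => ?_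
  rw [mul_comm]

/-- The operator is a partial isometry. Once the vanishing `η i` are discarded, the rest is
orthonormal and Bessel's inequality applies. -/
lemma norm_finRank_le_one {r : ℕ} {y η : Fin r → E} (hy : Orthonormal ℂ y)
    (h0 : ∀ i j, i ≠ j → inner ℂ (η i) (η j) = 0) (h1 : ∀ i, η i = 0 ∨ ‖η i‖ = 1) :
    ‖finRank y η‖ ≤ 1 := by
  classical
  refine ContinuousLinearMap.opNorm_le_bound _ zero_le_one fun x => ?_
  rw [one_mul, finRank_apply]
  have h2 : ‖∑ c, inner ℂ (η c) x • y c‖ ^ 2 = ∑ c, ‖inner ℂ (η c) x‖ ^ 2 := by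
    have h := hy.inner_sum (fun c => inner ℂ (η c) x) (fun c => inner ℂ (η c) x) Finset.univ
    rw [inner_self_eq_norm_sq_to_K] at h
    have h' : ∀ z : ℂ, starRingEnd ℂ z * z = ((‖z‖ ^ 2 : ℝ) : ℂ) := by
      intro z; rw [mul_comm, Complex.mul_conj, Complex.normSq_eq_norm_sq]
    simp only [h'] at h
    exact Complex.ofReal_injective (by push_cast at h ⊢; exact h)
  have ho : Orthonormal ℂ (fun i : {i // η i ≠ 0} => η i) :=
    ⟨fun i => (h1 i).resolve_left i.2, fun i j hij => h0 _ _ (fun h => hij (Subtype.ext h))⟩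
  have h3 : ∑ c, ‖inner ℂ (η c) x‖ ^ 2 ≤ ‖x‖ ^ 2 := by
    refine le_trans (le_of_eq ?_) (ho.sum_inner_products_le x (s := Finset.univ))
    rw [← Finset.sum_subtype (Finset.univ.filter fun i => η i ≠ 0) (by simp)
      (fun c => ‖inner ℂ (η c) x‖ ^ 2), Finset.sum_filter_of_ne]
    intro c _ hc h
    simp [h] at hc
  exact le_of_sq_le_sq (h2 ▸ h3) (norm_nonneg _)

lemma inner_sum_finRank {m n : ℕ} (a b : Fin m → E) (ξ η : Fin n → E) :
    ∑ i, inner ℂ (η i) (finRank a b (ξ i)) = ∑ c, inner ℂ (b c) (finRank ξ η (a c)) := by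
  simp only [finRank_apply, inner_sum, inner_smul_right]
  rw [Finset.sum_comm]
  exact Finset.sum_congr rfl fun _ _ => Finset.sum_congr rfl fun _ _ => mul_comm _ _

lemma nucLe_finRank {m : ℕ} (a b : Fin m → E) :
    NucLe (finRank a b) (sumSqrtEig (gram ℂ b * gram ℂ a)) := by
  obtain ⟨r, y, hy, hb, -, hs⟩ := exists_singular_vectors a b
  rw [finRank_eq_of_sum a b y hb, hs]
  refine nucLe_sum _ fun i _ => ?_
  simpa [hy.1 i] using nucLe_rankOne (finRank a b (y i)) (y i)

/-- The bound is tested on the partial isometry of the polar decomposition, for which the pairing is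
the sum of the singular values. -/
lemma sumSqrtEig_le_of_nucLe {m : ℕ} {a b : Fin m → E} {C : ℝ} (hC : 0 ≤ C)
    (h : NucLe (finRank a b) C) : sumSqrtEig (gram ℂ b * gram ℂ a) ≤ C := by
  obtain ⟨r, y, hy, hb, ho, hs⟩ := exists_singular_vectors a b
  set d : Fin r → E := fun i => finRank a b (y i)
  -- If `d i = 0`, the inverse is `0⁻¹ = 0` and `η i = 0`, as `norm_finRank_le_one` permits.
  set η : Fin r → E := fun i => ((‖d i‖⁻¹ : ℝ) : ℂ) • d i
  have h1 := h r y η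
  have h2 : ‖finRank y η‖ ≤ 1 := by
    refine norm_finRank_le_one hy (fun i j hij => ?_) fun i => ?_
    · simp only [η, inner_smul_left, inner_smul_right, d, ho i j hij, mul_zero]
    · by_cases hd : d i = 0
      · left; simp [η, hd]
      · right
        simp [η, norm_smul, hd]
  have h3 : ∑ i, inner ℂ (η i) (finRank a b (y i)) = ((∑ i, ‖d i‖ : ℝ) : ℂ) := by
    push_cast
    refine Finset.sum_congr rfl fun i _ => ?_
    change inner ℂ (((‖d i‖⁻¹ : ℝ) : ℂ) • d i) (d i) = _
    rw [inner_smul_left, inner_self_eq_norm_sq_to_K, Complex.conj_ofReal]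
    by_cases hd : ‖d i‖ = 0
    · simp [hd]
    · have : (‖d i‖ : ℂ) ≠ 0 := by exact_mod_cast hd
      push_cast
      field_simp
      simp
  rw [h3, Complex.norm_real, Real.norm_of_nonneg (Finset.sum_nonneg fun i _ => norm_nonneg _)] at h1
  rw [hs]
  refine h1.trans ?_
  calc _ ≤ C * 1 := mul_le_mul_of_nonneg_left h2 hC
    _ = C := mul_one C

/-- The test operator is the orthogonal projection onto the span of `b`, which fixes each `b c`. -/
lemma norm_trace_le_of_nucLe {m : ℕ} {a b : Fin m → E} {C : ℝ} (hC : 0 ≤ C)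
    (h : NucLe (finRank a b) C) : ‖∑ c, inner ℂ (b c) (a c)‖ ≤ C := by
  obtain ⟨r, y, hy, hb, -, -⟩ := exists_singular_vectors a b
  have h1 := h r y y
  have h2 : ‖finRank y y‖ ≤ 1 :=
    norm_finRank_le_one hy (fun i j hij => hy.2 hij) fun i => Or.inr (hy.1 i)
  rw [inner_sum_finRank] at h1
  have h3 : ∀ c, inner ℂ (b c) (finRank y y (a c)) = inner ℂ (b c) (a c) := by
    intro c
    conv_rhs => rw [← hb c]
    rw [finRank_apply, inner_sum, sum_inner]
    refine Finset.sum_congr rfl fun i _ => ?_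
    rw [inner_smul_right, inner_smul_left, inner_conj_symm, mul_comm]
  simp only [h3] at h1
  refine h1.trans ?_
  calc _ ≤ C * 1 := mul_le_mul_of_nonneg_left h2 hC
    _ = C := mul_one C

lemma sumSqrtEig_nonneg {p : ℕ} (C : Matrix (Fin p) (Fin p) ℂ) : 0 ≤ sumSqrtEig C := by
  refine Multiset.sum_nonneg fun x hx => ?_
  obtain ⟨z, -, rfl⟩ := Multiset.mem_map.1 hx
  exact Real.sqrt_nonneg _

end

/-! ### Determinants and traces of finite rank operators -/

section

open InnerProductSpace

section FiniteRank

variable {E : Type*} [AddCommGroup E] [Module ℂ E]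

lemma det_one_add_comp_comm {U W : Type*} [AddCommGroup U] [Module ℂ U] [AddCommGroup W]
    [Module ℂ W] [FiniteDimensional ℂ U] [FiniteDimensional ℂ W] (f : U →ₗ[ℂ] W) (g : W →ₗ[ℂ] U) :
    LinearMap.det (1 + f ∘ₗ g) = LinearMap.det (1 + g ∘ₗ f) := by
  classical
  let bU := Module.finBasis ℂ U
  let bW := Module.finBasis ℂ W
  rw [← LinearMap.det_toMatrix bW, ← LinearMap.det_toMatrix bU]
  simp only [map_add, LinearMap.toMatrix_one]
  rw [LinearMap.toMatrix_comp bW bU bW, LinearMap.toMatrix_comp bU bW bU,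
    Matrix.det_one_add_mul_comm]

/-- The Fredholm determinant of `1 + F`, for a linear map `F` of finite rank. -/
def fdet (F : E →ₗ[ℂ] E) : ℂ :=
  LinearMap.det (1 + F.restrict (p := LinearMap.range F) (q := LinearMap.range F)
    fun x _ => LinearMap.mem_range_self F x)

/-- The trace of a linear map of finite rank. -/
def ftr (F : E →ₗ[ℂ] E) : ℂ :=
  LinearMap.trace ℂ _ (F.restrict (p := LinearMap.range F) (q := LinearMap.range F)
    fun x _ => LinearMap.mem_range_self F x)

variable {F G : E →ₗ[ℂ] E}

/-- The restriction to `W` factors through the range of `F`, and `det (1 + fg) = det (1 + gf)`. Thus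
operators can be compared on a common finite-dimensional subspace. -/
lemma fdet_eq_det_restrict {W : Submodule ℂ E} [FiniteDimensional ℂ W]
    (h : LinearMap.range F ≤ W) :
    fdet F = LinearMap.det (1 + F.restrict (p := W) (q := W)
      fun x _ => h (LinearMap.mem_range_self F x)) := by
  have := Submodule.finiteDimensional_of_le h
  exact det_one_add_comp_comm (F.rangeRestrict ∘ₗ W.subtype) (Submodule.inclusion h)

lemma ftr_eq_trace_restrict {W : Submodule ℂ E} [FiniteDimensional ℂ W]
    (h : LinearMap.range F ≤ W) :
    ftr F = LinearMap.trace ℂ _ (F.restrict (p := W) (q := W)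
      fun x _ => h (LinearMap.mem_range_self F x)) := by
  have := Submodule.finiteDimensional_of_le h
  exact LinearMap.trace_comp_comm' (Submodule.inclusion h) (F.rangeRestrict ∘ₗ W.subtype)

lemma fdet_comp {U : Type*} [AddCommGroup U] [Module ℂ U] [FiniteDimensional ℂ U]
    (a : U →ₗ[ℂ] E) (b : E →ₗ[ℂ] U) : fdet (a ∘ₗ b) = LinearMap.det (1 + b ∘ₗ a) := by
  rw [fdet_eq_det_restrict (LinearMap.range_comp_le_range b a)]
  exact det_one_add_comp_comm a.rangeRestrict (b ∘ₗ (LinearMap.range a).subtype)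

lemma ftr_comp {U : Type*} [AddCommGroup U] [Module ℂ U] [FiniteDimensional ℂ U]
    (a : U →ₗ[ℂ] E) (b : E →ₗ[ℂ] U) : ftr (a ∘ₗ b) = LinearMap.trace ℂ U (b ∘ₗ a) := by
  rw [ftr_eq_trace_restrict (LinearMap.range_comp_le_range b a)]
  exact LinearMap.trace_comp_comm' (b ∘ₗ (LinearMap.range a).subtype) a.rangeRestrict

/-- Since `1 + (F + G + FG) = (1 + F)(1 + G)`, it suffices to restrict to the sum of the two ranges.
-/
lemma fdet_mul [FiniteDimensional ℂ (LinearMap.range F)] [FiniteDimensional ℂ (LinearMap.range G)] :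
    fdet (F + G + F * G) = fdet F * fdet G := by
  set W := LinearMap.range F ⊔ LinearMap.range G
  have hF : LinearMap.range F ≤ W := le_sup_left
  have hG : LinearMap.range G ≤ W := le_sup_right
  have hFG : LinearMap.range (F + G + F * G) ≤ W := by
    rintro _ ⟨x, rfl⟩
    exact W.add_mem (W.add_mem (hF ⟨x, rfl⟩) (hG ⟨x, rfl⟩)) (hF ⟨G x, rfl⟩)
  rw [fdet_eq_det_restrict hF, fdet_eq_det_restrict hG, fdet_eq_det_restrict hFG, ← map_mul]
  congr 1
  ext x
  simp
  abel

lemma ftr_add [FiniteDimensional ℂ (LinearMap.range F)] [FiniteDimensional ℂ (LinearMap.range G)] :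
    ftr (F + G) = ftr F + ftr G := by
  set W := LinearMap.range F ⊔ LinearMap.range G
  have hF : LinearMap.range F ≤ W := le_sup_left
  have hG : LinearMap.range G ≤ W := le_sup_right
  have hFG : LinearMap.range (F + G) ≤ W := by
    rintro _ ⟨x, rfl⟩
    exact W.add_mem (hF ⟨x, rfl⟩) (hG ⟨x, rfl⟩)
  rw [ftr_eq_trace_restrict hF, ftr_eq_trace_restrict hG, ftr_eq_trace_restrict hFG, ← map_add]
  rfl

lemma ftr_smul [FiniteDimensional ℂ (LinearMap.range F)] (c : ℂ) : ftr (c • F) = c * ftr F := by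
  have hF : LinearMap.range (c • F) ≤ LinearMap.range F := by
    rintro _ ⟨x, rfl⟩
    exact ⟨c • x, by simp⟩
  rw [ftr_eq_trace_restrict hF, ftr, ← smul_eq_mul, ← map_smul]
  rfl

end FiniteRank

variable {E : Type*} [NormedAddCommGroup E] [InnerProductSpace ℂ E]

/-- The map `c ↦ ∑ c_i a_i`. -/
def synth {m : ℕ} (a : Fin m → E) : (Fin m → ℂ) →ₗ[ℂ] E := Fintype.linearCombination ℂ a

/-- The map `x ↦ (⟨b_i, x⟩)_i`. -/
def coeffs {m : ℕ} (b : Fin m → E) : E →ₗ[ℂ] (Fin m → ℂ) :=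
  LinearMap.pi fun i => (innerSL ℂ (b i)).toLinearMap

lemma finRank_eq_comp {m : ℕ} (a b : Fin m → E) :
    (finRank a b).toLinearMap = synth a ∘ₗ coeffs b := by
  ext x
  simp [finRank_apply, synth, coeffs, Fintype.linearCombination_apply]

lemma coeffs_comp_synth {m : ℕ} (a b : Fin m → E) :
    coeffs b ∘ₗ synth a = Matrix.toLin' (Matrix.of fun c d => inner ℂ (b c) (a d)) := by
  ext c d
  simp [synth, coeffs, Fintype.linearCombination_apply]

lemma fdet_finRank {m : ℕ} (a b : Fin m → E) :
    fdet (finRank a b).toLinearMap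
      = (1 + Matrix.of fun c d => inner ℂ (b c) (a d) : Matrix (Fin m) (Fin m) ℂ).det := by
  rw [finRank_eq_comp, fdet_comp, coeffs_comp_synth, ← LinearMap.det_toLin']
  congr 1
  rw [map_add, Matrix.toLin'_one]
  rfl

lemma ftr_finRank {m : ℕ} (a b : Fin m → E) :
    ftr (finRank a b).toLinearMap = ∑ c, inner ℂ (b c) (a c) := by
  rw [finRank_eq_comp, ftr_comp, coeffs_comp_synth, Matrix.trace_toLin'_eq]
  rfl

/-- `T` is of finite rank. -/
def IsFinRank (T : E →L[ℂ] E) : Prop := ∃ (m : ℕ) (a b : Fin m → E), T = finRank a b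

lemma finRank_add {m n : ℕ} (a b : Fin m → E) (a' b' : Fin n → E) :
    finRank a b + finRank a' b' = finRank (Fin.append a a') (Fin.append b b') := by
  simp [finRank, Fin.sum_univ_add]

lemma mul_finRank {m : ℕ} (a b : Fin m → E) (T : E →L[ℂ] E) :
    T * finRank a b = finRank (fun i => T (a i)) b := by
  ext x; simp [finRank_apply]

lemma finRank_mul [CompleteSpace E] {m : ℕ} (a b : Fin m → E) (T : E →L[ℂ] E) :
    finRank a b * T = finRank a (fun i => T.adjoint (b i)) := by
  ext x; simp [finRank_apply, ContinuousLinearMap.adjoint_inner_left]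

lemma smul_finRank {m : ℕ} (a b : Fin m → E) (c : ℂ) :
    c • finRank a b = finRank (fun i => c • a i) b := by
  ext x; simp [finRank_apply, Finset.smul_sum, smul_smul, mul_comm]

lemma IsFinRank.add {T S : E →L[ℂ] E} (hT : IsFinRank T) (hS : IsFinRank S) :
    IsFinRank (T + S) := by
  obtain ⟨m, a, b, rfl⟩ := hT
  obtain ⟨n, a', b', rfl⟩ := hS
  exact ⟨_, _, _, finRank_add a b a' b'⟩

lemma IsFinRank.mul_left {T : E →L[ℂ] E} (hT : IsFinRank T) (S : E →L[ℂ] E) :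
    IsFinRank (S * T) := by
  obtain ⟨m, a, b, rfl⟩ := hT
  exact ⟨_, _, _, mul_finRank a b S⟩

lemma IsFinRank.mul_right [CompleteSpace E] {T : E →L[ℂ] E} (hT : IsFinRank T) (S : E →L[ℂ] E) :
    IsFinRank (T * S) := by
  obtain ⟨m, a, b, rfl⟩ := hT
  exact ⟨_, _, _, finRank_mul a b S⟩

lemma IsFinRank.smul {T : E →L[ℂ] E} (hT : IsFinRank T) (c : ℂ) : IsFinRank (c • T) := by
  obtain ⟨m, a, b, rfl⟩ := hT
  exact ⟨_, _, _, smul_finRank a b c⟩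

lemma IsFinRank.zero : IsFinRank (0 : E →L[ℂ] E) :=
  ⟨0, Fin.elim0, Fin.elim0, by simp [finRank]⟩

lemma IsFinRank.finiteDimensional {T : E →L[ℂ] E} (hT : IsFinRank T) :
    FiniteDimensional ℂ (LinearMap.range T.toLinearMap) := by
  obtain ⟨m, a, b, rfl⟩ := hT
  rw [finRank_eq_comp]
  exact Submodule.finiteDimensional_of_le (LinearMap.range_comp_le_range (coeffs b) (synth a))

/-- The Fredholm determinant of a finite rank perturbation of the identity. -/
def cdet (T : E →L[ℂ] E) : ℂ := fdet (T - 1).toLinearMap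

lemma cdet_mul {T S : E →L[ℂ] E} (hT : IsFinRank (T - 1)) (hS : IsFinRank (S - 1)) :
    cdet (T * S) = cdet T * cdet S := by
  have := hT.finiteDimensional
  have := hS.finiteDimensional
  rw [cdet, cdet, cdet, ← fdet_mul]
  congr 1
  ext x
  simp

/-- The determinant involves only the numbers `⟨b_c, S S' a_d⟩`, so a one-sided inverse is enough.
-/
lemma fdet_conj [CompleteSpace E] {T : E →L[ℂ] E} (hT : IsFinRank T) {S S' : E →L[ℂ] E}
    (h : S * S' = 1) :
    fdet (S' * T * S).toLinearMap = fdet T.toLinearMap := by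
  obtain ⟨m, a, b, rfl⟩ := hT
  rw [mul_finRank, finRank_mul, fdet_finRank, fdet_finRank]
  congr 2
  ext c d
  simp only [Matrix.of_apply, ContinuousLinearMap.adjoint_inner_left]
  congr 1
  exact congrArg (fun T : E →L[ℂ] E => T (a d)) h

lemma differentiable_det {m : ℕ} :
    Differentiable ℂ fun A : Fin m → Fin m → ℂ => (Matrix.of A).det := by
  simp only [Matrix.det_apply, Matrix.of_apply]
  fun_prop

/-- Continuity of `X` at 0 suffices for `t X(t)` to have the derivative `X(0)` there. By the chain
rule the answer depends on `X(0)` only, so it is identified by comparison with constant `X`, where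
the determinant is a polynomial in `t`. -/
lemma hasDerivAt_det_one_add {m : ℕ} {X : ℂ → Matrix (Fin m) (Fin m) ℂ}
    (hX : ∀ c d, ContinuousAt (fun t => X t c d) 0) :
    HasDerivAt (fun t : ℂ => (1 + t • X t).det) (X 0).trace 0 := by
  have key : ∀ Y : ℂ → Matrix (Fin m) (Fin m) ℂ, (∀ c d, ContinuousAt (fun t => Y t c d) 0) →
      HasDerivAt (fun t : ℂ => (1 + t • Y t).det)
        (fderiv ℂ (fun A : Fin m → Fin m → ℂ => (Matrix.of A).det) (1 : Matrix _ _ ℂ) (Y 0)) 0 := by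
    intro Y hY
    have h1 : HasDerivAt (fun t : ℂ => (fun c d => (1 + t • Y t) c d : Fin m → Fin m → ℂ))
        (Y 0) 0 := by
      refine hasDerivAt_pi.2 fun c => hasDerivAt_pi.2 fun d => ?_
      simp only [Matrix.add_apply, Matrix.smul_apply, smul_eq_mul]
      refine HasDerivAt.const_add _ ?_
      rw [hasDerivAt_iff_tendsto_slope]
      refine Tendsto.congr' ?_ ((hY c d).tendsto.mono_left nhdsWithin_le_nhds)
      filter_upwards [self_mem_nhdsWithin] with t ht
      have ht : t ≠ 0 := ht
      simp [slope, ht]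
    have h0 : (fun c d => (1 + (0 : ℂ) • Y 0) c d : Fin m → Fin m → ℂ) = (1 : Matrix _ _ ℂ) := by
      ext; simp
    have h2 := (differentiable_det (m := m)).differentiableAt
      (x := (fun c d => (1 + (0 : ℂ) • Y 0) c d)) |>.hasFDerivAt.comp_hasDerivAt 0 h1
    rw [h0] at h2
    exact h2
  have h1 := key X hX
  have h2 := key (fun _ => X 0) fun _ _ => continuousAt_const
  have h3 : HasDerivAt (fun t : ℂ => (1 + t • X 0).det) (X 0).trace 0 := by
    rw [funext fun t => Matrix.det_one_add_smul t (X 0)]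
    have a1 : HasDerivAt (fun t : ℂ => 1 + (X 0).trace * t) (X 0).trace 0 := by
      simpa using ((hasDerivAt_id (0 : ℂ)).const_mul (X 0).trace).const_add 1
    have a2 : HasDerivAt (fun t : ℂ => (Polynomial.eval t
        (1 + (Polynomial.X : Polynomial ℂ) • (X 0).map Polynomial.C).det.divX.divX) * t ^ 2) 0 0 := by
      have := (Polynomial.hasDerivAt
        (1 + (Polynomial.X : Polynomial ℂ) • (X 0).map Polynomial.C).det.divX.divX (0 : ℂ)).mul
        (hasDerivAt_pow 2 (0 : ℂ))
      refine HasDerivAt.congr_deriv this ?_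
      simp
    exact (a1.add a2).congr_deriv (add_zero _)
  rwa [h2.unique h3] at h1

end

/-! ### The integral operators on `L²` -/

section

open InnerProductSpace

variable {N M : ℕ}

lemma measurePreserving_mix_swap (n : ℕ) : MeasurePreserving
    (fun p : Cube N × Cube N => mix n p.2 p.1) (volume.prod volume) volume :=
  (measurePreserving_mix n).comp Measure.measurePreserving_swap

/-- A null set is null in almost every fiber; hence fiber integrals are well defined on classes of
functions. -/
lemma ae_ae_mix (n : ℕ) {p : Cube N → Prop} (h : ∀ᵐ k : Cube N, p k) :
    ∀ᵐ k : Cube N, ∀ᵐ s : Cube N, p (mix n s k) :=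
  Measure.ae_ae_of_ae_prod ((measurePreserving_mix_swap n).quasiMeasurePreserving.ae h)

lemma lintegral_mix (n : ℕ) {f : Cube N → ENNReal} (hf : Measurable f) :
    ∫⁻ k, ∫⁻ s, f (mix n s k) = ∫⁻ k, f k := by
  rw [← (measurePreserving_mix_swap n).lintegral_comp hf,
    lintegral_prod (f := fun p : Cube N × Cube N => f (mix n p.2 p.1))
      (hf.comp (measurePreserving_mix_swap n).measurable).aemeasurable]

/-- The function `⟨⟨β, u⟩⟩_n α`, for an arbitrary function `u`. -/
def kerFun (n : ℕ) (α β : V N M) (u : Cube N → EuclideanSpace ℂ (Fin M)) (k : Cube N) :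
    EuclideanSpace ℂ (Fin M) :=
  avg n (fun s => inner ℂ (β s) (u s)) k • α k

lemma kerFun_congr_ae (n : ℕ) (α β : V N M) {u v : Cube N → EuclideanSpace ℂ (Fin M)}
    (h : u =ᵐ[volume] v) : kerFun n α β u =ᵐ[volume] kerFun n α β v := by
  filter_upwards [ae_ae_mix n h] with k hk
  simp only [kerFun, avg]
  congr 1
  refine integral_congr_ae ?_
  filter_upwards [hk] with s hs
  rw [hs]

lemma integrable_inner (β : V N M) {u : Cube N → EuclideanSpace ℂ (Fin M)} (hu : MemLp u 2) :
    Integrable (fun s => inner ℂ (β s) (u s)) volume := by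
  have hβ : MemLp β 2 (volume : Measure (Cube N)) :=
    β.continuous.memLp_of_hasCompactSupport (HasCompactSupport.of_compactSpace β)
  refine (L2.integrable_inner (𝕜 := ℂ) (hβ.toLp β) (hu.toLp u)).congr ?_
  filter_upwards [hβ.coeFn_toLp, hu.coeFn_toLp] with k h1 h2
  rw [h1, h2]

lemma kerFun_add_ae (n : ℕ) (α β : V N M) {u v : Cube N → EuclideanSpace ℂ (Fin M)}
    (hu : MemLp u 2) (hv : MemLp v 2) :
    kerFun n α β (u + v) =ᵐ[volume] kerFun n α β u + kerFun n α β v := by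
  have h1 := ((measurePreserving_mix_swap n).integrable_comp_of_integrable
    (integrable_inner β hu)).prod_right_ae
  have h2 := ((measurePreserving_mix_swap n).integrable_comp_of_integrable
    (integrable_inner β hv)).prod_right_ae
  filter_upwards [h1, h2] with k h1 h2
  simp only [kerFun, avg, Pi.add_apply, inner_add_right, ← add_smul]
  congr 1
  exact integral_add h1 h2

lemma kerFun_smul (n : ℕ) (α β : V N M) (c : ℂ) (u : Cube N → EuclideanSpace ℂ (Fin M)) :
    kerFun n α β (c • u) = c • kerFun n α β u := by
  funext k
  simp only [kerFun, avg, Pi.smul_apply, inner_smul_right, integral_const_mul, mul_smul]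

lemma aestronglyMeasurable_kerFun (n : ℕ) (α β : V N M) {u : Cube N → EuclideanSpace ℂ (Fin M)}
    (hu : StronglyMeasurable u) :
    AEStronglyMeasurable (kerFun n α β u) volume := by
  have h : StronglyMeasurable (fun s => inner ℂ (β s) (u s)) :=
    β.continuous.stronglyMeasurable.inner hu
  have h2 : AEStronglyMeasurable (fun k => avg n (fun s => inner ℂ (β s) (u s)) k) volume :=
    (h.comp_measurable (measurePreserving_mix_swap n).measurable).aestronglyMeasurable
      |>.integral_prod_right'
  exact h2.smul α.continuous.aestronglyMeasurable

/-- The cube has total mass one, so the `L¹` norm is at most the `L²` norm. -/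
lemma sq_lintegral_le {u : Cube N → EuclideanSpace ℂ (Fin M)} (hu : AEStronglyMeasurable u) :
    (∫⁻ s, ‖u s‖ₑ) ^ (2 : ℝ) ≤ ∫⁻ s, ‖u s‖ₑ ^ (2 : ℝ) := by
  have := eLpNorm_le_eLpNorm_of_exponent_le (p := 1) (q := 2) (by norm_num) hu
  rw [eLpNorm_one_eq_lintegral_enorm, eLpNorm_eq_lintegral_rpow_enorm_toReal (by norm_num) (by norm_num)] at this
  have h2 := ENNReal.rpow_le_rpow this (z := 2) (by norm_num)
  rw [← ENNReal.rpow_mul] at h2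
  simpa using h2

lemma enorm_kerFun_le (n : ℕ) (α β : V N M) (u : Cube N → EuclideanSpace ℂ (Fin M)) (k : Cube N) :
    ‖kerFun n α β u k‖ₑ ≤ ‖α‖ₑ * ‖β‖ₑ * ∫⁻ s, ‖u (mix n s k)‖ₑ := by
  have hn : ∀ (γ : V N M) k, ‖γ k‖ₑ ≤ ‖γ‖ₑ := fun γ k => by
    rw [← ofReal_norm, ← ofReal_norm]
    exact ENNReal.ofReal_le_ofReal (γ.norm_coe_le_norm k)
  rw [kerFun, enorm_smul, avg, mul_comm, mul_assoc]
  refine mul_le_mul' (hn α k) ((enorm_integral_le_lintegral_enorm _).trans ?_)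
  rw [← lintegral_const_mul' _ _ (by simp)]
  refine lintegral_mono fun s => ?_
  refine le_trans ?_ (mul_le_mul' (hn β (mix n s k)) le_rfl)
  rw [← ofReal_norm, ← ofReal_norm, ← ofReal_norm, ← ENNReal.ofReal_mul (norm_nonneg _)]
  exact ENNReal.ofReal_le_ofReal (norm_inner_le_norm _ _)

lemma eLpNorm_kerFun_le (n : ℕ) (α β : V N M) {u : Cube N → EuclideanSpace ℂ (Fin M)}
    (hu : StronglyMeasurable u) :
    eLpNorm (kerFun n α β u) 2 volume ≤ ‖α‖ₑ * ‖β‖ₑ * eLpNorm u 2 volume := by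
  rw [eLpNorm_eq_lintegral_rpow_enorm_toReal (by norm_num) (by norm_num),
    eLpNorm_eq_lintegral_rpow_enorm_toReal (by norm_num) (by norm_num)]
  simp only [ENNReal.toReal_ofNat]
  have h1 : ∫⁻ k, ‖kerFun n α β u k‖ₑ ^ (2 : ℝ)
      ≤ (‖α‖ₑ * ‖β‖ₑ) ^ (2 : ℝ) * ∫⁻ k, ‖u k‖ₑ ^ (2 : ℝ) := by
    rw [← lintegral_mix n (f := fun k => ‖u k‖ₑ ^ (2 : ℝ)) (hu.enorm.pow_const _),
      ← lintegral_const_mul' _ _ (by simp [ENNReal.mul_eq_top])]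
    refine lintegral_mono fun k => ?_
    refine (ENNReal.rpow_le_rpow (enorm_kerFun_le n α β u k) (by norm_num)).trans ?_
    rw [ENNReal.mul_rpow_of_nonneg _ _ (by norm_num)]
    refine mul_le_mul' le_rfl (sq_lintegral_le (u := fun s => u (mix n s k)) ?_)
    exact (hu.comp_measurable (continuous_mix_left n k).measurable).aestronglyMeasurable
  refine (ENNReal.rpow_le_rpow h1 (by norm_num)).trans (le_of_eq ?_)
  rw [ENNReal.mul_rpow_of_nonneg _ _ (by norm_num), ← ENNReal.rpow_mul]
  norm_num

lemma memLp_kerFun (n : ℕ) (α β : V N M) (u : L2 N M) : MemLp (kerFun n α β u) 2 volume :=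
  ⟨aestronglyMeasurable_kerFun n α β (Lp.stronglyMeasurable u),
    (eLpNorm_kerFun_le n α β (Lp.stronglyMeasurable u)).trans_lt
      (ENNReal.mul_lt_top (ENNReal.mul_lt_top (by simp) (by simp)) (Lp.eLpNorm_lt_top u))⟩

/-- The operator `u ↦ α ⟨⟨β, u⟩⟩_n` on `L²`. -/
def theta (n : ℕ) (α β : V N M) : L2 N M →L[ℂ] L2 N M :=
  LinearMap.mkContinuous
    { toFun := fun u => (memLp_kerFun n α β u).toLp
      map_add' := fun u v => by
        rw [← MemLp.toLp_add, MemLp.toLp_eq_toLp_iff]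
        exact (kerFun_congr_ae n α β (Lp.coeFn_add u v)).trans
          (kerFun_add_ae n α β (Lp.memLp u) (Lp.memLp v))
      map_smul' := fun c u => by
        rw [RingHom.id_apply, ← MemLp.toLp_const_smul, MemLp.toLp_eq_toLp_iff]
        exact (kerFun_congr_ae n α β (Lp.coeFn_smul c u)).trans
          (Eventually.of_forall fun k => congrFun (kerFun_smul n α β c u) k) }
    (‖α‖ * ‖β‖) fun u => by
      change ‖(memLp_kerFun n α β u).toLp‖ ≤ _
      rw [Lp.norm_toLp, Lp.norm_def]
      have := ENNReal.toReal_mono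
        (ENNReal.mul_lt_top (ENNReal.mul_lt_top (by simp) (by simp)) (Lp.eLpNorm_lt_top u)).ne
        (eLpNorm_kerFun_le n α β (Lp.stronglyMeasurable u))
      simpa [ENNReal.toReal_mul] using this

lemma theta_ae (n : ℕ) (α β : V N M) (u : L2 N M) :
    theta n α β u =ᵐ[volume] kerFun n α β u :=
  (memLp_kerFun n α β u).coeFn_toLp

lemma theta_J (n : ℕ) (α β f : V N M) : theta n α β (J f) = J (act n α β f) := by
  refine Lp.ext ((theta_ae n α β (J f)).trans (((kerFun_congr_ae n α β (coeFn_J f))).trans ?_))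
  exact (coeFn_J (act n α β f)).symm

lemma ext_J {T S : L2 N M →L[ℂ] L2 N M} (h : ∀ f, T (J f) = S (J f)) : T = S :=
  ContinuousLinearMap.coeFn_injective
    (J_dense.equalizer T.continuous S.continuous (funext h))

/-- With all variables integrated out, the average is the full inner product. -/
lemma theta_of_le {n : ℕ} (h : N ≤ n) (α β : V N M) :
    theta n α β = rankOne ℂ (J α) (J β) := by
  refine ext_J fun f => ?_
  rw [theta_J, rankOne_apply, inner_J, ← map_smul]
  congr 1
  ext1 k
  simp only [act_apply, avg, mix_of_le h]
  rfl

lemma theta_mul_of_le {i j : ℕ} (h : i ≤ j) (α β α' β' : V N M) :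
    theta i α β * theta j α' β' = theta j (act i α β α') β' :=
  ext_J fun f => by
    simp only [mul_apply_eq_comp, theta_J, act_act_of_le h]

lemma theta_mul_of_ge {i j : ℕ} (h : j ≤ i) (α β α' β' : V N M) :
    theta i α β * theta j α' β' = theta i α (act j β' α' β) :=
  ext_J fun f => by
    simp only [mul_apply_eq_comp, theta_J, act_act_of_ge h]

end

/-! ### Formal sums and fiber operators -/

section

open InnerProductSpace

variable {N M : ℕ}

/-- Formal linear combinations of the operators `u ↦ α ⟨⟨β, u⟩⟩_n`, `0 ≤ n ≤ N`. -/
abbrev Formal (N M : ℕ) : Type := (Fin (N + 1) × V N M × V N M) →₀ ℂ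

/-- The operator given by a formal sum. -/
def op : Formal N M →ₗ[ℂ] (L2 N M →L[ℂ] L2 N M) :=
  Finsupp.linearCombination ℂ fun p => theta p.1 p.2.1 p.2.2

/-- The part of degree `i` of the operator given by a formal sum. -/
def part (i : ℕ) : Formal N M →ₗ[ℂ] (L2 N M →L[ℂ] L2 N M) :=
  Finsupp.linearCombination ℂ fun p => if p.1.1 = i then theta p.1 p.2.1 p.2.2 else 0

/-- The action on continuous functions of the part of degree `i` of a formal sum. -/
def actPart (i : ℕ) : Formal N M →ₗ[ℂ] (V N M →ₗ[ℂ] V N M) :=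
  Finsupp.linearCombination ℂ fun p => if p.1.1 = i then act p.1 p.2.1 p.2.2 else 0

/-- The finite rank operator in the fiber at `k` given by the part of degree `j`. -/
def fib (j : ℕ) (k : Cube N) : Formal N M →ₗ[ℂ] (L2 N M →L[ℂ] L2 N M) :=
  Finsupp.linearCombination ℂ fun p =>
    if p.1.1 = j then theta N (frz j k p.2.1) (frz j k p.2.2) else 0

/-- The operator in the fiber at `k` given by the parts of degree less than `j`. -/
def low (j : ℕ) (k : Cube N) : Formal N M →ₗ[ℂ] (L2 N M →L[ℂ] L2 N M) :=
  Finsupp.linearCombination ℂ fun p =>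
    if p.1.1 < j then theta p.1 (frz j k p.2.1) (frz j k p.2.2) else 0

/-- Freezing of the last coordinates of the coefficients of a formal sum. -/
def frzF (j : ℕ) (k : Cube N) : Formal N M →ₗ[ℂ] Formal N M :=
  Finsupp.lmapDomain ℂ ℂ fun p => (p.1, frz j k p.2.1, frz j k p.2.2)

section single

variable (n : Fin (N + 1)) (α β : V N M) (c : ℂ)

@[simp] lemma op_single : op (Finsupp.single (n, α, β) c) = c • theta n α β := by simp [op]

@[simp] lemma part_single (i : ℕ) : part i (Finsupp.single (n, α, β) c)
    = if n.1 = i then c • theta n α β else 0 := by simp [part]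

@[simp] lemma actPart_single (i : ℕ) : actPart i (Finsupp.single (n, α, β) c)
    = if n.1 = i then c • act n α β else 0 := by simp [actPart]

@[simp] lemma fib_single (j : ℕ) (k : Cube N) : fib j k (Finsupp.single (n, α, β) c)
    = if n.1 = j then c • theta N (frz j k α) (frz j k β) else 0 := by simp [fib]

@[simp] lemma low_single (j : ℕ) (k : Cube N) : low j k (Finsupp.single (n, α, β) c)
    = if n.1 < j then c • theta n (frz j k α) (frz j k β) else 0 := by simp [low]

@[simp] lemma frzF_single (j : ℕ) (k : Cube N) : frzF j k (Finsupp.single (n, α, β) c)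
    = Finsupp.single (n, frz j k α, frz j k β) c := by simp [frzF]

end single

lemma part_J (i : ℕ) (x : Formal N M) (f : V N M) : part i x (J f) = J (actPart i x f) := by
  induction x using Finsupp.induction_linear with
  | zero => simp
  | add x y hx hy => simp [hx, hy]
  | single p c =>
    obtain ⟨n, α, β⟩ := p
    simp only [part_single, actPart_single]
    split_ifs <;> simp [theta_J]

lemma low_eq_sum (j : ℕ) (k : Cube N) (x : Formal N M) :
    low j k x = ∑ i ∈ Finset.range j, part i (frzF j k x) := by
  induction x using Finsupp.induction_linear with
  | zero => simp
  | add x y hx hy => simp [hx, hy, Finset.sum_add_distrib]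
  | single p c =>
    obtain ⟨n, α, β⟩ := p
    simp only [low_single, frzF_single, part_single]
    rw [Finset.sum_ite_eq]
    simp

lemma fib_frzF {i j : ℕ} (h : i ≤ j) (k l : Cube N) (x : Formal N M) :
    fib i l (frzF j k x) = fib i (mix j l k) x := by
  have hf : ∀ α : V N M, frz i l (frz j k α) = frz i (mix j l k) α := fun α => by
    ext1 s; simp only [frz_apply, mix_mix_of_le h]
  induction x using Finsupp.induction_linear with
  | zero => simp
  | add x y hx hy => simp [hx, hy]
  | single p c =>
    obtain ⟨n, α, β⟩ := p
    simp only [fib_single, frzF_single, hf]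

lemma frz_of_le {j : ℕ} (h : N ≤ j) (k : Cube N) (α : V N M) : frz j k α = α := by
  ext1 s; simp only [frz_apply, mix_of_le h]

lemma op_eq_low (k : Cube N) (x : Formal N M) : op x = low (N + 1) k x := by
  induction x using Finsupp.induction_linear with
  | zero => simp
  | add x y hx hy => simp [hx, hy]
  | single p c =>
    obtain ⟨n, α, β⟩ := p
    simp [frz_of_le (Nat.le_succ N), n.2]

lemma op_eq_sum (x : Formal N M) : op x = ∑ i ∈ Finset.range (N + 1), part i x := by
  induction x using Finsupp.induction_linear with
  | zero => simp
  | add x y hx hy => simp [hx, hy, Finset.sum_add_distrib]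
  | single p c =>
    obtain ⟨n, α, β⟩ := p
    simp only [op_single, part_single]
    rw [Finset.sum_ite_eq, if_pos (Finset.mem_range.2 n.2)]

lemma frz_act_self (j : ℕ) (k : Cube N) (α β f : V N M) :
    frz j k (act j α β f) = act N (frz j k α) (frz j k β) (frz j k f) := by
  ext1 s
  simp only [frz_apply, act_apply, avg_mix le_rfl]
  simp only [avg, mix_of_le le_rfl]
  rfl

lemma J_frz_actPart (i : ℕ) (k : Cube N) (x : Formal N M) (f : V N M) :
    J (frz i k (actPart i x f)) = fib i k x (J (frz i k f)) := by
  induction x using Finsupp.induction_linear with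
  | zero => simp
  | add x y hx hy => simp [hx, hy]
  | single p c =>
    obtain ⟨n, α, β⟩ := p
    simp only [fib_single, actPart_single]
    split_ifs with h
    · subst h
      simp [theta_J, frz_act_self]
    · simp

lemma norm_J_frz_sq (i : ℕ) (k : Cube N) (f : V N M) :
    ((‖J (frz i k f)‖ ^ 2 : ℝ) : ℂ) = avg i (ip f f) k := by
  have := inner_self_eq_norm_sq_to_K (𝕜 := ℂ) (J (frz i k f))
  rw [inner_J] at this
  push_cast
  exact this.symm

lemma norm_J_sq (i : ℕ) (f : V N M) : ‖J f‖ ^ 2 = ∫ k, ‖J (frz i k f)‖ ^ 2 := by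
  have h1 := inner_self_eq_norm_sq_to_K (𝕜 := ℂ) (J f)
  rw [inner_J, ← integral_avg i (ip f f).continuous] at h1
  simp only [← norm_J_frz_sq] at h1
  rw [integral_complex_ofReal] at h1
  exact Complex.ofReal_injective (by rw [h1]; push_cast; rfl)

lemma continuous_norm_J_frz_sq (i : ℕ) (f : V N M) :
    Continuous fun k : Cube N => ‖J (frz i k f)‖ ^ 2 := by
  have : (fun k : Cube N => ‖J (frz i k f)‖ ^ 2) = fun k => (avg i (ip f f) k).re := by
    funext k; rw [← norm_J_frz_sq, Complex.ofReal_re]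
  rw [this]
  exact Complex.continuous_re.comp (continuous_avg i (ip f f).continuous)

/-- By Fubini `‖J f‖²` is the integral of the squared norms over the fibers (`norm_J_sq`), and in
each fiber the part of degree `i` acts as `fib i k x`. -/
lemma norm_part_le {i : ℕ} {x : Formal N M} {C : ℝ} (hC : 0 ≤ C) (h : ∀ k, ‖fib i k x‖ ≤ C) :
    ‖part i x‖ ≤ C := by
  refine ContinuousLinearMap.opNorm_le_bound _ hC ?_
  refine isClosed_property J_dense (isClosed_le (by fun_prop) (by fun_prop)) fun f => ?_
  rw [part_J]
  refine le_of_sq_le_sq ?_ (by positivity)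
  rw [mul_pow, norm_J_sq i, norm_J_sq i f, ← integral_const_mul]
  refine integral_mono (integrable_of_continuous (continuous_norm_J_frz_sq _ _))
    (integrable_of_continuous ((continuous_norm_J_frz_sq _ _).const_mul _)) fun k => ?_
  change _ ≤ C ^ 2 * _
  rw [← mul_pow, J_frz_actPart]
  exact pow_le_pow_left₀ (norm_nonneg _) (ContinuousLinearMap.le_of_opNorm_le _ (h k) _) 2

lemma norm_low_le {j : ℕ} {k : Cube N} {x : Formal N M} {C : ℕ → ℝ} (hC : ∀ i, 0 ≤ C i)
    (h : ∀ i l, ‖fib i l x‖ ≤ C i) : ‖low j k x‖ ≤ ∑ i ∈ Finset.range j, C i := by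
  rw [low_eq_sum]
  refine (norm_sum_le _ _).trans (Finset.sum_le_sum fun i hi => ?_)
  refine norm_part_le (hC i) fun l => ?_
  rw [fib_frzF (Finset.mem_range.1 hi).le]
  exact h i _

/-- Powers of a tent function in the single coordinate with (zero-based) index `j`, with peak at `k
j`. On the fiber through `k` that coordinate is frozen and the tent equals 1. An average over more
than `j` variables integrates over it, and the powers tend to 0 off a null hyperplane. -/
lemma exists_peak (j : ℕ) (k : Cube N) : ∃ w : ℕ → C(Cube N, ℂ),
    (∀ n s, w n (mix j s k) = 1) ∧
    ∀ i, j < i → i ≤ N → ∀ g : C(Cube N, ℂ),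
      Tendsto (fun n => avg i (w n * g) k) atTop (𝓝 0) := by
  by_cases hj : j < N
  swap
  -- For `j ≥ N` there is no degree above `j`, so the constant 1 will do.
  · exact ⟨fun _ => 1, fun _ _ => rfl, fun i h1 h2 => absurd (h1.trans_le h2) hj⟩
  let d : Cube N → ℝ := fun s => 1 - |(s ⟨j, hj⟩ : ℝ) - k ⟨j, hj⟩|
  have hd : Continuous d := by fun_prop
  have hd0 : ∀ s, 0 ≤ d s ∧ d s ≤ 1 := fun s => by
    have h1 := (s ⟨j, hj⟩).2; have h2 := (k ⟨j, hj⟩).2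
    refine ⟨sub_nonneg.2 (abs_le.2 ⟨?_, ?_⟩), sub_le_self _ (abs_nonneg _)⟩ <;>
      linarith [h1.1, h1.2, h2.1, h2.2]
  refine ⟨fun n => ⟨fun s => ((d s ^ n : ℝ) : ℂ), by fun_prop⟩, fun n s => ?_, fun i hi hiN g => ?_⟩
  · simp [d, mix]
  · have hdm : ∀ s, d (mix i s k) = d s := fun s => by simp [d, mix, hi]
    have key : Tendsto (fun n : ℕ => ∫ s, ((d s ^ n : ℝ) : ℂ) * g (mix i s k)) atTop
        (𝓝 (∫ _ : Cube N, (0 : ℂ))) := by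
      refine tendsto_integral_of_dominated_convergence (fun _ => ‖g‖) (fun n => ?_)
        (integrable_const _) (fun n => Eventually.of_forall fun s => ?_) ?_
      · have := g.continuous.comp (continuous_mix_left i k)
        have h2 : Continuous fun s => ((d s ^ n : ℝ) : ℂ) := by fun_prop
        exact (h2.mul this).aestronglyMeasurable
      · rw [norm_mul, Complex.norm_real, Real.norm_of_nonneg (pow_nonneg (hd0 s).1 n)]
        calc _ ≤ 1 * ‖g‖ := mul_le_mul (pow_le_one₀ (hd0 s).1 (hd0 s).2) (g.norm_coe_le_norm _)
              (norm_nonneg _) zero_le_one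
          _ = _ := one_mul _
      · have hnull := Measure.pi_hyperplane (fun _ : Fin N => (volume : Measure I)) ⟨j, hj⟩
          (k ⟨j, hj⟩)
        have : ∀ᵐ s : Cube N, s ⟨j, hj⟩ ≠ k ⟨j, hj⟩ := by
          rw [ae_iff]; simpa [volume_pi] using hnull
        filter_upwards [this] with s hs
        have hlt : d s < 1 := by
          have : (0 : ℝ) < |(s ⟨j, hj⟩ : ℝ) - k ⟨j, hj⟩| :=
            abs_pos.2 (sub_ne_zero.2 fun h => hs (Subtype.ext h))
          simp only [d]; linarith
        have h0 := tendsto_pow_atTop_nhds_zero_of_lt_one (hd0 s).1 hlt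
        have h1 := (Complex.continuous_ofReal.tendsto 0).comp h0
        simpa using h1.mul_const (g (mix i s k))
    simp only [integral_zero] at key
    refine key.congr fun n => ?_
    simp only [avg, ContinuousMap.coe_mul, Pi.mul_apply, ContinuousMap.coe_mk, hdm]

lemma ip_smul_right (w : C(Cube N, ℂ)) (β f : V N M) : ip β (w • f) = w * ip β f := by
  ext s; simp [ip]

lemma actPart_peak_self {j : ℕ} {k : Cube N} {w : C(Cube N, ℂ)} (hw : ∀ s, w (mix j s k) = 1)
    (x : Formal N M) (f : V N M) : actPart j x (w • f) k = actPart j x f k := by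
  induction x using Finsupp.induction_linear with
  | zero => simp
  | add x y hx hy => simp [hx, hy]
  | single p c =>
    obtain ⟨n, α, β⟩ := p
    simp only [actPart_single]
    split_ifs with h
    · subst h
      simp [act_apply, ip_smul_right, avg, hw]
    · simp

lemma tendsto_actPart_peak {i : ℕ} {k : Cube N} {w : ℕ → C(Cube N, ℂ)}
    (hw : ∀ g : C(Cube N, ℂ), Tendsto (fun n => avg i (w n * g) k) atTop (𝓝 0))
    (x : Formal N M) (f : V N M) :
    Tendsto (fun n => actPart i x (w n • f) k) atTop (𝓝 0) := by
  induction x using Finsupp.induction_linear with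
  | zero => simp
  | add x y hx hy => simpa using hx.add hy
  | single p c =>
    obtain ⟨n, α, β⟩ := p
    simp only [actPart_single]
    split_ifs with h
    · subst h
      simpa [act_apply, ip_smul_right] using ((hw (ip β f)).smul_const (α k)).const_smul c
    · simp

/-- The relation `op x = 0` is tested on `w n • f` at `k`. Degrees below `j` vanish by assumption,
degree `j` does not see `w n`, and higher degrees disappear in the limit. -/
lemma actPart_eq_zero {x : Formal N M} (hx : op x = 0) {j : ℕ} (hj : j ≤ N)
    (hlow : ∀ i < j, actPart i x = 0) : actPart j x = 0 := by
  have hsum : ∀ f : V N M, ∑ i ∈ Finset.range (N + 1), actPart i x f = 0 := by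
    intro f
    refine J_injective ?_
    rw [map_sum, map_zero]
    simp only [← part_J]
    rw [← _root_.sum_apply, ← op_eq_sum, hx]
    rfl
  ext1 f
  ext1 k
  obtain ⟨w, hw1, hw2⟩ := exists_peak j k
  have hlim : Tendsto (fun n => ∑ i ∈ Finset.range (N + 1), actPart i x (w n • f) k) atTop
      (𝓝 (∑ i ∈ Finset.range (N + 1), if i = j then actPart j x f k else 0)) := by
    refine tendsto_finsetSum _ fun i hi => ?_
    rcases lt_trichotomy i j with h | h | h
    · simp [hlow i h, h.ne]
    · subst h
      simp [actPart_peak_self (hw1 _)]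
    · rw [if_neg h.ne']
      exact tendsto_actPart_peak (hw2 i h (Nat.lt_succ_iff.1 (Finset.mem_range.1 hi))) x f
  rw [Finset.sum_ite_eq', if_pos (Finset.mem_range.2 (Nat.lt_succ_of_le hj))] at hlim
  have h0 : ∀ n, ∑ i ∈ Finset.range (N + 1), actPart i x (w n • f) k = 0 := fun n => by
    have := congrArg (fun g : V N M => g k) (hsum (w n • f))
    simpa using this
  simp only [h0] at hlim
  exact tendsto_nhds_unique hlim tendsto_const_nhds

lemma adjoint_fib_mem (j : ℕ) (k : Cube N) (x : Formal N M) (u : L2 N M) :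
    ∃ f : V N M, (fib j k x).adjoint u = J (frz j k f) := by
  induction x using Finsupp.induction_linear with
  | zero => exact ⟨0, by simp⟩
  | add x y hx hy =>
    obtain ⟨f, hf⟩ := hx
    obtain ⟨g, hg⟩ := hy
    exact ⟨f + g, by simp [hf, hg]⟩
  | single p c =>
    obtain ⟨n, α, β⟩ := p
    simp only [fib_single]
    split_ifs with h
    · refine ⟨(starRingEnd ℂ c * inner ℂ (J (frz j k α)) u) • β, ?_⟩
      rw [theta_of_le le_rfl, map_smulₛₗ, adjoint_rankOne, map_smul, map_smul, mul_smul]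
      rfl
    · exact ⟨0, by simp⟩

/-- The fiber operator kills frozen continuous functions, and the range of its adjoint consists of
such functions. Hence `‖fib* u‖² = ⟨u, fib fib* u⟩ = 0`. -/
lemma fib_eq_zero_of_actPart {j : ℕ} {x : Formal N M} (h : actPart j x = 0) (k : Cube N) :
    fib j k x = 0 := by
  have h1 : ∀ f, fib j k x (J (frz j k f)) = 0 := fun f => by
    rw [← J_frz_actPart, h]; simp
  rw [← ContinuousLinearMap.adjoint_adjoint (fib j k x)]
  have h2 : (fib j k x).adjoint = 0 := by
    ext1 u
    obtain ⟨f, hf⟩ := adjoint_fib_mem j k x u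
    rw [_root_.zero_apply, ← inner_self_eq_zero (𝕜 := ℂ),
      ContinuousLinearMap.adjoint_inner_right, hf, h1, inner_zero_left]
  rw [h2, map_zero]

lemma fib_eq_zero_of_lt {j : ℕ} (hj : N < j) (k : Cube N) (x : Formal N M) : fib j k x = 0 := by
  induction x using Finsupp.induction_linear with
  | zero => simp
  | add x y hx hy => simp [hx, hy]
  | single p c =>
    obtain ⟨n, α, β⟩ := p
    rw [fib_single, if_neg (by omega)]

/-- The fiber operators are determined by the operator. -/
lemma fib_eq_zero_of_op {x : Formal N M} (hx : op x = 0) (j : ℕ) (k : Cube N) :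
    fib j k x = 0 := by
  rcases lt_or_ge N j with hj | hj
  · exact fib_eq_zero_of_lt hj k x
  refine fib_eq_zero_of_actPart ?_ k
  induction j using Nat.strong_induction_on with
  | _ j ih => exact actPart_eq_zero hx hj fun i hi => ih i hi (hi.le.trans hj)

lemma low_eq_zero_of_op {x : Formal N M} (hx : op x = 0) (j : ℕ) (k : Cube N) :
    low j k x = 0 := by
  have := norm_low_le (j := j) (k := k) (x := x) (C := fun _ => 0) (fun _ => le_rfl)
    fun i l => by rw [fib_eq_zero_of_op hx, norm_zero]
  simpa using this

/-! ### Products of formal sums -/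

/-- `z` is a formal sum for the product of the operators given by `x` and `y`. -/
structure IsProd (x y z : Formal N M) : Prop where
  op_eq : op z = op x * op y
  low_eq : ∀ j k, low j k z = low j k x * low j k y
  fib_eq : ∀ j k, fib j k z = fib j k x * fib j k y + low j k x * fib j k y + fib j k x * low j k y

lemma IsProd.add_left {x x' y z z' : Formal N M} (h : IsProd x y z) (h' : IsProd x' y z') :
    IsProd (x + x') y (z + z') :=
  ⟨by simp [h.op_eq, h'.op_eq, add_mul], fun j k => by simp [h.low_eq, h'.low_eq, add_mul],
    fun j k => by simp only [map_add, h.fib_eq, h'.fib_eq, add_mul]; abel⟩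

lemma IsProd.add_right {x y y' z z' : Formal N M} (h : IsProd x y z) (h' : IsProd x y' z') :
    IsProd x (y + y') (z + z') :=
  ⟨by simp [h.op_eq, h'.op_eq, mul_add], fun j k => by simp [h.low_eq, h'.low_eq, mul_add],
    fun j k => by simp only [map_add, h.fib_eq, h'.fib_eq, mul_add]; abel⟩

lemma IsProd.smul {x y z : Formal N M} (h : IsProd x y z) (c d : ℂ) :
    IsProd (c • x) (d • y) ((c * d) • z) :=
  ⟨by simp only [map_smul, h.op_eq, smul_mul_smul_comm],
    fun j k => by simp only [map_smul, h.low_eq, smul_mul_smul_comm],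
    fun j k => by simp only [map_smul, h.fib_eq, smul_mul_smul_comm, smul_add]⟩

/-- The product has degree `j`, the larger one. In the fiber of degree `j` it is the term `fib *
fib` if `i = j` and `low * fib` if `i < j`; the other terms vanish. -/
lemma isProd_single_of_le {i j : Fin (N + 1)} (h : i ≤ j) (α β α' β' : V N M) :
    IsProd (Finsupp.single (i, α, β) 1) (Finsupp.single (j, α', β') 1)
      (Finsupp.single (j, act i α β α', β') 1) := by
  have h' : i.1 ≤ j.1 := h
  refine ⟨by simp [theta_mul_of_le h'], fun l k => ?_, fun l k => ?_⟩
  · simp only [low_single, one_smul]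
    by_cases hj : j.1 < l
    · rw [if_pos hj, if_pos hj, if_pos (h'.trans_lt hj), theta_mul_of_le h',
        frz_act_of_le (h'.trans hj.le)]
    · simp [hj]
  · simp only [low_single, fib_single, one_smul]
    by_cases hj : j.1 = l
    · subst hj
      rcases h'.eq_or_lt with hij | hij
      · simp only [hij, if_true, lt_irrefl, if_false, zero_mul, mul_zero, add_zero]
        rw [theta_mul_of_le le_rfl, frz_act_self]
      · simp only [hij, hij.ne, if_true, lt_irrefl, if_false, zero_mul, mul_zero, add_zero, zero_add]
        rw [theta_mul_of_le (Nat.lt_succ_iff.1 i.2), frz_act_of_le h']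
    · simp only [hj, if_false, mul_zero, zero_add]
      by_cases hj' : j.1 < l
      · simp [(h'.trans_lt hj').ne]
      · simp [hj']

lemma isProd_single_of_ge {i j : Fin (N + 1)} (h : j < i) (α β α' β' : V N M) :
    IsProd (Finsupp.single (i, α, β) 1) (Finsupp.single (j, α', β') 1)
      (Finsupp.single (i, α, act j β' α' β) 1) := by
  have h' : j.1 < i.1 := h
  refine ⟨by simp [theta_mul_of_ge h'.le], fun l k => ?_, fun l k => ?_⟩
  · simp only [low_single, one_smul]
    by_cases hi : i.1 < l
    · rw [if_pos hi, if_pos hi, if_pos (h'.trans hi), theta_mul_of_ge h'.le,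
        frz_act_of_le (h'.trans hi).le]
    · simp [hi]
  · simp only [low_single, fib_single, one_smul]
    by_cases hi : i.1 = l
    · subst hi
      simp only [h', h'.ne, if_true, lt_irrefl, if_false, mul_zero, add_zero, zero_add]
      rw [theta_mul_of_ge (Nat.lt_succ_iff.1 j.2), frz_act_of_le h'.le]
    · simp only [hi, if_false, zero_mul, zero_add, add_zero]
      by_cases hi' : i.1 < l
      · simp [(h'.trans hi').ne]
      · simp [hi']

lemma exists_isProd (x y : Formal N M) : ∃ z, IsProd x y z := by
  induction x using Finsupp.induction_linear with
  | zero => exact ⟨0, by constructor <;> simp⟩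
  | add x x' hx hx' =>
    obtain ⟨z, hz⟩ := hx
    obtain ⟨z', hz'⟩ := hx'
    exact ⟨_, hz.add_left hz'⟩
  | single p c =>
    induction y using Finsupp.induction_linear with
    | zero => exact ⟨0, by constructor <;> simp⟩
    | add y y' hy hy' =>
      obtain ⟨z, hz⟩ := hy
      obtain ⟨z', hz'⟩ := hy'
      exact ⟨_, hz.add_right hz'⟩
    | single q d =>
      rw [← mul_one c, ← mul_one d, ← smul_eq_mul c, ← smul_eq_mul d, ← Finsupp.smul_single,
        ← Finsupp.smul_single]
      rcases le_or_gt p.1 q.1 with h | h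
      · exact ⟨_, (isProd_single_of_le h p.2.1 p.2.2 q.2.1 q.2.2).smul c d⟩
      · exact ⟨_, (isProd_single_of_ge h p.2.1 p.2.2 q.2.1 q.2.2).smul c d⟩

end

/-! ### Operator forms -/

section

open InnerProductSpace

variable {N M : ℕ}

/-- The value at `k` of the function `op x u`. -/
def opFun (u : Cube N → EuclideanSpace ℂ (Fin M)) (k : Cube N) :
    Formal N M →ₗ[ℂ] EuclideanSpace ℂ (Fin M) :=
  Finsupp.linearCombination ℂ fun p => kerFun p.1 p.2.1 p.2.2 u k

@[simp] lemma opFun_single (u : Cube N → EuclideanSpace ℂ (Fin M)) (k : Cube N)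
    (n : Fin (N + 1)) (α β : V N M) (c : ℂ) :
    opFun u k (Finsupp.single (n, α, β) c) = c • kerFun n α β u k := by simp [opFun]

lemma op_ae (x : Formal N M) (u : L2 N M) : op x u =ᵐ[volume] fun k => opFun u k x := by
  induction x using Finsupp.induction_linear with
  | zero =>
    filter_upwards [Lp.coeFn_zero (EuclideanSpace ℂ (Fin M)) 2 (volume : Measure (Cube N))] with k h
    simp
  | add x y hx hy =>
    rw [map_add, _root_.add_apply]
    filter_upwards [Lp.coeFn_add (op x u) (op y u), hx, hy] with k h1 h2 h3
    rw [h1, Pi.add_apply, h2, h3, map_add]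
  | single p c =>
    obtain ⟨n, α, β⟩ := p
    rw [op_single, _root_.smul_apply]
    filter_upwards [Lp.coeFn_smul c (theta n α β u), theta_ae n α β u] with k h1 h2
    rw [h1, Pi.smul_apply, h2, opFun_single]

/-- A column of a matrix-valued function. -/
def colV {q : ℕ} (A : C(Cube N, Matrix (Fin M) (Fin q) ℂ)) (c : Fin q) : V N M :=
  ⟨fun k => WithLp.toLp 2 fun i => A k i c, by
    have := A.continuous
    fun_prop⟩

/-- The conjugate of a row of a matrix-valued function. -/
def rowV {q : ℕ} (B : C(Cube N, Matrix (Fin q) (Fin M) ℂ)) (c : Fin q) : V N M :=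
  ⟨fun k => WithLp.toLp 2 fun i => star (B k c i), by
    have := B.continuous
    fun_prop⟩

/-- The constant function with value the `c`-th unit vector. -/
def basisV (c : Fin M) : V N M := ContinuousMap.const _ (EuclideanSpace.single c 1)

lemma ip_rowV {q : ℕ} (B : C(Cube N, Matrix (Fin q) (Fin M) ℂ)) (c : Fin q)
    (k : Cube N) (u : EuclideanSpace ℂ (Fin M)) :
    inner ℂ (rowV B c k) u = (B k *ᵥ u.ofLp) c := by
  simp [rowV, PiLp.inner_apply, Matrix.mulVec, dotProduct, mul_comm]

lemma ip_basisV (c : Fin M) (k : Cube N) (u : EuclideanSpace ℂ (Fin M)) :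
    inner ℂ (basisV c k) u = u c := by
  simp [basisV, EuclideanSpace.inner_single_left]

/-- The formal sum of the matrix coefficients `A ⟨B · ⟩_n`. -/
def matF {q : ℕ} (n : Fin (N + 1)) (A : C(Cube N, Matrix (Fin M) (Fin q) ℂ))
    (B : C(Cube N, Matrix (Fin q) (Fin M) ℂ)) : Formal N M :=
  ∑ c, Finsupp.single (n, colV A c, rowV B c) 1

/-- The formal sum of the operator of multiplication by `A`. -/
def mulF (A : C(Cube N, Matrix (Fin M) (Fin M) ℂ)) : Formal N M :=
  ∑ c, Finsupp.single (0, colV A c, basisV c) 1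

/-- The formal sum with the coefficients of an operator form. -/
def OpForm.toFormal (a : OpForm N M) : Formal N M :=
  mulF a.A0 + ∑ j : Fin N, matF j.succ (a.A j) (a.B j)

lemma avg_zero (g : Cube N → ℂ) (k : Cube N) : avg 0 g k = g k := by
  simp [avg, mix_zero]

lemma opFun_mulF (A : C(Cube N, Matrix (Fin M) (Fin M) ℂ))
    (u : Cube N → EuclideanSpace ℂ (Fin M)) (k : Cube N) :
    (opFun u k (mulF A)).ofLp = A k *ᵥ (u k).ofLp := by
  funext i
  simp only [mulF, map_sum, opFun_single, one_smul, kerFun, Fin.val_zero, avg_zero, ip_basisV]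
  simp [colV, Matrix.mulVec, dotProduct, mul_comm]

lemma opFun_matF {q : ℕ} (n : Fin (N + 1)) (A : C(Cube N, Matrix (Fin M) (Fin q) ℂ))
    (B : C(Cube N, Matrix (Fin q) (Fin M) ℂ))
    {u : Cube N → EuclideanSpace ℂ (Fin M)} (hu : StronglyMeasurable u) (k : Cube N) :
    (opFun u k (matF n A B)).ofLp =
      A k *ᵥ avgVec n (fun k' => B k' *ᵥ (u k').ofLp) (tail n k) := by
  funext i
  simp only [matF, map_sum, opFun_single, one_smul, kerFun]
  have h : ∀ c, avg n (fun s => inner ℂ (rowV B c s) (u s)) k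
      = avgVec n (fun k' => B k' *ᵥ (u k').ofLp) (tail n k) c := by
    intro c
    have hm : Measurable fun s => inner ℂ (rowV B c s) (u s) :=
      ((rowV B c).continuous.stronglyMeasurable.inner hu).measurable
    rw [← integral_glue (Nat.lt_succ_iff.1 n.2) hm]
    simp only [ip_rowV]
    rfl
  simp only [h]
  simp [colV, Matrix.mulVec, dotProduct, mul_comm]

lemma opFun_toFormal (a : OpForm N M) {u : Cube N → EuclideanSpace ℂ (Fin M)}
    (hu : StronglyMeasurable u) (k : Cube N) :
    (opFun u k a.toFormal).ofLp = a.A0 k *ᵥ (u k).ofLp +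
      ∑ j : Fin N, a.A j k *ᵥ
        avgVec (j.1 + 1) (fun k' => a.B j k' *ᵥ (u k').ofLp) (tail (j.1 + 1) k) := by
  rw [OpForm.toFormal, map_add, map_sum, WithLp.ofLp_add, opFun_mulF, WithLp.ofLp_sum]
  congr 1
  exact Finset.sum_congr rfl fun j _ => opFun_matF j.succ _ _ hu k

lemma OpForm.represents_iff (a : OpForm N M) (T : L2 N M →L[ℂ] L2 N M) :
    a.Represents T ↔ T = op a.toFormal := by
  constructor
  · intro h
    ext1 u
    refine Lp.ext ?_
    filter_upwards [h u, op_ae a.toFormal u] with k h1 h2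
    rw [h2]
    apply (WithLp.ofLp_injective 2)
    rw [h1, opFun_toFormal a (Lp.stronglyMeasurable u)]
  · rintro rfl u
    filter_upwards [op_ae a.toFormal u] with k h2
    rw [h2, opFun_toFormal a (Lp.stronglyMeasurable u)]

lemma isMul_iff (A : C(Cube N, Matrix (Fin M) (Fin M) ℂ)) (T : L2 N M →L[ℂ] L2 N M) :
    IsMul A T ↔ T = op (mulF A) := by
  constructor
  · intro h
    ext1 u
    refine Lp.ext ?_
    filter_upwards [h u, op_ae (mulF A) u] with k h1 h2
    rw [h2]
    apply (WithLp.ofLp_injective 2)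
    rw [h1, opFun_mulF]
  · rintro rfl u
    filter_upwards [op_ae (mulF A) u] with k h2
    rw [h2, opFun_mulF]

lemma isAvg_iff (n : Fin (N + 1)) (T : L2 N M →L[ℂ] L2 N M) :
    IsAvg n.1 T ↔ T = op (matF n (1 : C(Cube N, Matrix (Fin M) (Fin M) ℂ)) 1) := by
  have key : ∀ (u : L2 N M) k, (opFun u k (matF n (1 : C(Cube N, Matrix (Fin M) (Fin M) ℂ)) 1)).ofLp
      = avgVec n (fun k' => (u k').ofLp) (tail n k) := fun u k => by
    rw [opFun_matF n _ _ (Lp.stronglyMeasurable u)]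
    simp
  constructor
  · intro h
    ext1 u
    refine Lp.ext ?_
    filter_upwards [h u, op_ae (matF n (1 : C(Cube N, Matrix (Fin M) (Fin M) ℂ)) 1) u] with k h1 h2
    rw [h2]
    apply (WithLp.ofLp_injective 2)
    rw [h1, key]
  · rintro rfl u
    filter_upwards [op_ae (matF n (1 : C(Cube N, Matrix (Fin M) (Fin M) ℂ)) 1) u] with k h2
    rw [h2, key]

lemma op_mulF_one : op (mulF (1 : C(Cube N, Matrix (Fin M) (Fin M) ℂ))) = 1 := by
  symm
  rw [← isMul_iff]
  intro u
  exact Eventually.of_forall fun k => by simp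

lemma exists_op_eq (A : H N M) : ∃ x : Formal N M, op x = A.1 := by
  obtain ⟨A, hA⟩ := A
  induction hA using Algebra.adjoin_induction with
  | mem T hT =>
    rcases hT with ⟨A, hA⟩ | ⟨j, hj⟩
    · exact ⟨_, ((isMul_iff A T).1 hA).symm⟩
    · exact ⟨_, ((isAvg_iff j.succ T).1 hj).symm⟩
  | algebraMap r => exact ⟨r • mulF 1, by
      rw [map_smul, op_mulF_one]; exact (Algebra.algebraMap_eq_smul_one r).symm⟩
  | add S T _ _ hS hT =>
    obtain ⟨x, hx⟩ := hS
    obtain ⟨y, hy⟩ := hT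
    exact ⟨x + y, by simp_all⟩
  | mul S T _ _ hS hT =>
    obtain ⟨x, hx⟩ := hS
    obtain ⟨y, hy⟩ := hT
    obtain ⟨z, hz⟩ := exists_isProd x y
    exact ⟨z, by simp_all [hz.op_eq]⟩

/-! ### Membership in `H` and existence of operator forms -/

/-- The matrix-valued function `α β*`. -/
def outer (α β : V N M) : C(Cube N, Matrix (Fin M) (Fin M) ℂ) :=
  ⟨fun k => Matrix.of fun i j => α k i * star (β k j), by
    have h1 := α.continuous
    have h2 := β.continuous
    refine continuous_matrix fun i j => ?_
    simp only [Matrix.of_apply]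
    fun_prop⟩

lemma isMul_theta_zero (α β : V N M) : IsMul (outer α β) (theta 0 α β) := by
  intro u
  filter_upwards [theta_ae 0 α β u] with k h
  rw [h]
  funext i
  simp only [kerFun, avg_zero]
  simp only [outer, ContinuousMap.coe_mk, Matrix.mulVec, dotProduct, Matrix.of_apply,
    PiLp.inner_apply, PiLp.smul_apply, smul_eq_mul, Finset.sum_mul, RCLike.star_def,
    RCLike.inner_apply]
  exact Finset.sum_congr rfl fun _ _ => by ring

lemma theta_zero_mem_H (α β : V N M) : theta 0 α β ∈ H N M :=
  Algebra.subset_adjoin (Or.inl ⟨_, isMul_theta_zero α β⟩)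

lemma colV_one (c : Fin M) : colV (1 : C(Cube N, Matrix (Fin M) (Fin M) ℂ)) c = basisV c := by
  ext k i
  simp [colV, basisV, Matrix.one_apply]

lemma rowV_one (c : Fin M) : rowV (1 : C(Cube N, Matrix (Fin M) (Fin M) ℂ)) c = basisV c := by
  ext k i
  simp [rowV, basisV, Matrix.one_apply, apply_ite, eq_comm]

lemma act_zero_basisV (α f : V N M) (c : Fin M) (k : Cube N) :
    act 0 α (basisV c) f k = f k c • α k := by
  rw [act_apply, avg_zero]
  exact congrArg (· • α k) (ip_basisV c k (f k))

lemma theta_smul_left (n : ℕ) (α β : V N M) (c : ℂ) : theta n (c • α) β = c • theta n α β := by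
  refine ext_J fun f => ?_
  rw [theta_J, _root_.smul_apply, theta_J, ← map_smul]
  congr 1
  ext1 k
  simp [act_apply, smul_comm c]

lemma theta_zero_left (n : ℕ) (β : V N M) : theta n 0 β = 0 := by
  refine ext_J fun f => ?_
  rw [theta_J, _root_.zero_apply, ← map_zero J]
  congr 1
  ext1 k
  simp [act_apply]

lemma theta_zero_right (n : ℕ) (α : V N M) : theta n α 0 = 0 := by
  refine ext_J fun f => ?_
  rw [theta_J, _root_.zero_apply, ← map_zero J]
  congr 1
  ext1 k
  simp [act_apply, ip, avg]

/-- The average is the sum over the unit vectors `e_d` of the elementary operators with both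
coefficients `e_d`. The degree 0 factors around it select the term `d = c` and install `α` and `β`;
some `c` exists because `M > 0`. -/
lemma theta_mem_H (hM : 0 < M) (n : Fin (N + 1)) (α β : V N M) : theta n α β ∈ H N M := by
  refine Fin.cases (theta_zero_mem_H α β) (fun j => ?_) n
  have havg : op (matF j.succ (1 : C(Cube N, Matrix (Fin M) (Fin M) ℂ)) 1) ∈ H N M :=
    Algebra.subset_adjoin (Or.inr ⟨j, (isAvg_iff j.succ _).2 rfl⟩)
  let c : Fin M := ⟨0, hM⟩
  have key : theta j.succ α β = theta 0 α (basisV c) *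
      (op (matF j.succ (1 : C(Cube N, Matrix (Fin M) (Fin M) ℂ)) 1) * theta 0 (basisV c) β) := by
    have h1 : ∀ d, theta j.succ (basisV d) (basisV d) * theta 0 (basisV c) β
        = if d = c then theta j.succ (basisV c) β else 0 := by
      intro d
      rw [theta_mul_of_ge (Nat.zero_le _)]
      split_ifs with h
      · subst h
        congr 1
        ext1 k
        rw [act_zero_basisV]; simp [basisV]
      · have : act 0 β (basisV c) (basisV d) = 0 := by
          ext1 k
          rw [act_zero_basisV]; simp [basisV, Ne.symm h]
        rw [this, theta_zero_right]
    simp only [matF, map_sum, op_single, one_smul, colV_one, rowV_one, Finset.sum_mul, h1]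
    rw [Finset.sum_ite_eq', if_pos (Finset.mem_univ _), theta_mul_of_le (Nat.zero_le _)]
    congr 1
    ext1 k
    rw [act_zero_basisV]; simp [basisV]
  rw [key]
  exact mul_mem (theta_zero_mem_H _ _) (mul_mem havg (theta_zero_mem_H _ _))

/-- An operator form for the sum of the operators given by two operator forms. -/
def OpForm.add (a b : OpForm N M) : OpForm N M where
  A0 := a.A0 + b.A0
  m j := a.m j + b.m j
  m_pos j := Nat.add_pos_left (a.m_pos j) _
  A j := ⟨fun k => Matrix.of fun i => Fin.append (a.A j k i) (b.A j k i), by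
    have h1 := (a.A j).continuous
    have h2 := (b.A j).continuous
    refine continuous_matrix fun i c => ?_
    refine Fin.addCases (fun c => ?_) (fun c => ?_) c
    · simp only [Matrix.of_apply]; fun_prop
    · simp only [Matrix.of_apply]; fun_prop⟩
  B j := ⟨fun k => Matrix.of (Fin.append (a.B j k) (b.B j k)), by
    have h1 := (a.B j).continuous
    have h2 := (b.B j).continuous
    refine continuous_matrix fun c i => ?_
    refine Fin.addCases (fun c => ?_) (fun c => ?_) c
    · simp only [Matrix.of_apply]; fun_prop
    · simp only [Matrix.of_apply]; fun_prop⟩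

lemma op_mulF_add (A A' : C(Cube N, Matrix (Fin M) (Fin M) ℂ)) :
    op (mulF (A + A')) = op (mulF A) + op (mulF A') := by
  symm
  rw [← map_add, ← isMul_iff]
  intro u
  filter_upwards [op_ae (mulF A + mulF A') u] with k h
  rw [h, map_add, WithLp.ofLp_add, opFun_mulF, opFun_mulF, ContinuousMap.add_apply, Matrix.add_mulVec]

lemma op_add_toFormal (a b : OpForm N M) :
    op (a.add b).toFormal = op a.toFormal + op b.toFormal := by
  have h : ∀ j : Fin N, matF j.succ ((a.add b).A j) ((a.add b).B j)
      = matF j.succ (a.A j) (a.B j) + matF j.succ (b.A j) (b.B j) := by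
    intro j
    unfold matF
    change ∑ c : Fin (a.m j + b.m j), _ = _
    rw [Fin.sum_univ_add]
    congr 1 <;> refine Finset.sum_congr rfl fun c _ => ?_
    · congr 3
      · ext k i; exact Fin.append_left _ _ _
      · ext k i; exact congrArg star (congrFun (Fin.append_left _ _ _) i)
    · congr 3
      · ext k i; exact Fin.append_right _ _ _
      · ext k i; exact congrArg star (congrFun (Fin.append_right _ _ _) i)
  simp only [OpForm.toFormal, map_add, h, Finset.sum_add_distrib]
  rw [show (a.add b).A0 = a.A0 + b.A0 from rfl, op_mulF_add]
  abel

/-- An operator form for `α ⟨⟨β, ·⟩⟩_n`. -/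
def OpForm.single (n : Fin (N + 1)) (α β : V N M) : OpForm N M where
  A0 := if n = 0 then outer α β else 0
  -- The sizes must be positive, so unused degrees have size one and left coefficient zero.
  m _ := 1
  m_pos _ := Nat.one_pos
  A j := if n = j.succ then ⟨fun k => Matrix.of fun i _ => α k i, by
    have h1 := α.continuous
    refine continuous_matrix fun i j => ?_
    simp only [Matrix.of_apply]
    fun_prop⟩ else 0
  B j := ⟨fun k => Matrix.of fun _ i => star (β k i), by
    have h2 := β.continuous
    refine continuous_matrix fun i j => ?_
    simp only [Matrix.of_apply]
    fun_prop⟩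

lemma op_mulF_zero : op (mulF (0 : C(Cube N, Matrix (Fin M) (Fin M) ℂ))) = 0 := by
  symm
  rw [← isMul_iff]
  intro u
  filter_upwards [Lp.coeFn_zero (EuclideanSpace ℂ (Fin M)) 2 (volume : Measure (Cube N))] with k h1
  rw [_root_.zero_apply, h1]
  simp

lemma op_single_toFormal (n : Fin (N + 1)) (α β : V N M) :
    op (OpForm.single n α β).toFormal = theta n α β := by
  have h1 : ∀ j : Fin N, op (matF j.succ ((OpForm.single n α β).A j) ((OpForm.single n α β).B j))
      = if n = j.succ then theta n α β else 0 := by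
    intro j
    unfold matF
    change op (∑ c : Fin 1, _) = _
    rw [Fin.sum_univ_one, op_single, one_smul]
    have hrow : rowV ((OpForm.single n α β).B j) (0 : Fin 1) = β := by
      ext k i; exact star_star _
    rw [hrow]
    split_ifs with h
    · subst h
      congr 1
      simp only [OpForm.single, if_true]
      rfl
    · have : colV ((OpForm.single n α β).A j) (0 : Fin 1) = 0 := by
        simp only [OpForm.single, if_neg h]
        rfl
      rw [this, theta_zero_left]
  have h0 : op (mulF (OpForm.single n α β).A0) = if n = 0 then theta n α β else 0 := by
    split_ifs with h
    · subst h
      exact ((isMul_iff _ _).1 (isMul_theta_zero α β)).symm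
    · simp only [OpForm.single, if_neg h]
      exact op_mulF_zero
  rw [OpForm.toFormal, map_add, map_sum, h0]
  simp only [h1]
  refine Fin.cases ?_ (fun i => ?_) n
  · simp [eq_comm]
  · simp

lemma exists_opForm (x : Formal N M) : ∃ a : OpForm N M, op a.toFormal = op x := by
  induction x using Finsupp.induction_linear with
  | zero => exact ⟨OpForm.single 0 0 0, by rw [op_single_toFormal, theta_zero_left, map_zero]⟩
  | add x y hx hy =>
    obtain ⟨a, ha⟩ := hx
    obtain ⟨b, hb⟩ := hy
    exact ⟨a.add b, by rw [op_add_toFormal, ha, hb, map_add]⟩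
  | single p c => exact
    ⟨OpForm.single p.1 (c • p.2.1) p.2.2, by rw [op_single_toFormal, theta_smul_left, ← op_single]⟩

lemma exists_represents (A : H N M) : ∃ a : OpForm N M, a.Represents A.1 := by
  obtain ⟨x, hx⟩ := exists_op_eq A
  obtain ⟨a, ha⟩ := exists_opForm x
  exact ⟨a, (a.represents_iff _).2 (by rw [ha, hx])⟩

end

/-! ### The trace norm -/

section

open InnerProductSpace

variable {N M : ℕ}

/-- A formal sum for an element of `H`. -/
def formalOf (A : H N M) : Formal N M := (exists_op_eq A).choose

lemma op_formalOf (A : H N M) : op (formalOf A) = A.1 := (exists_op_eq A).choose_spec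

lemma fib_congr_op {x y : Formal N M} (h : op x = op y) (j : ℕ) (k : Cube N) :
    fib j k x = fib j k y := by
  rw [← sub_eq_zero, ← map_sub]
  exact fib_eq_zero_of_op (by rw [map_sub, h, sub_self]) j k

lemma low_congr_op {x y : Formal N M} (h : op x = op y) (j : ℕ) (k : Cube N) :
    low j k x = low j k y := by
  rw [← sub_eq_zero, ← map_sub]
  exact low_eq_zero_of_op (by rw [map_sub, h, sub_self]) j k

/-- The finite rank operator in the fiber at `k` given by the part of degree `j`. -/
def fibH (j : ℕ) (k : Cube N) : H N M →ₗ[ℂ] (L2 N M →L[ℂ] L2 N M) where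
  toFun A := fib j k (formalOf A)
  map_add' A B := by
    rw [← map_add]
    exact fib_congr_op (by rw [map_add, op_formalOf, op_formalOf, op_formalOf]; rfl) j k
  map_smul' c A := by
    rw [← map_smul]
    exact fib_congr_op (by rw [map_smul, op_formalOf, op_formalOf]; rfl) j k

/-- The operator in the fiber at `k` given by the parts of degree less than `j`. -/
def lowH (j : ℕ) (k : Cube N) : H N M →ₗ[ℂ] (L2 N M →L[ℂ] L2 N M) where
  toFun A := low j k (formalOf A)
  map_add' A B := by
    rw [← map_add]
    exact low_congr_op (by rw [map_add, op_formalOf, op_formalOf, op_formalOf]; rfl) j k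
  map_smul' c A := by
    rw [← map_smul]
    exact low_congr_op (by rw [map_smul, op_formalOf, op_formalOf]; rfl) j k

lemma fibH_eq {A : H N M} {x : Formal N M} (h : op x = A.1) (j : ℕ) (k : Cube N) :
    fibH j k A = fib j k x := fib_congr_op (by rw [op_formalOf, h]) j k

lemma lowH_eq {A : H N M} {x : Formal N M} (h : op x = A.1) (j : ℕ) (k : Cube N) :
    lowH j k A = low j k x := low_congr_op (by rw [op_formalOf, h]) j k

lemma lowH_mul (j : ℕ) (k : Cube N) (A B : H N M) :
    lowH j k (A * B) = lowH j k A * lowH j k B := by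
  obtain ⟨z, hz⟩ := exists_isProd (formalOf A) (formalOf B)
  rw [lowH_eq (x := z) (by rw [hz.op_eq, op_formalOf, op_formalOf]; rfl), hz.low_eq]
  rfl

lemma fibH_mul (j : ℕ) (k : Cube N) (A B : H N M) :
    fibH j k (A * B) = fibH j k A * fibH j k B + lowH j k A * fibH j k B
      + fibH j k A * lowH j k B := by
  obtain ⟨z, hz⟩ := exists_isProd (formalOf A) (formalOf B)
  rw [fibH_eq (x := z) (by rw [hz.op_eq, op_formalOf, op_formalOf]; rfl), hz.fib_eq]
  rfl

lemma coe_eq_lowH (k : Cube N) (A : H N M) : A.1 = lowH (N + 1) k A := by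
  rw [← op_formalOf A, op_eq_low k]; rfl

lemma lowH_zero (k : Cube N) (A : H N M) : lowH 0 k A = 0 := by
  change low 0 k _ = 0
  rw [low_eq_sum, Finset.range_zero, Finset.sum_empty]

lemma fibH_eq_zero_of_lt {j : ℕ} (hj : N < j) (k : Cube N) (A : H N M) : fibH j k A = 0 :=
  fib_eq_zero_of_lt hj k _

lemma frz_basisV (j : ℕ) (k : Cube N) (c : Fin M) : frz j k (basisV c) = basisV c := rfl

lemma low_mulF {j : ℕ} (hj : 0 < j) (k : Cube N) (A : C(Cube N, Matrix (Fin M) (Fin M) ℂ)) :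
    low j k (mulF A) = ∑ c, theta 0 (frz j k (colV A c)) (basisV c) := by
  simp only [mulF, map_sum, low_single, Fin.val_zero, if_pos hj, one_smul, frz_basisV]

lemma fib_mulF_of_pos {j : ℕ} (hj : 0 < j) (k : Cube N)
    (A : C(Cube N, Matrix (Fin M) (Fin M) ℂ)) : fib j k (mulF A) = 0 := by
  rw [mulF, map_sum]
  exact Finset.sum_eq_zero fun c _ => by rw [fib_single, if_neg (show ¬(0 : Fin (N + 1)).1 = j from hj.ne)]

lemma fib_mulF_zero (k : Cube N) (A : C(Cube N, Matrix (Fin M) (Fin M) ℂ)) :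
    fib 0 k (mulF A) = finRank (fun c => J (frz 0 k (colV A c))) (fun c => J (basisV c)) := by
  simp only [mulF, map_sum, fib_single, Fin.val_zero, if_true, one_smul, frz_basisV, finRank,
    theta_of_le le_rfl]

lemma fib_matF {q : ℕ} (n : Fin (N + 1)) (A : C(Cube N, Matrix (Fin M) (Fin q) ℂ))
    (B : C(Cube N, Matrix (Fin q) (Fin M) ℂ)) (j : ℕ) (k : Cube N) :
    fib j k (matF n A B) = if n.1 = j then
      finRank (fun c => J (frz j k (colV A c))) (fun c => J (frz j k (rowV B c))) else 0 := by
  split_ifs with h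
  · simp only [matF, map_sum, fib_single, if_pos h, one_smul, finRank, theta_of_le le_rfl]
  · simp only [matF, map_sum, fib_single, if_neg h, Finset.sum_const_zero]

lemma lowH_one {j : ℕ} (hj : 0 < j) (k : Cube N) : lowH j k (1 : H N M) = 1 := by
  rw [lowH_eq (x := mulF 1) op_mulF_one, low_mulF hj, ← op_mulF_one, mulF]
  simp only [map_sum, op_single, one_smul, colV_one, frz_basisV, Fin.val_zero]

lemma fibH_one {j : ℕ} (hj : 0 < j) (k : Cube N) : fibH j k (1 : H N M) = 0 := by
  rw [fibH_eq (x := mulF 1) op_mulF_one, fib_mulF_of_pos hj]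

lemma fibH_zero_one (k : Cube N) :
    fibH 0 k (1 : H N M) = finRank (fun c => J (basisV c)) (fun c => J (basisV c)) := by
  rw [fibH_eq (x := mulF 1) op_mulF_one, fib_mulF_zero]
  simp only [colV_one, frz_basisV]

lemma OpForm.Represents.op_toFormal {a : OpForm N M} {A : H N M} (h : a.Represents A.1) :
    op a.toFormal = A.1 := ((a.represents_iff _).1 h).symm

lemma OpForm.Represents.fibH_zero {a : OpForm N M} {A : H N M} (h : a.Represents A.1)
    (k : Cube N) :
    fibH 0 k A = finRank (fun c => J (frz 0 k (colV a.A0 c))) (fun c => J (basisV c)) := by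
  rw [fibH_eq h.op_toFormal, OpForm.toFormal, map_add, map_sum, fib_mulF_zero]
  simp [fib_matF]

lemma OpForm.Represents.fibH_succ {a : OpForm N M} {A : H N M} (h : a.Represents A.1)
    (j : Fin N) (k : Cube N) :
    fibH (j.1 + 1) k A = finRank (fun c => J (frz (j.1 + 1) k (colV (a.A j) c)))
      (fun c => J (frz (j.1 + 1) k (rowV (a.B j) c))) := by
  rw [fibH_eq h.op_toFormal, OpForm.toFormal, map_add, map_sum, fib_mulF_of_pos (Nat.succ_pos _),
    zero_add, Finset.sum_eq_single j]
  · rw [fib_matF, if_pos (by simp)]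
  · intro i _ hi
    rw [fib_matF, if_neg]
    simpa [Fin.ext_iff] using hi
  · simp

lemma exists_fibH_eq (j : ℕ) (A : H N M) : ∃ (m : ℕ) (α β : Fin m → V N M),
    ∀ k, fibH j k A = finRank (fun c => J (frz j k (α c))) (fun c => J (frz j k (β c))) := by
  obtain ⟨a, ha⟩ := exists_represents A
  rcases j with _ | j
  · exact ⟨M, colV a.A0, basisV, fun k => by rw [ha.fibH_zero]; simp only [frz_basisV]⟩
  · by_cases hj : j < N
    · exact ⟨a.m ⟨j, hj⟩, colV (a.A ⟨j, hj⟩), rowV (a.B ⟨j, hj⟩), fun k => ha.fibH_succ ⟨j, hj⟩ k⟩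
    · exact ⟨0, Fin.elim0, Fin.elim0, fun k => by
        rw [fibH_eq_zero_of_lt (by omega)]; simp [finRank]⟩

lemma isFinRank_fibH (j : ℕ) (k : Cube N) (A : H N M) : IsFinRank (fibH j k A) := by
  obtain ⟨m, α, β, h⟩ := exists_fibH_eq j A
  exact ⟨m, _, _, h k⟩

/-- The nuclear norm. -/
def nuc {E : Type*} [NormedAddCommGroup E] [InnerProductSpace ℂ E] (T : E →L[ℂ] E) : ℝ :=
  sInf {C | 0 ≤ C ∧ NucLe T C}

lemma nuc_finRank {E : Type*} [NormedAddCommGroup E] [InnerProductSpace ℂ E]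
    {m : ℕ} (a b : Fin m → E) :
    nuc (finRank a b) = sumSqrtEig (gram ℂ b * gram ℂ a) := by
  refine IsLeast.csInf_eq ⟨⟨sumSqrtEig_nonneg _, nucLe_finRank a b⟩, ?_⟩
  rintro C ⟨h0, hC⟩
  exact sumSqrtEig_le_of_nucLe h0 hC

lemma IsFinRank.nucLe_nuc {E : Type*} [NormedAddCommGroup E] [InnerProductSpace ℂ E]
    {T : E →L[ℂ] E} (h : IsFinRank T) : NucLe T (nuc T) := by
  obtain ⟨m, a, b, rfl⟩ := h
  rw [nuc_finRank]
  exact nucLe_finRank a b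

lemma nuc_nonneg {E : Type*} [NormedAddCommGroup E] [InnerProductSpace ℂ E]
    (T : E →L[ℂ] E) : 0 ≤ nuc T := Real.sInf_nonneg fun _ h => h.1

lemma nuc_le {E : Type*} [NormedAddCommGroup E] [InnerProductSpace ℂ E]
    {T : E →L[ℂ] E} {C : ℝ} (h0 : 0 ≤ C) (h : NucLe T C) : nuc T ≤ C :=
  csInf_le ⟨0, fun _ h => h.1⟩ ⟨h0, h⟩

lemma norm_J_le (f : V N M) : ‖J f‖ ≤ ‖f‖ := by
  refine le_of_sq_le_sq ?_ (norm_nonneg _)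
  rw [norm_J_sq 0]
  refine (integral_mono (integrable_of_continuous (continuous_norm_J_frz_sq _ _))
    (integrable_const (‖f‖ ^ 2)) fun k => ?_).trans (by simp)
  have h := norm_J_frz_sq 0 k f
  rw [avg_zero] at h
  have h2 : ‖J (frz 0 k f)‖ ^ 2 = ‖f k‖ ^ 2 := by
    have := inner_self_eq_norm_sq_to_K (𝕜 := ℂ) (f k)
    exact Complex.ofReal_injective (h.trans (this.trans (by push_cast; rfl)))
  change ‖J (frz 0 k f)‖ ^ 2 ≤ _
  rw [h2]
  exact pow_le_pow_left₀ (norm_nonneg _) (f.norm_coe_le_norm k) 2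

lemma norm_frz_le (j : ℕ) (k : Cube N) (f : V N M) : ‖frz j k f‖ ≤ ‖f‖ :=
  (ContinuousMap.norm_le _ (norm_nonneg f)).2 fun _ => f.norm_coe_le_norm _

/-- Without this the real supremum in `degNorm` would not be an upper bound: it defaults to 0 on
unbounded families. -/
lemma bddAbove_nuc_fibH (j : ℕ) (A : H N M) :
    BddAbove (Set.range fun k => nuc (fibH j k A)) := by
  obtain ⟨m, α, β, h⟩ := exists_fibH_eq j A
  refine ⟨∑ c, ‖α c‖ * ‖β c‖, ?_⟩
  rintro _ ⟨k, rfl⟩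
  have h0 : ∀ f : V N M, ‖J (frz j k f)‖ ≤ ‖f‖ := fun f => (norm_J_le _).trans (norm_frz_le j k f)
  refine nuc_le (Finset.sum_nonneg fun c _ => by positivity) ?_
  rw [h k]
  exact nucLe_sum _ fun c _ => (nucLe_rankOne _ _).mono
    (mul_le_mul (h0 _) (h0 _) (norm_nonneg _) (norm_nonneg _))

/-- The contribution of degree `j` to the trace norm. -/
def degNorm (j : ℕ) (A : H N M) : ℝ := ⨆ k, nuc (fibH j k A)

lemma degNorm_nonneg (j : ℕ) (A : H N M) : 0 ≤ degNorm j A :=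
  Real.iSup_nonneg fun _ => nuc_nonneg _

lemma nucLe_degNorm (j : ℕ) (k : Cube N) (A : H N M) : NucLe (fibH j k A) (degNorm j A) :=
  (isFinRank_fibH j k A).nucLe_nuc.mono (le_ciSup (bddAbove_nuc_fibH j A) k)

lemma degNorm_le {j : ℕ} {A : H N M} {C : ℝ} (h0 : 0 ≤ C) (h : ∀ k, NucLe (fibH j k A) C) :
    degNorm j A ≤ C := ciSup_le fun k => nuc_le h0 (h k)

lemma norm_fibH_le (j : ℕ) (k : Cube N) (A : H N M) : ‖fibH j k A‖ ≤ degNorm j A :=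
  (nucLe_degNorm j k A).norm_le (degNorm_nonneg j A)

lemma norm_lowH_le (j : ℕ) (k : Cube N) (A : H N M) :
    ‖lowH j k A‖ ≤ ∑ i ∈ Finset.range j, degNorm i A :=
  norm_low_le (fun i => degNorm_nonneg i A) fun i l => norm_fibH_le i l A

lemma avgMat_tail {p q n : ℕ} (hn : n ≤ N) {F : Cube N → Matrix (Fin p) (Fin q) ℂ}
    (hF : Continuous F) (k : Cube N) (c : Fin p) (d : Fin q) :
    avgMat n F (tail n k) c d = avg n (fun s => F s c d) k :=
  integral_glue hn (hF.matrix_elem c d).measurable k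

lemma inner_J_frz (n : ℕ) (k : Cube N) (α β : V N M) :
    inner ℂ (J (frz n k α)) (J (frz n k β)) = avg n (ip α β) k := by
  rw [inner_J]; rfl

/-- The Gram matrices of the frozen columns of `A_j` and of the frozen conjugate rows of `B_j` are
`⟨A_j* A_j⟩_j` and `⟨B_j B_j*⟩_j`. In degree 0 the right vectors are orthonormal and only `A_0* A_0`
remains. -/
lemma OpForm.Represents.g_tail {a : OpForm N M} {A : H N M} (h : a.Represents A.1)
    (j : Fin (N + 1)) (k : Cube N) : a.g j (tail j.1 k) = nuc (fibH j.1 k A) := by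
  refine Fin.cases ?_ (fun j => ?_) j
  · change sumSqrtEig ((a.A0 (full (tail 0 k)))ᴴ * a.A0 (full (tail 0 k))) = nuc (fibH 0 k A)
    rw [h.fibH_zero, nuc_finRank]
    congr 1
    have h1 : gram ℂ (fun c => J (basisV c : V N M)) = 1 := by
      ext c d
      have := inner_J_frz 0 k (basisV c : V N M) (basisV d)
      rw [frz_basisV, frz_basisV] at this
      rw [Matrix.gram_apply, this, avg_zero]
      change inner ℂ (basisV c k) (basisV d k) = _
      rw [ip_basisV]
      simp [basisV, Matrix.one_apply]
    rw [h1, one_mul]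
    ext c d
    rw [Matrix.gram_apply, inner_J_frz, avg_zero]
    rw [show full (tail 0 k) = k from full_tail k]
    simp [ip, colV, Matrix.mul_apply, PiLp.inner_apply, mul_comm]
  · change sumSqrtEig (avgMat (j.1 + 1) _ (tail (j.1 + 1) k) * avgMat (j.1 + 1) _ (tail (j.1 + 1) k))
      = nuc (fibH (j.1 + 1) k A)
    have hA := (a.A j).continuous
    have hB := (a.B j).continuous
    rw [h.fibH_succ, nuc_finRank]
    congr 2
    · ext c d
      rw [Matrix.gram_apply, inner_J_frz, avgMat_tail j.2 (hB.matrix_mul hB.matrix_conjTranspose)]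
      congr 1
      funext s
      simp [ip, rowV, Matrix.mul_apply, PiLp.inner_apply, mul_comm]
    · ext c d
      rw [Matrix.gram_apply, inner_J_frz, avgMat_tail j.2 (hA.matrix_conjTranspose.matrix_mul hA)]
      congr 1
      funext s
      simp [ip, colV, Matrix.mul_apply, PiLp.inner_apply, mul_comm]

lemma surjective_tail (n : ℕ) : Function.Surjective (tail n : Cube N → Cube (N - n)) :=
  fun κ => ⟨ext n κ, tail_ext κ⟩

lemma OpForm.Represents.trNorm_eq_sum {a : OpForm N M} {A : H N M} (h : a.Represents A.1) :
    a.trNorm = ∑ j ∈ Finset.range (N + 1), degNorm j A := by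
  rw [OpForm.trNorm, Finset.sum_range]
  refine Finset.sum_congr rfl fun j _ => ?_
  rw [← (surjective_tail j.1).iSup_comp]
  exact iSup_congr (h.g_tail j)

lemma trNorm_eq_sum (A : H N M) : trNorm A = ∑ j ∈ Finset.range (N + 1), degNorm j A := by
  rw [trNorm, dif_pos (exists_represents A)]
  exact (exists_represents A).choose_spec.trNorm_eq_sum

lemma trNorm_eq {A : H N M} {a : OpForm N M} (h : a.Represents A.1) : trNorm A = a.trNorm := by
  rw [trNorm_eq_sum, h.trNorm_eq_sum]

lemma norm_coe_le_trNorm (A : H N M) : ‖A.1‖ ≤ trNorm A := by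
  rw [coe_eq_lowH (fun _ => 0), trNorm_eq_sum]
  exact norm_lowH_le _ _ A

lemma trNorm_eq_zero_iff (A : H N M) : trNorm A = 0 ↔ A = 0 := by
  constructor
  · intro h
    have := norm_coe_le_trNorm A
    rw [h] at this
    exact Subtype.ext (norm_le_zero_iff.1 this)
  · rintro rfl
    rw [trNorm_eq_sum]
    refine Finset.sum_eq_zero fun j _ => le_antisymm (degNorm_le le_rfl fun k => ?_)
      (degNorm_nonneg j _)
    rw [map_zero]
    exact NucLe.zero

lemma degNorm_add_le (j : ℕ) (A B : H N M) : degNorm j (A + B) ≤ degNorm j A + degNorm j B :=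
  degNorm_le (add_nonneg (degNorm_nonneg _ _) (degNorm_nonneg _ _)) fun k => by
    rw [map_add]; exact (nucLe_degNorm j k A).add (nucLe_degNorm j k B)

lemma degNorm_smul_le (j : ℕ) (c : ℂ) (A : H N M) : degNorm j (c • A) ≤ ‖c‖ * degNorm j A :=
  degNorm_le (mul_nonneg (norm_nonneg _) (degNorm_nonneg _ _)) fun k => by
    rw [map_smul]; exact (nucLe_degNorm j k A).smul c

lemma trNorm_add_le (A B : H N M) : trNorm (A + B) ≤ trNorm A + trNorm B := by
  simp only [trNorm_eq_sum, ← Finset.sum_add_distrib]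
  exact Finset.sum_le_sum fun j _ => degNorm_add_le j A B

lemma trNorm_smul_le (c : ℂ) (A : H N M) : trNorm (c • A) ≤ ‖c‖ * trNorm A := by
  simp only [trNorm_eq_sum, Finset.mul_sum]
  exact Finset.sum_le_sum fun j _ => degNorm_smul_le j c A

lemma trNorm_smul (c : ℂ) (A : H N M) : trNorm (c • A) = ‖c‖ * trNorm A := by
  refine le_antisymm (trNorm_smul_le c A) ?_
  rcases eq_or_ne c 0 with rfl | hc
  · simp [(trNorm_eq_zero_iff (0 : H N M)).2 rfl]
  · have h := trNorm_smul_le c⁻¹ (c • A)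
    rw [smul_smul, inv_mul_cancel₀ hc, one_smul, norm_inv] at h
    rwa [← le_inv_mul_iff₀ (norm_pos_iff.2 hc)]

/-- Each term of `fibH_mul` contains a finite rank factor, measured in the nuclear norm; the other
factor needs only its operator norm, and for `lowH` this is bounded by the lower degrees. -/
lemma degNorm_mul_le (j : ℕ) (A B : H N M) : degNorm j (A * B) ≤
    degNorm j A * degNorm j B + (∑ i ∈ Finset.range j, degNorm i A) * degNorm j B
      + degNorm j A * ∑ i ∈ Finset.range j, degNorm i B := by
  have h := degNorm_nonneg (N := N) (M := M)
  have hs : ∀ A : H N M, 0 ≤ ∑ i ∈ Finset.range j, degNorm i A := fun A =>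
    Finset.sum_nonneg fun i _ => h i A
  refine degNorm_le (add_nonneg (add_nonneg (mul_nonneg (h _ _) (h _ _))
    (mul_nonneg (hs _) (h _ _))) (mul_nonneg (h _ _) (hs _))) fun k => ?_
  rw [fibH_mul]
  refine (((nucLe_degNorm j k A).mul (h _ _) (h _ _) (nucLe_degNorm j k B)).add
    (((nucLe_degNorm j k B).mul_left (h _ _) _).mono ?_)).add
    (((nucLe_degNorm j k A).mul_right (h _ _) _).mono ?_)
  · exact mul_le_mul_of_nonneg_right (norm_lowH_le j k A) (h _ _)
  · exact mul_le_mul_of_nonneg_left (norm_lowH_le j k B) (h _ _)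

/-- The pairs of indices in the product are sorted by their maximum. -/
lemma sum_range_mul_sum_range (f g : ℕ → ℝ) (n : ℕ) :
    ∑ j ∈ Finset.range n, (f j * g j + (∑ i ∈ Finset.range j, f i) * g j
      + f j * ∑ i ∈ Finset.range j, g i)
      = (∑ j ∈ Finset.range n, f j) * ∑ j ∈ Finset.range n, g j := by
  induction n with
  | zero => simp
  | succ n ih => rw [Finset.sum_range_succ, ih, Finset.sum_range_succ, Finset.sum_range_succ]; ring

lemma trNorm_mul_le (A B : H N M) : trNorm (A * B) ≤ trNorm A * trNorm B := by
  simp only [trNorm_eq_sum]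
  rw [← sum_range_mul_sum_range]
  exact Finset.sum_le_sum fun j _ => degNorm_mul_le j A B

lemma trNorm_nonneg (A : H N M) : 0 ≤ trNorm A := (norm_nonneg _).trans (norm_coe_le_trNorm A)

end

/-! ### Fiber determinants -/

section

open InnerProductSpace

variable {N M : ℕ}

/-- The unital extension `A ↦ s A + (1 - s 1)` of a multiplicative linear map. -/
def unitize {R S : Type*} [Ring R] [Ring S] [Module ℂ R] [Module ℂ S] (s : R →ₗ[ℂ] S)
    (hs : ∀ A B, s (A * B) = s A * s B) : R →* S where
  toFun A := s A + (1 - s 1)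
  map_one' := by abel
  map_mul' A B := by
    have h1 : s A * s 1 = s A := by rw [← hs, mul_one]
    have h2 : s 1 * s B = s B := by rw [← hs, one_mul]
    have h3 : s 1 * s 1 = s 1 := by rw [← hs, one_mul]
    have h4 : (s A + (1 - s 1)) * (s B + (1 - s 1)) = s A * s B + (s A - s A * s 1)
        + (s B - s 1 * s B) + (1 - s 1 - s 1 + s 1 * s 1) := by noncomm_ring
    rw [h4, hs, h1, h2, h3]
    abel

/-- `lowH`, made unital. -/
def psi (j : ℕ) (k : Cube N) : H N M →* (L2 N M →L[ℂ] L2 N M) := unitize (lowH j k) (lowH_mul j k)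

/-- `lowH + fibH`, made unital. -/
def phi (j : ℕ) (k : Cube N) : H N M →* (L2 N M →L[ℂ] L2 N M) :=
  unitize (lowH j k + fibH j k) fun A B => by
    simp only [LinearMap.add_apply, lowH_mul, fibH_mul, add_mul, mul_add]; abel

lemma psi_apply (j : ℕ) (k : Cube N) (A : H N M) :
    psi j k A = lowH j k A + (1 - lowH j k 1) := rfl

lemma phi_sub_psi (j : ℕ) (k : Cube N) (A : H N M) :
    phi j k A - psi j k A = fibH j k A - fibH j k 1 := by
  change (lowH j k A + fibH j k A) + (1 - (lowH j k 1 + fibH j k 1))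
    - (lowH j k A + (1 - lowH j k 1)) = _
  abel

lemma psi_one_add (j : ℕ) (k : Cube N) (C : H N M) : psi j k (1 + C) = 1 + lowH j k C := by
  rw [psi_apply, map_add]; abel

lemma phi_one_add (j : ℕ) (k : Cube N) (C : H N M) :
    phi j k (1 + C) = 1 + (lowH j k C + fibH j k C) := by
  change lowH j k (1 + C) + fibH j k (1 + C) + (1 - (lowH j k 1 + fibH j k 1)) = _
  rw [map_add, map_add]; abel

lemma psi_zero (k : Cube N) (A : H N M) : psi 0 k A = 1 := by
  rw [psi_apply, lowH_zero, lowH_zero]; abel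

lemma psi_succ (j : ℕ) (k : Cube N) (A : H N M) : psi (j + 1) k A = lowH (j + 1) k A := by
  rw [psi_apply, lowH_one (Nat.succ_pos j)]; abel

/-- The fiber determinants of an operator. -/
def fiberDet (j : ℕ) (k : Cube N) (A : H N M) : ℂ := cdet (Ring.inverse (psi j k A) * phi j k A)

lemma cdet_one {E : Type*} [NormedAddCommGroup E] [InnerProductSpace ℂ E] :
    cdet (1 : E →L[ℂ] E) = 1 := by
  have h := fdet_finRank (E := E) (m := 0) Fin.elim0 Fin.elim0
  have h0 : (1 : E →L[ℂ] E) - 1 = finRank (m := 0) Fin.elim0 Fin.elim0 := by simp [finRank]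
  rw [cdet, h0, h]
  exact Matrix.det_isEmpty

lemma IsFinRank.inverse_mul_sub_one {E : Type*} [NormedAddCommGroup E] [InnerProductSpace ℂ E]
    {S T : E →L[ℂ] E} (h : IsFinRank (T - S)) (hS : IsUnit S) :
    IsFinRank (Ring.inverse S * T - 1) := by
  have : Ring.inverse S * T - 1 = Ring.inverse S * (T - S) := by
    rw [mul_sub, Ring.inverse_mul_cancel S hS]
  rw [this]
  exact h.mul_left _

lemma isFinRank_phi_sub_psi (j : ℕ) (k : Cube N) (A : H N M) :
    IsFinRank (phi j k A - psi j k A) := by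
  rw [phi_sub_psi, ← map_sub]
  exact isFinRank_fibH j k _

/-- The inverse is again a finite rank perturbation of the identity, so multiplicativity applies to
`T T⁻¹ = 1`. -/
lemma cdet_ne_zero {E : Type*} [NormedAddCommGroup E] [InnerProductSpace ℂ E]
    {T : E →L[ℂ] E} (h : IsFinRank (T - 1)) (hT : IsUnit T) : cdet T ≠ 0 := by
  obtain ⟨u, rfl⟩ := hT
  have h2 : IsFinRank ((↑u⁻¹ : E →L[ℂ] E) - 1) := by
    have : (↑u⁻¹ : E →L[ℂ] E) - 1 = (-↑u⁻¹ : E →L[ℂ] E) * ((u : E →L[ℂ] E) - 1) := by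
      rw [mul_sub, neg_mul, u.inv_mul]; simp; abel
    rw [this]
    exact h.mul_left _
  intro h0
  have := cdet_mul h h2
  rw [u.mul_inv, cdet_one, h0, zero_mul] at this
  exact one_ne_zero this

lemma fiberDet_ne_zero {j : ℕ} {k : Cube N} {A : H N M} (h1 : IsUnit (psi j k A))
    (h2 : IsUnit (phi j k A)) : fiberDet j k A ≠ 0 :=
  cdet_ne_zero ((isFinRank_phi_sub_psi j k A).inverse_mul_sub_one h1)
    (h1.ringInverse.mul h2)

lemma fiberDet_one (j : ℕ) (k : Cube N) : fiberDet j k (1 : H N M) = 1 := by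
  rw [fiberDet, map_one, map_one, Ring.inverse_one, one_mul, cdet_one]

/-- With `u = psi A`, `v = psi B`, `F = phi A`, `G = phi B` one has `(uv)⁻¹ FG = (v⁻¹ (u⁻¹F)
v)(v⁻¹G)`, and the determinant is invariant under conjugation. -/
lemma fiberDet_mul {j : ℕ} {k : Cube N} {A B : H N M} (hA : IsUnit (psi j k A))
    (hB : IsUnit (psi j k B)) : fiberDet j k (A * B) = fiberDet j k A * fiberDet j k B := by
  have h1 := (isFinRank_phi_sub_psi j k A).inverse_mul_sub_one hA
  have h2 := (isFinRank_phi_sub_psi j k B).inverse_mul_sub_one hB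
  unfold fiberDet
  rw [map_mul, map_mul]
  obtain ⟨u, hu⟩ := hA
  obtain ⟨v, hv⟩ := hB
  rw [← hu, Ring.inverse_unit] at h1 ⊢
  rw [← hv, Ring.inverse_unit] at h2 ⊢
  rw [← Units.val_mul, Ring.inverse_unit, _root_.mul_inv_rev, Units.val_mul]
  set F := phi j k A
  set G := phi j k B
  have h3 : (↑v⁻¹ * ↑u⁻¹ : L2 N M →L[ℂ] L2 N M) * (F * G)
      = (↑v⁻¹ * (↑u⁻¹ * F) * ↑v) * (↑v⁻¹ * G) := by
    simp only [mul_assoc, Units.mul_inv_cancel_left]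
  have h4 : (↑v⁻¹ * (↑u⁻¹ * F) * ↑v : L2 N M →L[ℂ] L2 N M) - 1 = ↑v⁻¹ * (↑u⁻¹ * F - 1) * ↑v := by
    rw [mul_sub, sub_mul, mul_one, Units.inv_mul]
  rw [h3, cdet_mul (by rw [h4]; exact (h1.mul_left _).mul_right _) h2]
  congr 1
  rw [cdet, h4, fdet_conj h1 v.mul_inv, cdet]

/-- All fiber operators are invertible. -/
def Regular (A : H N M) : Prop := ∀ j k, IsUnit (psi j k A) ∧ IsUnit (phi j k A)

lemma regular_of_isUnit {A : H N M} (h : IsUnit A) : Regular A :=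
  fun j k => ⟨h.map (psi j k), h.map (phi j k)⟩

lemma isUnit_one_add_of_norm_lt {R : Type*} [NormedRing R] [CompleteSpace R] {x : R}
    (h : ‖x‖ < 1) : IsUnit (1 + x) := by
  rw [← sub_neg_eq_add]
  exact isUnit_one_sub_of_norm_lt_one (by rwa [norm_neg])

lemma sum_degNorm_le (j : ℕ) (C : H N M) : ∑ i ∈ Finset.range j, degNorm i C ≤ trNorm C := by
  rw [trNorm_eq_sum]
  rcases le_total j (N + 1) with h | h
  · exact Finset.sum_le_sum_of_subset_of_nonneg (Finset.range_mono h) fun i _ _ =>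
      degNorm_nonneg i C
  · refine (Finset.sum_subset (Finset.range_mono h) fun i _ hi => ?_).ge
    refine le_antisymm (degNorm_le le_rfl fun k => ?_) (degNorm_nonneg _ _)
    rw [fibH_eq_zero_of_lt (by simpa using hi)]
    exact NucLe.zero

lemma norm_lowH_le_trNorm (j : ℕ) (k : Cube N) (C : H N M) : ‖lowH j k C‖ ≤ trNorm C :=
  (norm_lowH_le j k C).trans (sum_degNorm_le j C)

lemma norm_lowH_add_fibH_le_trNorm (j : ℕ) (k : Cube N) (C : H N M) :
    ‖lowH j k C + fibH j k C‖ ≤ trNorm C := by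
  refine le_trans ?_ (sum_degNorm_le (j + 1) C)
  rw [Finset.sum_range_succ]
  exact (norm_add_le _ _).trans (add_le_add (norm_lowH_le j k C) (norm_fibH_le j k C))

/-- A Neumann series in the complete algebra of bounded operators on `L²`, fiber by fiber. -/
lemma regular_one_add {C : H N M} (h : trNorm C < 1) : Regular (1 + C) := fun j k =>
  ⟨by
    rw [psi_one_add]
    exact isUnit_one_add_of_norm_lt ((norm_lowH_le_trNorm j k C).trans_lt h), by
    rw [phi_one_add]
    exact isUnit_one_add_of_norm_lt ((norm_lowH_add_fibH_le_trNorm j k C).trans_lt h)⟩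

/-! ### Fiberwise linear algebra with continuous coefficients -/

/-- The action on continuous functions of the part of degree less than `j`. -/
def lowAct (j : ℕ) : Formal N M →ₗ[ℂ] (V N M →ₗ[ℂ] V N M) :=
  Finsupp.linearCombination ℂ fun p => if p.1.1 < j then act p.1 p.2.1 p.2.2 else 0

@[simp] lemma lowAct_single (j : ℕ) (n : Fin (N + 1)) (α β : V N M) (c : ℂ) :
    lowAct j (Finsupp.single (n, α, β) c) = if n.1 < j then c • act n α β else 0 := by
  simp [lowAct]

lemma low_J_frz (j : ℕ) (k : Cube N) (x : Formal N M) (f : V N M) :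
    low j k x (J (frz j k f)) = J (frz j k (lowAct j x f)) := by
  induction x using Finsupp.induction_linear with
  | zero => simp
  | add x y hx hy => simp [hx, hy]
  | single p c =>
    obtain ⟨n, α, β⟩ := p
    simp only [low_single, lowAct_single]
    split_ifs with h
    · simp [theta_J, frz_act_of_le h.le]
    · simp

lemma lowAct_succ (j : ℕ) (x : Formal N M) : lowAct (j + 1) x = lowAct j x + actPart j x := by
  induction x using Finsupp.induction_linear with
  | zero => simp
  | add x y hx hy => rw [map_add, map_add, map_add, hx, hy]; abel
  | single p c =>
    obtain ⟨n, α, β⟩ := p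
    simp only [lowAct_single, actPart_single]
    rcases lt_trichotomy n.1 j with h | h | h
    · rw [if_pos (by omega), if_pos h, if_neg (by omega), add_zero]
    · rw [if_pos (by omega), if_neg (by omega), if_pos h, zero_add]
    · rw [if_neg (by omega), if_neg (by omega), if_neg (by omega), zero_add]

/-- A function of the coordinates from the `j`-th on. -/
def TailInv (j : ℕ) (h : C(Cube N, ℂ)) : Prop := ∀ s k, h (mix j s k) = h k

lemma TailInv.mix_of_le {i j : ℕ} (hij : i ≤ j) {h : C(Cube N, ℂ)} (hh : TailInv j h)
    (s k : Cube N) : h (mix i s k) = h k := by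
  rw [← hh k (mix i s k), mix_mix_of_ge hij, hh]

lemma avg_ip_smul {i j : ℕ} (hij : i ≤ j) {h : C(Cube N, ℂ)} (hh : TailInv j h) (β f : V N M)
    (k : Cube N) : avg i (ip β (h • f)) k = h k * avg i (ip β f) k := by
  rw [ip_smul_right]
  simp only [avg, ContinuousMap.coe_mul, Pi.mul_apply, hh.mix_of_le hij]
  exact integral_const_mul _ _

lemma avg_ip_sum {ι : Type*} (s : Finset ι) (i : ℕ) (β : V N M) (f : ι → V N M) (k : Cube N) :
    avg i (ip β (∑ c ∈ s, f c)) k = ∑ c ∈ s, avg i (ip β (f c)) k := by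
  simp only [← inner_J_frz, map_sum, inner_sum]

lemma avg_ip_sub (i : ℕ) (β f g : V N M) (k : Cube N) :
    avg i (ip β (f - g)) k = avg i (ip β f) k - avg i (ip β g) k := by
  simp only [← inner_J_frz, map_sub, inner_sub_right]

/-- Degrees below `j` integrate only over variables on which `h` does not depend. -/
lemma lowAct_smul {j : ℕ} {h : C(Cube N, ℂ)} (hh : TailInv j h) (x : Formal N M) (f : V N M) :
    lowAct j x (h • f) = h • lowAct j x f := by
  induction x using Finsupp.induction_linear with
  | zero => simp
  | add x y hx hy =>
    rw [map_add, LinearMap.add_apply, LinearMap.add_apply, hx, hy]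
    ext1 k
    exact (smul_add (h k) _ _).symm
  | single p c =>
    obtain ⟨n, α, β⟩ := p
    simp only [lowAct_single]
    split_ifs with hn
    · ext1 k
      simp [act_apply, avg_ip_smul hn.le hh, smul_smul, mul_left_comm]
    · simp

lemma lowAct_one_toFormal (a : OpForm N M) (f : V N M) (k : Cube N) :
    (lowAct 1 a.toFormal f k).ofLp = a.A0 k *ᵥ (f k).ofLp := by
  have h : lowAct 1 a.toFormal = ∑ c, act 0 (colV a.A0 c) (basisV c) := by
    rw [OpForm.toFormal, map_add, map_sum]
    have : ∀ j : Fin N, lowAct 1 (matF j.succ (a.A j) (a.B j)) = 0 := fun j => by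
      simp [matF]
    simp only [this, Finset.sum_const_zero, add_zero, mulF, map_sum, lowAct_single, one_smul]
    simp
  rw [h]
  funext i
  simp [LinearMap.sum_apply, act_zero_basisV, colV, Matrix.mulVec, dotProduct, mul_comm]

lemma actPart_toFormal (a : OpForm N M) (j : Fin N) (f : V N M) :
    actPart (j.1 + 1) a.toFormal f
      = ∑ c, avgC (j.1 + 1) (ip (rowV (a.B j) c) f) • colV (a.A j) c := by
  have h : actPart (j.1 + 1) a.toFormal
      = ∑ c, act (j.1 + 1) (colV (a.A j) c) (rowV (a.B j) c) := by
    rw [OpForm.toFormal, map_add, map_sum, Finset.sum_eq_single j]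
    · simp [matF, mulF]
    · intro i _ hi
      have : ¬ i.1 = j.1 := by simpa [Fin.ext_iff] using hi
      simp [matF, this]
    · simp
  rw [h, LinearMap.sum_apply]
  rfl

/-- The matrix of averages of inner products of two families of functions. -/
def pairing {p q : ℕ} (n : ℕ) (β : Fin p → V N M) (α : Fin q → V N M) (k : Cube N) :
    Matrix (Fin p) (Fin q) ℂ :=
  Matrix.of fun c d => avg n (ip (β c) (α d)) k

lemma continuous_pairing {p q : ℕ} (n : ℕ) (β : Fin p → V N M) (α : Fin q → V N M) :
    Continuous (pairing n β α) :=
  continuous_matrix fun c d => continuous_avg n (ip (β c) (α d)).continuous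

lemma pairing_mix {p q : ℕ} (n : ℕ) (β : Fin p → V N M) (α : Fin q → V N M) (s k : Cube N) :
    pairing n β α (mix n s k) = pairing n β α k := by
  ext c d; exact avg_mix le_rfl _ s k

lemma avgMat_mul_tail {p q n : ℕ} (hn : n ≤ N) (B : C(Cube N, Matrix (Fin p) (Fin M) ℂ))
    (X : C(Cube N, Matrix (Fin M) (Fin q) ℂ)) (k : Cube N) :
    avgMat n (fun k' => B k' * X k') (tail n k) = pairing n (rowV B) (colV X) k := by
  ext c d
  rw [avgMat_tail hn (B.continuous.matrix_mul X.continuous)]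
  congr 1
  funext s
  simp [ip, rowV, colV, Matrix.mul_apply, PiLp.inner_apply, mul_comm]

/-- An entry of a continuous matrix-valued function. -/
def entry {p q : ℕ} (G : C(Cube N, Matrix (Fin p) (Fin q) ℂ)) (c : Fin p) (d : Fin q) :
    C(Cube N, ℂ) := ⟨fun k => G k c d, G.continuous.matrix_elem c d⟩

/-- The pointwise product of continuous matrix-valued functions. -/
def mulC {l p q : ℕ} (F : C(Cube N, Matrix (Fin l) (Fin p) ℂ))
    (G : C(Cube N, Matrix (Fin p) (Fin q) ℂ)) : C(Cube N, Matrix (Fin l) (Fin q) ℂ) :=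
  ⟨fun k => F k * G k, F.continuous.matrix_mul G.continuous⟩

lemma colV_mulC {p q : ℕ} (X : C(Cube N, Matrix (Fin M) (Fin p) ℂ))
    (G : C(Cube N, Matrix (Fin p) (Fin q) ℂ)) (c : Fin q) :
    colV (mulC X G) c = ∑ d, entry G d c • colV X d := by
  ext k i
  simp [colV, mulC, entry, Matrix.mul_apply, mul_comm]

lemma colV_sub {q : ℕ} (X Y : C(Cube N, Matrix (Fin M) (Fin q) ℂ)) (c : Fin q) :
    colV (X - Y) c = colV X c - colV Y c := rfl

lemma continuous_matrix_inv {q : ℕ} {G : Cube N → Matrix (Fin q) (Fin q) ℂ} (hG : Continuous G)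
    (h : ∀ k, (G k).det ≠ 0) : Continuous fun k => (G k)⁻¹ := by
  simp only [Matrix.inv_def, Ring.inverse_eq_inv']
  exact (hG.matrix_det.inv₀ h).smul hG.matrix_adjugate

lemma pairing_sub {p q : ℕ} (n : ℕ) (β : Fin p → V N M)
    (X Y : C(Cube N, Matrix (Fin M) (Fin q) ℂ)) (k : Cube N) :
    pairing n β (colV (X - Y)) k = pairing n β (colV X) k - pairing n β (colV Y) k := by
  ext c d
  simp only [pairing, Matrix.of_apply, colV_sub, avg_ip_sub, Matrix.sub_apply]

lemma pairing_mulC {p q r : ℕ} {n : ℕ} (β : Fin p → V N M)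
    (X : C(Cube N, Matrix (Fin M) (Fin q) ℂ)) {G : C(Cube N, Matrix (Fin q) (Fin r) ℂ)}
    (hG : ∀ s k, G (mix n s k) = G k) (k : Cube N) :
    pairing n β (colV (mulC X G)) k = pairing n β (colV X) k * G k := by
  ext c d
  have hT : ∀ e, TailInv n (entry G e d) := fun e s k => by simp [entry, hG]
  simp only [pairing, Matrix.of_apply, colV_mulC, avg_ip_sum, Matrix.mul_apply,
    avg_ip_smul le_rfl (hT _)]
  exact Finset.sum_congr rfl fun e _ => mul_comm _ _

end

/-! ### Elimination -/

section

open InnerProductSpace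

variable {N M : ℕ}

namespace OpForm.Represents

variable {a : OpForm N M} {A : H N M}

/-- In degree 0 `psi` is trivial, and `phi A - 1` is the matrix `A_0(k) - 1` acting on constant
functions. -/
lemma fiberDet_zero (h : a.Represents A.1) (k : Cube N) : fiberDet 0 k A = (a.A0 k).det := by
  rw [fiberDet, psi_zero, Ring.inverse_one, one_mul, cdet, ← psi_zero k A, phi_sub_psi,
    h.fibH_zero, fibH_zero_one]
  have h1 : finRank (fun c => J (frz 0 k (colV a.A0 c))) (fun c => J (basisV c))
      - finRank (fun c => J (basisV c)) (fun c => J (basisV c))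
      = finRank (fun c => J (frz 0 k (colV a.A0 c - basisV c))) fun c => J (basisV c) := by
    ext1 u
    simp only [_root_.sub_apply, finRank_apply, map_sub, smul_sub, Finset.sum_sub_distrib,
      frz_basisV]
  rw [h1, fdet_finRank]
  congr 1
  ext c d
  have h2 : inner ℂ (J (basisV c)) (J (frz 0 k (colV a.A0 d - basisV d)))
      = avg 0 (ip (basisV c) (colV a.A0 d - basisV d)) k := by
    rw [← inner_J_frz, frz_basisV]
  rw [Matrix.add_apply, Matrix.of_apply, h2, avg_zero]
  change _ + inner ℂ (basisV c k) _ = _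
  rw [ip_basisV]
  simp [basisV, colV, Matrix.one_apply]

lemma low_eq_psi (h : a.Represents A.1) (j : ℕ) (k : Cube N) :
    low (j + 1) k a.toFormal = psi (j + 1) k A := by
  rw [psi_succ, lowH_eq h.op_toFormal]

/-- If `R` solves the linear system with the lower part on continuous functions, then `psi⁻¹` maps
the frozen columns of `A_j` to those of `R`. Hence `psi⁻¹ phi - 1` is an explicit finite rank
operator. -/
lemma fiberDet_succ (h : a.Represents A.1) {j : Fin N} {k : Cube N}
    (hu : IsUnit (psi (j.1 + 1) k A)) {R : C(Cube N, Matrix (Fin M) (Fin (a.m j)) ℂ)}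
    (hR : ∀ c, lowAct (j.1 + 1) a.toFormal (colV R c) = colV (a.A j) c) :
    fiberDet (j.1 + 1) k A = (1 + pairing (j.1 + 1) (rowV (a.B j)) (colV R) k).det := by
  have h1 : Ring.inverse (psi (j.1 + 1) k A) * phi (j.1 + 1) k A - 1
      = finRank (fun c => J (frz (j.1 + 1) k (colV R c)))
        (fun c => J (frz (j.1 + 1) k (rowV (a.B j) c))) := by
    have h2 : Ring.inverse (psi (j.1 + 1) k A) * phi (j.1 + 1) k A - 1
        = Ring.inverse (psi (j.1 + 1) k A) * fibH (j.1 + 1) k A := by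
      have := phi_sub_psi (j.1 + 1) k A
      rw [fibH_one (Nat.succ_pos _), sub_zero] at this
      rw [← this, mul_sub, Ring.inverse_mul_cancel _ hu]
    rw [h2, h.fibH_succ, mul_finRank]
    congr 1
    funext c
    rw [← hR, ← low_J_frz, h.low_eq_psi, ← mul_apply_eq_comp, Ring.inverse_mul_cancel _ hu]
    rfl
  rw [fiberDet, cdet, h1, fdet_finRank]
  congr 2
  ext c d
  exact inner_J_frz _ _ _ _

lemma exists_red_zero (h : a.Represents A.1) (hA : Regular A) (j : Fin N) :
    ∃ R : C(Cube N, Matrix (Fin M) (Fin (a.m j)) ℂ), (∀ k, R k = a.red 0 j k) ∧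
      ∀ c, lowAct 1 a.toFormal (colV R c) = colV (a.A j) c := by
  have hdet : ∀ k, (a.A0 k).det ≠ 0 := fun k => by
    rw [← h.fiberDet_zero]; exact fiberDet_ne_zero (hA 0 k).1 (hA 0 k).2
  refine ⟨⟨fun k => (a.A0 k)⁻¹ * a.A j k,
    (continuous_matrix_inv a.A0.continuous hdet).matrix_mul (a.A j).continuous⟩,
    fun k => rfl, fun c => ?_⟩
  ext1 k
  refine WithLp.ofLp_injective 2 ?_
  rw [lowAct_one_toFormal]
  funext i
  have h1 : a.A0 k * ((a.A0 k)⁻¹ * a.A j k) = a.A j k := by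
    rw [← Matrix.mul_assoc, Matrix.mul_nonsing_inv _ (isUnit_iff_ne_zero.2 (hdet k)), Matrix.one_mul]
  exact congrFun (congrFun h1 i) c

/-- Write `T_r` for the part of degree at most `r`, that is `lowAct (r + 1)`. The invariant is that
`A_{j,r}` is continuous and solves `T_r A_{j,r} = A_j`. For the induction put `X = A_{j,r}`, `Y =
A_{r+1,r}`, `P = ⟨B_{r+1} Y⟩` and `G = (1 + P)⁻¹⟨B_{r+1} X⟩`. Then `⟨B_{r+1}(X - YG)⟩ = G`, so the
term of degree `r + 1` restores what `T_r` takes away. Invertibility of `1 + P` is the nonvanishing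
of the fiber determinant of degree `r + 1`. -/
lemma exists_red (h : a.Represents A.1) (hA : Regular A) (r : ℕ) (j : Fin N) (hj : r ≤ j.1) :
    ∃ R : C(Cube N, Matrix (Fin M) (Fin (a.m j)) ℂ), (∀ k, R k = a.red r j k) ∧
      ∀ c, lowAct (r + 1) a.toFormal (colV R c) = colV (a.A j) c := by
  induction r generalizing j with
  | zero => exact h.exists_red_zero hA j
  | succ r ih =>
    have hr : r < N := by omega
    obtain ⟨X, hX, hX'⟩ := ih j (by omega)
    obtain ⟨Y, hY, hY'⟩ := ih ⟨r, hr⟩ le_rfl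
    set P : Cube N → Matrix (Fin (a.m ⟨r, hr⟩)) (Fin (a.m ⟨r, hr⟩)) ℂ :=
      pairing (r + 1) (rowV (a.B ⟨r, hr⟩)) (colV Y) with hP
    have hPc : Continuous fun k => 1 + P k :=
      continuous_const.add (continuous_pairing (r + 1) (rowV (a.B ⟨r, hr⟩)) (colV Y))
    have hdet : ∀ k, (1 + P k).det ≠ 0 := fun k => by
      rw [hP, ← h.fiberDet_succ (j := ⟨r, hr⟩) (hA (r + 1) k).1 hY']
      exact fiberDet_ne_zero (hA (r + 1) k).1 (hA (r + 1) k).2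
    let G : C(Cube N, Matrix (Fin (a.m ⟨r, hr⟩)) (Fin (a.m j)) ℂ) :=
      ⟨fun k => (1 + P k)⁻¹ * pairing (r + 1) (rowV (a.B ⟨r, hr⟩)) (colV X) k,
        (continuous_matrix_inv hPc hdet).matrix_mul (continuous_pairing _ _ _)⟩
    -- `G` depends only on the remaining variables; therefore it passes through the averages over
    -- the first `r + 1` of them.
    have hG : ∀ s k, G (mix (r + 1) s k) = G k := fun s k => by
      simp only [G, hP, ContinuousMap.coe_mk, pairing_mix]
    have hGT : ∀ c d, TailInv (r + 1) (entry G c d) := fun c d s k => by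
      simp only [entry, ContinuousMap.coe_mk, hG]
    have hpair : ∀ k, pairing (r + 1) (rowV (a.B ⟨r, hr⟩)) (colV (X - mulC Y G)) k = G k := by
      intro k
      rw [pairing_sub, pairing_mulC _ _ hG]
      have h1 : (1 + P k) * G k = pairing (r + 1) (rowV (a.B ⟨r, hr⟩)) (colV X) k := by
        rw [show G k = (1 + P k)⁻¹ * pairing (r + 1) (rowV (a.B ⟨r, hr⟩)) (colV X) k from rfl,
          ← Matrix.mul_assoc, Matrix.mul_nonsing_inv _ (isUnit_iff_ne_zero.2 (hdet k)),
          Matrix.one_mul]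
      rw [← h1, Matrix.add_mul, Matrix.one_mul]
      exact add_sub_cancel_right _ _
    refine ⟨X - mulC Y G, fun k => ?_, fun c => ?_⟩
    · have e1 : (fun k' => a.B ⟨r, hr⟩ k' * a.red r ⟨r, hr⟩ k')
          = fun k' => a.B ⟨r, hr⟩ k' * Y k' := funext fun k' => by rw [hY]
      have e2 : (fun k' => a.B ⟨r, hr⟩ k' * a.red r j k')
          = fun k' => a.B ⟨r, hr⟩ k' * X k' := funext fun k' => by rw [hX]
      simp only [OpForm.red, dif_pos hr]
      rw [e1, e2, avgMat_mul_tail hr, avgMat_mul_tail hr, ← hX, ← hY, Matrix.mul_assoc]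
      rfl
    · rw [lowAct_succ, LinearMap.add_apply, actPart_toFormal a ⟨r, hr⟩]
      have h1 : lowAct (r + 1) a.toFormal (colV (X - mulC Y G) c)
          = colV (a.A j) c - ∑ d, entry G d c • colV (a.A ⟨r, hr⟩) d := by
        rw [colV_sub, colV_mulC, map_sub, map_sum, hX']
        congr 1
        exact Finset.sum_congr rfl fun d _ => by rw [lowAct_smul (hGT d c), hY']
      rw [h1]
      have h2 : ∀ d, avgC (r + 1) (ip (rowV (a.B ⟨r, hr⟩) d) (colV (X - mulC Y G) c))
          = entry G d c := fun d => by
        ext1 k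
        exact congrFun (congrFun (hpair k) d) c
      simp only [h2]
      exact sub_add_cancel _ _

lemma det_tail (h : a.Represents A.1) (hA : Regular A) (j : Fin (N + 1)) (k : Cube N) :
    a.det j (tail j.1 k) = fiberDet j.1 k A := by
  refine Fin.cases ?_ (fun j => ?_) j
  · change (a.A0 (full (tail 0 k))).det = fiberDet 0 k A
    rw [h.fiberDet_zero, show full (tail 0 k) = k from full_tail k]
  · change (a.E j (tail (j.1 + 1) k)).det = fiberDet (j.1 + 1) k A
    obtain ⟨R, hR, hR'⟩ := h.exists_red hA j.1 j le_rfl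
    rw [h.fiberDet_succ (hA _ k).1 hR', OpForm.E]
    have e : (fun k' => a.B j k' * a.red j.1 j k') = fun k' => a.B j k' * R k' :=
      funext fun k' => by rw [hR]
    rw [e, avgMat_mul_tail j.2]

lemma continuous_fiberDet (h : a.Represents A.1) (hA : Regular A) (j : Fin (N + 1)) :
    Continuous fun k => fiberDet j.1 k A := by
  refine Fin.cases ?_ (fun j => ?_) j
  · change Continuous fun k => fiberDet 0 k A
    simp only [h.fiberDet_zero]
    exact a.A0.continuous.matrix_det
  · change Continuous fun k => fiberDet (j.1 + 1) k A
    obtain ⟨R, hR, hR'⟩ := h.exists_red hA j.1 j le_rfl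
    have : (fun k => fiberDet (j.1 + 1) k A)
        = fun k => (1 + pairing (j.1 + 1) (rowV (a.B j)) (colV R) k).det :=
      funext fun k => h.fiberDet_succ (hA _ k).1 hR'
    rw [this]
    exact (continuous_const.add (continuous_pairing _ _ _)).matrix_det

end OpForm.Represents

/-! ### Invertibility in `H` from invertibility in the fibers -/

lemma theta_sum_left {ι : Type*} (s : Finset ι) (n : ℕ) (α : ι → V N M) (β : V N M) :
    theta n (∑ c ∈ s, α c) β = ∑ c ∈ s, theta n (α c) β := by
  refine ext_J fun f => ?_
  rw [theta_J, _root_.sum_apply]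
  simp only [theta_J]
  rw [← map_sum]
  congr 1
  ext1 k
  simp [act_apply, Finset.smul_sum]

lemma theta_sub_left (n : ℕ) (α α' β : V N M) :
    theta n (α - α') β = theta n α β - theta n α' β := by
  refine ext_J fun f => ?_
  rw [theta_J, _root_.sub_apply]
  simp only [theta_J]
  rw [← map_sub]
  congr 1
  ext1 k
  simp [act_apply, smul_sub]

lemma theta_add_left (n : ℕ) (α α' β : V N M) :
    theta n (α + α') β = theta n α β + theta n α' β := by
  rw [← sub_eq_iff_eq_add, ← theta_sub_left, add_sub_cancel_right]

lemma part_mul_theta {i n : ℕ} (hn : i ≤ n) (x : Formal N M) (α β : V N M) :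
    part i x * theta n α β = theta n (actPart i x α) β := by
  induction x using Finsupp.induction_linear with
  | zero => simp [theta_zero_left]
  | add x y hx hy =>
    rw [map_add, add_mul, hx, hy, map_add, LinearMap.add_apply, theta_add_left]
  | single p c =>
    obtain ⟨m, α', β'⟩ := p
    simp only [part_single, actPart_single]
    split_ifs with h
    · rw [smul_mul_assoc, theta_mul_of_le (h.trans_le hn), LinearMap.smul_apply, theta_smul_left]
    · simp [theta_zero_left]

lemma lowAct_eq_sum (j : ℕ) (x : Formal N M) : lowAct j x = ∑ i ∈ Finset.range j, actPart i x := by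
  induction j with
  | zero =>
    simp [lowAct, Finsupp.linearCombination_apply]
  | succ j ih => rw [lowAct_succ, ih, Finset.sum_range_succ]

lemma sum_part_mul_theta {r n : ℕ} (hn : r ≤ n + 1) (x : Formal N M) (α β : V N M) :
    (∑ i ∈ Finset.range r, part i x) * theta n α β = theta n (lowAct r x α) β := by
  rw [Finset.sum_mul, lowAct_eq_sum, LinearMap.sum_apply, theta_sum_left]
  exact Finset.sum_congr rfl fun i hi =>
    part_mul_theta (by have := Finset.mem_range.1 hi; omega) x α β

/-- The operator with coefficients `R`, `B` in degree `n`. -/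
def matOp {q : ℕ} (n : Fin (N + 1)) (R : C(Cube N, Matrix (Fin M) (Fin q) ℂ))
    (β : Fin q → V N M) : L2 N M →L[ℂ] L2 N M := ∑ c, theta n (colV R c) (β c)

lemma matOp_mul {q : ℕ} (n : Fin (N + 1)) (R Z : C(Cube N, Matrix (Fin M) (Fin q) ℂ))
    (β : Fin q → V N M) {G : C(Cube N, Matrix (Fin q) (Fin q) ℂ)}
    (hG : ∀ k, pairing n.1 β (colV Z) k = G k) :
    matOp n R β * matOp n Z β = matOp n (mulC R G) β := by
  rw [matOp, matOp, matOp, Finset.mul_sum]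
  refine Finset.sum_congr rfl fun d _ => ?_
  rw [Finset.sum_mul, colV_mulC, theta_sum_left]
  refine Finset.sum_congr rfl fun c _ => ?_
  rw [theta_mul_of_le le_rfl]
  congr 1
  ext1 k
  rw [act_apply]
  exact congrArg (· • colV R c k) (congrFun (congrFun (hG k) c) d)

lemma matOp_sub {q : ℕ} (n : Fin (N + 1)) (R Z : C(Cube N, Matrix (Fin M) (Fin q) ℂ))
    (β : Fin q → V N M) : matOp n (R - Z) β = matOp n R β - matOp n Z β := by
  simp only [matOp, colV_sub, theta_sub_left, Finset.sum_sub_distrib]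

lemma matOp_mem_H (hM : 0 < M) {q : ℕ} (n : Fin (N + 1))
    (R : C(Cube N, Matrix (Fin M) (Fin q) ℂ)) (β : Fin q → V N M) : matOp n R β ∈ H N M :=
  sum_mem fun _ _ => theta_mem_H hM _ _ _

/-- The inverse of `1 + R⟨B·⟩` is `1 - R W⟨B·⟩` with `W = (1 + ⟨B R⟩)⁻¹`, as in the Woodbury
identity. It has the same form and so stays in `H`. -/
lemma isUnit_one_add_matOp (hM : 0 < M) {q : ℕ} (n : Fin (N + 1))
    (R : C(Cube N, Matrix (Fin M) (Fin q) ℂ)) (β : Fin q → V N M)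
    (hdet : ∀ k, (1 + pairing n.1 β (colV R) k).det ≠ 0) :
    IsUnit (1 + ⟨matOp n R β, matOp_mem_H hM n R β⟩ : H N M) := by
  set P : C(Cube N, Matrix (Fin q) (Fin q) ℂ) := ⟨pairing n.1 β (colV R), continuous_pairing _ _ _⟩
  have hP : ∀ k, pairing n.1 β (colV R) k = P k := fun k => rfl
  let W : C(Cube N, Matrix (Fin q) (Fin q) ℂ) :=
    ⟨fun k => (1 + P k)⁻¹, continuous_matrix_inv (continuous_const.add P.continuous) hdet⟩
  have hW : ∀ s k, W (mix n.1 s k) = W k := fun s k => by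
    simp only [W, ContinuousMap.coe_mk, ← hP, pairing_mix]
  have hPW : ∀ k, P k * W k = 1 - W k := fun k => by
    have := Matrix.mul_nonsing_inv _ (isUnit_iff_ne_zero.2 (hdet k))
    rw [hP, Matrix.add_mul, Matrix.one_mul] at this
    exact eq_sub_of_add_eq' this
  have hWP : ∀ k, W k * P k = 1 - W k := fun k => by
    have := Matrix.nonsing_inv_mul _ (isUnit_iff_ne_zero.2 (hdet k))
    rw [hP, Matrix.mul_add, Matrix.mul_one] at this
    exact eq_sub_of_add_eq' this
  have h1 : matOp n R β * matOp n (mulC R W) β = matOp n R β - matOp n (mulC R W) β := by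
    rw [matOp_mul n R (mulC R W) β (G := mulC P W) fun k => by rw [pairing_mulC _ _ hW]; rfl,
      ← matOp_sub]
    congr 1
    ext1 k
    change R k * (P k * W k) = R k - R k * W k
    rw [hPW, Matrix.mul_sub, Matrix.mul_one]
  have h2 : matOp n (mulC R W) β * matOp n R β = matOp n R β - matOp n (mulC R W) β := by
    rw [matOp_mul n (mulC R W) R β hP, ← matOp_sub]
    congr 1
    ext1 k
    change R k * W k * P k = R k - R k * W k
    rw [Matrix.mul_assoc, hWP, Matrix.mul_sub, Matrix.mul_one]
  refine ⟨⟨_, 1 - ⟨matOp n (mulC R W) β, matOp_mem_H hM n _ β⟩, ?_, ?_⟩, rfl⟩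
  · refine Subtype.ext ?_
    change (1 + matOp n R β) * (1 - matOp n (mulC R W) β) = 1
    rw [add_mul, mul_sub, mul_sub, h1]
    simp
  · refine Subtype.ext ?_
    change (1 - matOp n (mulC R W) β) * (1 + matOp n R β) = 1
    rw [sub_mul, mul_add, mul_add, h2]
    simp

lemma mulF_mem_H (A : C(Cube N, Matrix (Fin M) (Fin M) ℂ)) : op (mulF A) ∈ H N M :=
  Algebra.subset_adjoin (Or.inl ⟨A, (isMul_iff A _).2 rfl⟩)

lemma op_mulF_mul (A B : C(Cube N, Matrix (Fin M) (Fin M) ℂ)) :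
    op (mulF A) * op (mulF B) = op (mulF (A * B)) := by
  rw [← isMul_iff]
  intro u
  filter_upwards [(isMul_iff A _).2 rfl (op (mulF B) u), (isMul_iff B _).2 rfl u] with k h1 h2
  rw [mul_apply_eq_comp, h1, h2, Matrix.mulVec_mulVec]
  rfl

lemma isUnit_mulF {A : C(Cube N, Matrix (Fin M) (Fin M) ℂ)} (h : ∀ k, (A k).det ≠ 0) :
    IsUnit (⟨op (mulF A), mulF_mem_H A⟩ : H N M) := by
  let B : C(Cube N, Matrix (Fin M) (Fin M) ℂ) :=
    ⟨fun k => (A k)⁻¹, continuous_matrix_inv A.continuous h⟩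
  have h1 : A * B = 1 := by
    ext1 k; exact Matrix.mul_nonsing_inv _ (isUnit_iff_ne_zero.2 (h k))
  have h2 : B * A = 1 := by
    ext1 k; exact Matrix.nonsing_inv_mul _ (isUnit_iff_ne_zero.2 (h k))
  refine ⟨⟨_, ⟨op (mulF B), mulF_mem_H B⟩, Subtype.ext ?_, Subtype.ext ?_⟩, rfl⟩
  · exact (op_mulF_mul A B).trans (by rw [h1, op_mulF_one]; rfl)
  · exact (op_mulF_mul B A).trans (by rw [h2, op_mulF_one]; rfl)

lemma part_zero_toFormal (a : OpForm N M) : part 0 a.toFormal = op (mulF a.A0) := by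
  rw [OpForm.toFormal, map_add, map_sum]
  have : ∀ j : Fin N, part 0 (matF j.succ (a.A j) (a.B j)) = 0 := fun j => by simp [matF]
  simp [this, mulF]

lemma part_succ_toFormal (a : OpForm N M) (j : Fin N) :
    part (j.1 + 1) a.toFormal = matOp j.succ (a.A j) (rowV (a.B j)) := by
  rw [OpForm.toFormal, map_add, map_sum, Finset.sum_eq_single j]
  · simp [matF, mulF, matOp]
  · intro i _ hi
    have : ¬ i.1 = j.1 := by simpa [Fin.ext_iff] using hi
    simp [matF, this]
  · simp

/-- If `T` is the part of degree at most `r` and `T R = A_{r+1}`, then adding the next degree gives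
`T (1 + R⟨B_{r+1}·⟩)`, a product of invertible factors. -/
lemma OpForm.Represents.exists_unit_partial (hM : 0 < M) {a : OpForm N M} {A : H N M}
    (h : a.Represents A.1) (hA : Regular A) (r : ℕ) (hr : r ≤ N) :
    ∃ T : (H N M)ˣ, T.1.1 = ∑ i ∈ Finset.range (r + 1), part i a.toFormal := by
  induction r with
  | zero =>
    obtain ⟨T, hT⟩ := isUnit_mulF (A := a.A0) fun k => by
      rw [← h.fiberDet_zero]; exact fiberDet_ne_zero (hA 0 k).1 (hA 0 k).2
    exact ⟨T, by rw [hT, Finset.sum_range_one, part_zero_toFormal]⟩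
  | succ r ih =>
    obtain ⟨T, hT⟩ := ih (by omega)
    obtain ⟨R, -, hR⟩ := h.exists_red hA r ⟨r, hr⟩ le_rfl
    obtain ⟨S, hS⟩ := isUnit_one_add_matOp hM (Fin.succ ⟨r, hr⟩) R (rowV (a.B ⟨r, hr⟩)) fun k => by
      have := fiberDet_ne_zero (hA (r + 1) k).1 (hA (r + 1) k).2
      rwa [h.fiberDet_succ (j := ⟨r, hr⟩) (hA (r + 1) k).1 hR] at this
    refine ⟨T * S, ?_⟩
    have h1 : (∑ i ∈ Finset.range (r + 1), part i a.toFormal)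
        * matOp (Fin.succ ⟨r, hr⟩) R (rowV (a.B ⟨r, hr⟩)) = part (r + 1) a.toFormal := by
      rw [part_succ_toFormal a ⟨r, hr⟩, matOp, matOp, Finset.mul_sum]
      exact Finset.sum_congr rfl fun c _ => by rw [sum_part_mul_theta (by simp), hR]
    rw [Finset.sum_range_succ, ← h1, ← hT, Units.val_mul, hS]
    exact mul_one_add (T : H N M).1 _

lemma Regular.isUnit (hM : 0 < M) {A : H N M} (hA : Regular A) : IsUnit A := by
  obtain ⟨a, ha⟩ := exists_represents A
  obtain ⟨T, hT⟩ := ha.exists_unit_partial hM hA N le_rfl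
  refine ⟨T, Subtype.ext ?_⟩
  rw [hT, ← op_eq_sum, ha.op_toFormal]

/-- A Neumann series could leave the incomplete algebra `H`; it is used only in the fibers, and
elimination then produces the inverse inside `H`. -/
lemma isUnit_one_add_of_trNorm_lt (hM : 0 < M) {C : H N M} (h : trNorm C < 1) :
    IsUnit (1 + C) := (regular_one_add h).isUnit hM

/-- Both determinants equal the fiber determinants, which mention no representation. -/
lemma opDet_eq {A : H N M} (hA : IsUnit A) {a : OpForm N M} (h : a.Represents A.1) :
    opDet A = a.det := by
  rw [opDet, dif_pos (exists_represents A)]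
  funext j κ
  obtain ⟨k, rfl⟩ := surjective_tail j.1 κ
  rw [h.det_tail (regular_of_isUnit hA),
    (exists_represents A).choose_spec.det_tail (regular_of_isUnit hA)]

lemma opDet_tail {A : H N M} (hA : IsUnit A) (j : Fin (N + 1)) (k : Cube N) :
    opDet A j (tail j.1 k) = fiberDet j.1 k A := by
  obtain ⟨a, ha⟩ := exists_represents A
  rw [opDet_eq hA ha, ha.det_tail (regular_of_isUnit hA)]

lemma opDet_eq_ext {A : H N M} (hA : IsUnit A) (j : Fin (N + 1)) (κ : Cube (N - j.1)) :
    opDet A j κ = fiberDet j.1 (ext j.1 κ) A := by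
  rw [← opDet_tail hA, tail_ext]

lemma continuous_opDet {A : H N M} (hA : IsUnit A) (j : Fin (N + 1)) :
    Continuous (opDet A j) := by
  obtain ⟨a, ha⟩ := exists_represents A
  have h := (ha.continuous_fiberDet (regular_of_isUnit hA) j).comp (continuous_ext j.1)
  exact h.congr fun κ => (opDet_eq_ext hA j κ).symm

end

/-! ### Fiber traces and the logarithm of the determinant -/

section

open InnerProductSpace

variable {N M : ℕ}

/-- The traces of the fiber operators. -/
def fiberTr (j : ℕ) (k : Cube N) : H N M →ₗ[ℂ] ℂ where
  toFun A := ftr (fibH j k A).toLinearMap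
  map_add' A B := by
    have := (isFinRank_fibH j k A).finiteDimensional
    have := (isFinRank_fibH j k B).finiteDimensional
    rw [map_add]
    exact ftr_add
  map_smul' c A := by
    have := (isFinRank_fibH j k A).finiteDimensional
    rw [map_smul]
    exact ftr_smul c

lemma fiberTr_apply (j : ℕ) (k : Cube N) (A : H N M) :
    fiberTr j k A = ftr (fibH j k A).toLinearMap := rfl

lemma degNorm_le_trNorm (j : ℕ) (A : H N M) : degNorm j A ≤ trNorm A := by
  refine le_trans ?_ (sum_degNorm_le (j + 1) A)
  exact Finset.single_le_sum (fun i _ => degNorm_nonneg i A) (Finset.self_mem_range_succ j)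

lemma norm_fiberTr_le (j : ℕ) (k : Cube N) (A : H N M) : ‖fiberTr j k A‖ ≤ trNorm A := by
  refine le_trans ?_ (degNorm_le_trNorm j A)
  have h := nucLe_degNorm j k A
  rw [fiberTr_apply]
  obtain ⟨m, a, b, hab⟩ := isFinRank_fibH j k A
  rw [hab] at h ⊢
  rw [ftr_finRank]
  exact norm_trace_le_of_nucLe (degNorm_nonneg j A) h

lemma continuous_fiberTr (j : ℕ) (A : H N M) : Continuous fun k => fiberTr j k A := by
  obtain ⟨m, α, β, h⟩ := exists_fibH_eq j A
  have : (fun k => fiberTr j k A) = fun k => ∑ c, avg j (ip (β c) (α c)) k := by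
    funext k
    rw [fiberTr_apply, h, ftr_finRank]
    exact Finset.sum_congr rfl fun c _ => inner_J_frz _ _ _ _
  rw [this]
  exact continuous_finsetSum _ fun c _ => continuous_avg j (ip (β c) (α c)).continuous

/-- With `L` the lower part of `C`, `psi⁻¹ phi = 1 + t (1 + tL)⁻¹ fib C` for small `t`. Inversion is
continuous at 1, so `hasDerivAt_det_one_add` applies with a factor that equals `fib C` at `t = 0`.
-/
lemma hasDerivAt_fiberDet_zero (j : ℕ) (k : Cube N) (C : H N M) :
    HasDerivAt (fun t : ℂ => fiberDet j k (1 + t • C)) (fiberTr j k C) 0 := by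
  set L := lowH j k C with hL
  obtain ⟨m, a, b, hab⟩ := isFinRank_fibH j k C
  have hcont : ContinuousAt (fun t : ℂ => Ring.inverse (1 + t • L)) 0 := by
    have h1 : ContinuousAt (fun t : ℂ => 1 + t • L) 0 := by fun_prop
    have h2 := NormedRing.inverse_continuousAt (1 : (L2 N M →L[ℂ] L2 N M)ˣ)
    refine ContinuousAt.comp (f := fun t : ℂ => 1 + t • L) (g := Ring.inverse) ?_ h1
    simpa using h2
  have h1 := hasDerivAt_det_one_add (m := m)
    (X := fun t => Matrix.of fun c d => inner ℂ (b c) (Ring.inverse (1 + t • L) (a d)))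
    fun c d => by
      have h3 : ContinuousAt (fun t : ℂ => Ring.inverse (1 + t • L) (a d)) 0 :=
        hcont.clm_apply continuousAt_const
      exact continuousAt_const.inner h3
  have htr : (Matrix.of fun c d => inner ℂ (b c) (Ring.inverse (1 + (0 : ℂ) • L) (a d)) :
      Matrix (Fin m) (Fin m) ℂ).trace = fiberTr j k C := by
    rw [fiberTr_apply, hab, ftr_finRank, Matrix.trace]
    simp
  rw [htr] at h1
  refine h1.congr_of_eventuallyEq ?_
  have hunit : ∀ᶠ t : ℂ in 𝓝 0, IsUnit (1 + t • L) := by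
    have h3 : ContinuousAt (fun t : ℂ => ‖t • L‖) 0 := by fun_prop
    have h4 := h3.eventually_lt (continuousAt_const (y := (1 : ℝ))) (by simp)
    filter_upwards [h4] with t ht using isUnit_one_add_of_norm_lt ht
  filter_upwards [hunit] with t ht
  have hpsi : psi j k (1 + t • C) = 1 + t • L := by rw [psi_one_add, map_smul]
  have h5 : Ring.inverse (1 + t • L) * phi j k (1 + t • C) - 1
      = finRank (fun d => t • Ring.inverse (1 + t • L) (a d)) b := by
    have h6 : phi j k (1 + t • C) = 1 + t • L + t • finRank a b := by
      rw [phi_one_add, map_smul, map_smul, hab, add_assoc]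
    rw [h6, mul_add, Ring.inverse_mul_cancel _ ht, add_sub_cancel_left, mul_smul_comm,
      mul_finRank, smul_finRank]
  rw [fiberDet, hpsi, cdet, h5, fdet_finRank]
  congr 2
  ext c d
  simp

lemma trNorm_pow_le (C : H N M) (n : ℕ) : trNorm (C ^ (n + 1)) ≤ trNorm C ^ (n + 1) := by
  induction n with
  | zero => simp
  | succ n ih =>
    rw [pow_succ, pow_succ (trNorm C)]
    exact (trNorm_mul_le _ _).trans (mul_le_mul_of_nonneg_right ih (trNorm_nonneg C))

/-- Multiplicativity transports the derivative from 0 to `t` through `1 + sC = U (1 + (s - t)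
U⁻¹C)`. -/
lemma hasDerivAt_fiberDet (hM : 0 < M) (j : ℕ) (k : Cube N) {C : H N M} {t : ℂ}
    (ht : ‖t‖ * trNorm C < 1) {U : (H N M)ˣ} (hU : (U : H N M) = 1 + t • C) :
    HasDerivAt (fun s : ℂ => fiberDet j k (1 + s • C))
      (fiberDet j k (1 + t • C) * fiberTr j k ((↑U⁻¹ : H N M) * C)) t := by
  have h1 := hasDerivAt_fiberDet_zero j k ((↑U⁻¹ : H N M) * C)
  have h2 : HasDerivAt (fun s : ℂ => fiberDet j k (1 + (s - t) • ((↑U⁻¹ : H N M) * C)))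
      (fiberTr j k ((↑U⁻¹ : H N M) * C)) t := by
    have := HasDerivAt.comp_sub_const t t (f := fun t : ℂ => fiberDet j k
      (1 + t • ((↑U⁻¹ : H N M) * C))) (by simpa using h1)
    exact this
  refine (h2.const_mul (fiberDet j k (1 + t • C))).congr_of_eventuallyEq ?_
  have h3 : ContinuousAt (fun s : ℂ => ‖s‖ * trNorm C) t := by fun_prop
  filter_upwards [h3.eventually_lt (continuousAt_const (y := (1 : ℝ))) ht] with s hs
  have hs' : IsUnit (1 + s • C) := isUnit_one_add_of_trNorm_lt hM (by rwa [trNorm_smul])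
  have hfac : (U : H N M) * (1 + (s - t) • ((↑U⁻¹ : H N M) * C)) = 1 + s • C := by
    rw [mul_add, mul_one, mul_smul_comm, ← mul_assoc, U.mul_inv, one_mul, hU, sub_smul]
    abel
  have hV : IsUnit (1 + (s - t) • ((↑U⁻¹ : H N M) * C)) := by
    rw [← hfac] at hs'
    exact (Units.isUnit_units_mul U _).1 hs'
  rw [← hfac, fiberDet_mul (U.isUnit.map (psi j k)) (hV.map (psi j k)), hU]

/-- The expansion of `U⁻¹` is stopped after finitely many steps, and only the traces are passed to
the limit: the series need not be treated in the incomplete algebra `H`. -/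
lemma hasSum_fiberTr (j : ℕ) (k : Cube N) {C : H N M} {t : ℂ}
    (ht : ‖t‖ * trNorm C < 1) {U : (H N M)ˣ} (hU : (U : H N M) = 1 + t • C) :
    HasSum (fun n : ℕ => (-t) ^ n * fiberTr j k (C ^ (n + 1)))
      (fiberTr j k ((↑U⁻¹ : H N M) * C)) := by
  have h0 : 0 ≤ ‖t‖ * trNorm C := mul_nonneg (norm_nonneg _) (trNorm_nonneg C)
  have hbd : ∀ n, ‖(-t) ^ n * fiberTr j k (C ^ (n + 1))‖ ≤ trNorm C * (‖t‖ * trNorm C) ^ n := by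
    intro n
    rw [norm_mul, norm_pow, norm_neg]
    calc _ ≤ ‖t‖ ^ n * trNorm C ^ (n + 1) := mul_le_mul_of_nonneg_left
          ((norm_fiberTr_le j k _).trans (trNorm_pow_le C n)) (by positivity)
      _ = _ := by ring
  have hs : Summable fun n : ℕ => (-t) ^ n * fiberTr j k (C ^ (n + 1)) :=
    Summable.of_norm_bounded ((summable_geometric_of_lt_one h0 ht).mul_left _) hbd
  rw [hs.hasSum_iff_tendsto_nat]
  have hrem : ∀ m : ℕ, fiberTr j k ((↑U⁻¹ : H N M) * C)
      = ∑ n ∈ Finset.range m, (-t) ^ n * fiberTr j k (C ^ (n + 1))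
        + (-t) ^ m * fiberTr j k ((↑U⁻¹ : H N M) * C ^ (m + 1)) := by
    intro m
    induction m with
    | zero => simp
    | succ m ih =>
      have h1 : (↑U⁻¹ : H N M) * C ^ (m + 1)
          = C ^ (m + 1) + (-t) • ((↑U⁻¹ : H N M) * C ^ (m + 1 + 1)) := by
        have h2 : (↑U⁻¹ : H N M) * ((U : H N M) * C ^ (m + 1)) = C ^ (m + 1) := by
          rw [← mul_assoc, U.inv_mul, one_mul]
        rw [hU, add_mul, one_mul, mul_add, smul_mul_assoc, ← pow_succ', mul_smul_comm] at h2
        conv_rhs => rw [← h2]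
        rw [neg_smul]
        abel
      rw [ih, h1, map_add, map_smul, Finset.sum_range_succ, smul_eq_mul, pow_succ]
      ring
  have hlim : Tendsto (fun m : ℕ => (-t) ^ m * fiberTr j k ((↑U⁻¹ : H N M) * C ^ (m + 1))) atTop
      (𝓝 0) := by
    have hg : Tendsto (fun m : ℕ => trNorm (↑U⁻¹ : H N M) * trNorm C * (‖t‖ * trNorm C) ^ m) atTop
        (𝓝 0) := by
      simpa using (tendsto_pow_atTop_nhds_zero_of_lt_one h0 ht).const_mul
        (trNorm (↑U⁻¹ : H N M) * trNorm C)
    refine squeeze_zero_norm (fun m => ?_) hg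
    rw [norm_mul, norm_pow, norm_neg]
    calc _ ≤ ‖t‖ ^ m * (trNorm (↑U⁻¹ : H N M) * trNorm C ^ (m + 1)) :=
          mul_le_mul_of_nonneg_left (((norm_fiberTr_le j k _).trans (trNorm_mul_le _ _)).trans
            (mul_le_mul_of_nonneg_left (trNorm_pow_le C m) (trNorm_nonneg _))) (by positivity)
      _ = _ := by ring
  have := (tendsto_const_nhds (x := fiberTr j k ((↑U⁻¹ : H N M) * C))).sub hlim
  rw [sub_zero] at this
  refine this.congr fun m => ?_
  rw [hrem m]
  ring

lemma hasDerivAt_logSeries {F : Type*} [NormedAddCommGroup F] [NormedSpace ℂ F] [CompleteSpace F]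
    {a : ℕ → F} {q : ℝ} (hq : 0 ≤ q) (ha : ∀ n, ‖a n‖ ≤ q ^ (n + 1)) {t : ℂ} (ht : ‖t‖ * q < 1) :
    HasDerivAt (fun t : ℂ => ∑' n : ℕ, ((-1) ^ n * t ^ (n + 1) / (n + 1)) • a n)
      (∑' n : ℕ, (-t) ^ n • a n) t := by
  obtain ⟨ρ, hρ, hρq⟩ : ∃ ρ, ‖t‖ < ρ ∧ ρ * q < 1 := by
    -- The radius exceeds `‖t‖` by a fraction of the gap `1 - ‖t‖ q`; the denominator has `q + 1`
    -- because `q` may be 0.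
    refine ⟨‖t‖ + (1 - ‖t‖ * q) / (2 * (q + 1)), ?_, ?_⟩
    · have : 0 < (1 - ‖t‖ * q) / (2 * (q + 1)) := div_pos (by linarith) (by linarith)
      linarith
    · have h1 : (1 - ‖t‖ * q) / (2 * (q + 1)) * q < 1 - ‖t‖ * q := by
        rw [div_mul_eq_mul_div, div_lt_iff₀ (by linarith)]
        exact mul_lt_mul_of_pos_left (by linarith) (by linarith)
      linarith
  have hρ0 : 0 < ρ := (norm_nonneg t).trans_lt hρ
  refine hasDerivAt_tsum_of_isPreconnected (u := fun n => q * (ρ * q) ^ n)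
    (g := fun (n : ℕ) (t : ℂ) => ((-1) ^ n * t ^ (n + 1) / (n + 1)) • a n)
    (g' := fun (n : ℕ) (t : ℂ) => (-t) ^ n • a n) (t := Metric.ball 0 ρ) (y₀ := 0)
    ((summable_geometric_of_lt_one (by positivity) hρq).mul_left q) Metric.isOpen_ball
    (convex_ball _ _).isPreconnected ?_ ?_ (by simpa using hρ0) (by simp) (by simpa using hρ)
  · intro n y _
    have hn : ((n : ℂ) + 1) ≠ 0 := Nat.cast_add_one_ne_zero n
    have h1 : HasDerivAt (fun t : ℂ => (-1) ^ n * t ^ (n + 1) / (n + 1)) ((-y) ^ n) y := by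
      have := (((hasDerivAt_pow (n + 1) y).const_mul ((-1 : ℂ) ^ n)).div_const ((n : ℂ) + 1))
      refine this.congr_deriv ?_
      push_cast
      field_simp
      exact (neg_pow y n).symm
    exact h1.smul_const (a n)
  · intro n y hy
    have hy' : ‖y‖ ≤ ρ := by simpa using (Metric.mem_ball.1 hy).le
    rw [norm_smul, norm_pow, norm_neg]
    calc _ ≤ ρ ^ n * q ^ (n + 1) := mul_le_mul (pow_le_pow_left₀ (norm_nonneg _) hy' n) (ha n)
          (norm_nonneg _) (by positivity)
      _ = _ := by ring

/-- Along `t ↦ 1 + tC` the determinant and `exp ℓ` have the same logarithmic derivative, so their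
quotient is constant on a disc that contains 0 and 1. -/
lemma fiberDet_one_add_eq_exp (hM : 0 < M) (j : ℕ) (k : Cube N) {C : H N M} (hC : trNorm C < 1) :
    fiberDet j k (1 + C)
      = Complex.exp (∑' n : ℕ, ((-1) ^ n / (n + 1)) * fiberTr j k (C ^ (n + 1))) := by
  set q := trNorm C with hq
  have hq0 : 0 ≤ q := trNorm_nonneg C
  set ℓ : ℂ → ℂ := fun t => ∑' n : ℕ, ((-1) ^ n * t ^ (n + 1) / (n + 1)) • fiberTr j k (C ^ (n + 1))
  -- Since `q < 1`, this radius satisfies both `ρ > 1` and `ρ q < 1`.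
  set ρ : ℝ := 2 / (1 + q)
  have hρ1 : 1 < ρ := by rw [lt_div_iff₀ (by linarith)]; linarith
  have hρq : ρ * q < 1 := by
    rw [div_mul_eq_mul_div, div_lt_one (by linarith)]; linarith
  have hball : ∀ t ∈ Metric.ball (0 : ℂ) ρ, ‖t‖ * q < 1 := fun t ht =>
    (mul_le_mul_of_nonneg_right (by simpa using (Metric.mem_ball.1 ht).le) hq0).trans_lt hρq
  have hderiv : ∀ t ∈ Metric.ball (0 : ℂ) ρ,
      HasDerivAt (fun s => fiberDet j k (1 + s • C) * Complex.exp (-ℓ s)) 0 t := by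
    intro t ht
    obtain ⟨U, hU⟩ := isUnit_one_add_of_trNorm_lt hM (C := t • C)
      (by rw [trNorm_smul]; exact hball t ht)
    have h1 := hasDerivAt_fiberDet hM j k (hball t ht) hU
    have h2 : HasDerivAt ℓ (fiberTr j k ((↑U⁻¹ : H N M) * C)) t := by
      rw [← (hasSum_fiberTr j k (hball t ht) hU).tsum_eq]
      exact hasDerivAt_logSeries hq0
        (fun n => (norm_fiberTr_le j k _).trans (trNorm_pow_le C n)) (hball t ht)
    exact (h1.mul h2.neg.cexp).congr_deriv (by ring)
  have hconst := Metric.isOpen_ball.is_const_of_deriv_eq_zero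
    (convex_ball (0 : ℂ) ρ).isPreconnected
    (fun t ht => (hderiv t ht).differentiableAt.differentiableWithinAt)
    (fun t ht => (hderiv t ht).deriv) (x := 1) (y := 0) (by simpa using hρ1)
    (by simpa using zero_lt_one.trans hρ1)
  have h0 : ℓ 0 = 0 := by simp [ℓ]
  have h1 : ℓ 1 = ∑' n : ℕ, ((-1) ^ n / (n + 1)) * fiberTr j k (C ^ (n + 1)) := by simp [ℓ]
  simp only [one_smul, zero_smul, add_zero, h0, neg_zero, Complex.exp_zero, mul_one,
    fiberDet_one] at hconst
  rw [Complex.exp_neg] at hconst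
  rw [← h1]
  exact (mul_inv_eq_one₀ (Complex.exp_ne_zero _)).1 hconst

lemma inner_J_basisV (c d : Fin M) :
    inner ℂ (J (basisV c : V N M)) (J (basisV d)) = if c = d then (1 : ℂ) else 0 := by
  have h := inner_J_frz 0 (fun _ => 0) (basisV c : V N M) (basisV d)
  rw [frz_basisV, frz_basisV, avg_zero] at h
  rw [h]
  change inner ℂ (basisV c _) (basisV d _) = _
  rw [ip_basisV]
  simp [basisV]

lemma fiberTr_one (j : ℕ) (k : Cube N) :
    fiberTr j k (1 : H N M) = if j = 0 then (M : ℂ) else 0 := by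
  rw [fiberTr_apply]
  split_ifs with h
  · subst h
    rw [fibH_zero_one, ftr_finRank]
    simp only [inner_J_basisV, if_true]
    simp
  · have h0 := ftr_finRank (E := L2 N M) (m := 0) Fin.elim0 Fin.elim0
    rw [fibH_one (Nat.pos_of_ne_zero h)]
    simpa [finRank] using h0

lemma trNorm_one_le : trNorm (1 : H N M) ≤ M := by
  rw [trNorm_eq_sum, Finset.sum_eq_single 0]
  · refine degNorm_le (Nat.cast_nonneg M) fun k => ?_
    rw [fibH_zero_one]
    refine (nucLe_sum Finset.univ (fun c _ => nucLe_rankOne _ _)).mono (le_of_eq ?_)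
    have h : ∀ c : Fin M, ‖J (basisV c : V N M)‖ = 1 := fun c => by
      have h1 := inner_self_eq_norm_sq_to_K (𝕜 := ℂ) (J (basisV c : V N M))
      rw [inner_J_basisV, if_pos rfl] at h1
      have h2 : ‖J (basisV c : V N M)‖ ^ 2 = 1 :=
        Complex.ofReal_injective (by push_cast; exact h1.symm)
      exact (pow_eq_one_iff_of_nonneg (norm_nonneg _) two_ne_zero).1 h2
    simp [h]
  · intro j _ hj
    refine le_antisymm (degNorm_le le_rfl fun k => ?_) (degNorm_nonneg _ _)
    rw [fibH_one (Nat.pos_of_ne_zero hj)]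
    exact NucLe.zero
  · simp

lemma fiberDet_smul_one (j : ℕ) (k : Cube N) {z : ℂ} (hz : z ≠ 0) :
    fiberDet j k (z • (1 : H N M)) = if j = 0 then z ^ M else 1 := by
  split_ifs with h
  · subst h
    have h1 : finRank (fun c : Fin M => (z - 1) • J (basisV c : V N M)) (fun c => J (basisV c))
        = fibH 0 k (z • (1 : H N M)) - fibH 0 k 1 := by
      rw [map_smul, fibH_zero_one, ← smul_finRank, sub_smul, one_smul]
    rw [fiberDet, psi_zero, Ring.inverse_one, one_mul, cdet, ← psi_zero k (z • (1 : H N M)),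
      phi_sub_psi, ← h1, fdet_finRank]
    have h2 : (1 + Matrix.of fun c d : Fin M => inner ℂ (J (basisV c : V N M))
        ((z - 1) • J (basisV d : V N M))) = Matrix.diagonal fun _ : Fin M => z := by
      ext c d
      rw [Matrix.add_apply, Matrix.of_apply, inner_smul_right, inner_J_basisV, Matrix.one_apply,
        Matrix.diagonal_apply]
      split_ifs <;> simp
    rw [h2, Matrix.det_diagonal]
    simp
  · have hj := Nat.pos_of_ne_zero h
    have hu : IsUnit (z • (1 : H N M)) :=
      ⟨⟨z • 1, z⁻¹ • 1, by simp [smul_smul, hz], by simp [smul_smul, hz]⟩, rfl⟩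
    have h1 := phi_sub_psi j k (z • (1 : H N M))
    rw [(fibH j k).map_smul, fibH_one hj, smul_zero, sub_zero, sub_eq_zero] at h1
    rw [fiberDet, h1, Ring.inverse_mul_cancel _ (hu.map (psi j k)), cdet_one]

end

/-! ### Determinant and trace on the completion -/

section

open InnerProductSpace

variable {N M : ℕ}

/-- The trace `τ` on `H`. -/
def tauH : H N M →ₗ[ℂ] CAlg N where
  toFun A := fun j => ⟨fun κ => fiberTr j.1 (ext j.1 κ) A,
    (continuous_fiberTr j.1 A).comp (continuous_ext j.1)⟩
  map_add' A B := by
    funext j; ext κ; exact map_add (fiberTr j.1 (ext j.1 κ)) A B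
  map_smul' c A := by
    funext j; ext κ; exact map_smul (fiberTr j.1 (ext j.1 κ)) c A

lemma tauH_apply (A : H N M) (j : Fin (N + 1)) (κ : Cube (N - j.1)) :
    tauH A j κ = fiberTr j.1 (ext j.1 κ) A := rfl

lemma norm_tauH_le (A : H N M) : ‖tauH A‖ ≤ trNorm A :=
  (pi_norm_le_iff_of_nonneg (trNorm_nonneg A)).2 fun _ =>
    (ContinuousMap.norm_le _ (trNorm_nonneg A)).2 fun _ => norm_fiberTr_le _ _ A

/-- The determinant `π` as a homomorphism on the invertible elements of `H`. -/
def detH : (H N M)ˣ →* CAlg N where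
  toFun U := fun j => ⟨opDet U.1 j, continuous_opDet U.isUnit j⟩
  map_one' := by
    funext j; ext κ
    exact (opDet_eq_ext isUnit_one j κ).trans (fiberDet_one _ _)
  map_mul' U W := by
    funext j; ext κ
    change opDet (U * W : (H N M)ˣ).1 j κ = opDet U.1 j κ * opDet W.1 j κ
    rw [opDet_eq_ext U.isUnit, opDet_eq_ext W.isUnit]
    exact (opDet_eq_ext (U * W).isUnit j κ).trans
      (fiberDet_mul (U.isUnit.map (psi _ _)) (W.isUnit.map (psi _ _)))

lemma detH_apply (U : (H N M)ˣ) (j : Fin (N + 1)) (κ : Cube (N - j.1)) :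
    detH U j κ = opDet U.1 j κ := rfl

/-- The componentwise exponential. -/
def expC (f : CAlg N) : CAlg N := fun j =>
  (⟨Complex.exp, Complex.continuous_exp⟩ : C(ℂ, ℂ)).comp (f j)

lemma expC_apply (f : CAlg N) (j : Fin (N + 1)) (κ : Cube (N - j.1)) :
    expC f j κ = Complex.exp (f j κ) := rfl

lemma continuous_expC : Continuous (expC : CAlg N → CAlg N) :=
  continuous_pi fun j => (ContinuousMap.continuous_postcomp _).comp (continuous_apply j)

lemma expC_zero : expC (0 : CAlg N) = 1 := by
  funext j; ext κ; exact Complex.exp_zero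

lemma isUnit_expC (f : CAlg N) : IsUnit (expC f) := by
  have h : ∀ g : CAlg N, expC g * expC (-g) = 1 := fun g => by
    funext j; ext κ
    change Complex.exp _ * Complex.exp (-_) = 1
    rw [← Complex.exp_add, add_neg_cancel, Complex.exp_zero]
  exact IsUnit.of_mul_eq_one _ (h f)

lemma exp_eq_comp {X : Type*} [TopologicalSpace X] [CompactSpace X] (g : C(X, ℂ)) :
    NormedSpace.exp g = (⟨Complex.exp, Complex.continuous_exp⟩ : C(ℂ, ℂ)).comp g := by
  ext x
  let := NormedAlgebra.restrictScalars ℚ ℂ C(X, ℂ)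
  change _ = Complex.exp (g x)
  rw [Complex.exp_eq_exp_ℂ]
  exact NormedSpace.map_exp (ContinuousMap.evalAlgHom ℂ ℂ x) (continuous_eval_const x) g

lemma summable_logSeries {F : Type*} [NormedAddCommGroup F] [NormedSpace ℂ F] [CompleteSpace F]
    {a : ℕ → F} {q : ℝ} (hq : 0 ≤ q) (hq1 : q < 1) (ha : ∀ n, ‖a n‖ ≤ q ^ (n + 1)) :
    Summable fun n : ℕ => (((-1) ^ n / (n + 1) : ℂ)) • a n := by
  refine Summable.of_norm_bounded ((summable_geometric_of_lt_one hq hq1).mul_left q) fun n => ?_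
  have h1 : ‖((-1) ^ n / (n + 1) : ℂ)‖ ≤ 1 := by
    rw [norm_div, norm_pow, norm_neg, norm_one, one_pow]
    have : ‖(n : ℂ) + 1‖ = n + 1 := by
      rw [← Nat.cast_succ, Complex.norm_natCast, Nat.cast_succ]
    rw [this]
    exact (div_le_one (by positivity)).2 (by linarith [(Nat.cast_nonneg n : (0 : ℝ) ≤ n)])
  rw [norm_smul]
  calc _ ≤ 1 * q ^ (n + 1) := mul_le_mul h1 (ha n) (norm_nonneg _) zero_le_one
    _ = _ := by ring

/-- Evaluation of a component at a point. -/
def evalC (j : Fin (N + 1)) (κ : Cube (N - j.1)) : CAlg N →L[ℂ] ℂ :=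
  (ContinuousMap.evalCLM ℂ κ).comp (ContinuousLinearMap.proj j)

lemma evalC_apply (j : Fin (N + 1)) (κ : Cube (N - j.1)) (f : CAlg N) : evalC j κ f = f j κ := rfl

lemma detH_one_add (hM : 0 < M) {C : H N M} (hC : trNorm C < 1) {U : (H N M)ˣ}
    (hU : (U : H N M) = 1 + C) :
    detH U = expC (∑' n : ℕ, ((-1) ^ n / (n + 1) : ℂ) • tauH (C ^ (n + 1))) := by
  funext j; ext κ
  have hs := summable_logSeries (trNorm_nonneg C) hC
    fun n => (norm_tauH_le (C ^ (n + 1))).trans (trNorm_pow_le C n)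
  rw [expC_apply, detH_apply, opDet_eq_ext U.isUnit, hU, fiberDet_one_add_eq_exp hM _ _ hC,
    ← evalC_apply, ContinuousLinearMap.map_tsum _ hs]
  rfl

/-- For small `t`, `π(1 + tA) = exp (L t)` with a power series `L` in the Banach algebra `CAlg N`,
where `L 0 = 0` and `L' (0) = τ(A)`. A derivative in the sup norm is a uniform limit of difference
quotients. -/
lemma isTrace_tauH (hM : 0 < M) (A : H N M) : IsTrace A fun j κ => tauH A j κ := by
  intro j
  set L : ℂ → CAlg N := fun t =>
    ∑' n : ℕ, ((-1) ^ n * t ^ (n + 1) / (n + 1) : ℂ) • tauH (A ^ (n + 1)) with hL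
  have hbd : ∀ n, ‖tauH (A ^ (n + 1))‖ ≤ trNorm A ^ (n + 1) :=
    fun n => (norm_tauH_le _).trans (trNorm_pow_le A n)
  have h1 : HasDerivAt L (tauH A) 0 := by
    refine (hasDerivAt_logSeries (trNorm_nonneg A) hbd (by simp)).congr_deriv ?_
    rw [tsum_eq_single 0 fun n hn => by simp [hn]]
    simp
  have hL0 : L 0 = 0 := by
    simp only [hL, ne_eq, Nat.add_one_ne_zero, not_false_eq_true, zero_pow, mul_zero, zero_div]
    exact (tsum_congr fun n => zero_smul ℂ (tauH (A ^ (n + 1)))).trans tsum_zero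
  have h2 : HasDerivAt (fun t => NormedSpace.exp (L t j)) (tauH A j) 0 := by
    have h3 : HasDerivAt (fun t => L t j) (tauH A j) 0 := (hasDerivAt_pi.1 h1) j
    have h4 : HasFDerivAt NormedSpace.exp (1 : C(Cube (N - j.1), ℂ) →L[ℂ] C(Cube (N - j.1), ℂ))
        (L 0 j) := by
      rw [hL0]; exact hasFDerivAt_exp_zero
    exact h4.comp_hasDerivAt 0 h3
  rw [hasDerivAt_iff_tendsto_slope, ContinuousMap.tendsto_iff_tendstoUniformly] at h2
  have hev : ∀ᶠ t : ℂ in 𝓝[≠] 0, trNorm (t • A) < 1 := by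
    have h3 : ContinuousAt (fun t : ℂ => ‖t‖ * trNorm A) 0 := by fun_prop
    have h4 := h3.eventually_lt (continuousAt_const (y := (1 : ℝ))) (by simp)
    filter_upwards [nhdsWithin_le_nhds h4] with t ht
    rwa [trNorm_smul]
  rw [← tendstoUniformlyOn_univ] at h2 ⊢
  refine h2.congr ?_
  filter_upwards [hev] with t ht κ _
  obtain ⟨U, hU⟩ := isUnit_one_add_of_trNorm_lt hM ht
  have h5 : opDet (1 + t • A) j κ = NormedSpace.exp (L t j) κ := by
    rw [exp_eq_comp, ← hU, ← detH_apply, detH_one_add hM ht hU]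
    have h6 : ∀ n : ℕ, ((-1) ^ n / (n + 1) : ℂ) • tauH ((t • A) ^ (n + 1))
        = ((-1) ^ n * t ^ (n + 1) / (n + 1) : ℂ) • tauH (A ^ (n + 1)) := fun n => by
      rw [smul_pow, map_smul, smul_smul]
      congr 1
      ring
    simp only [h6]
    rfl
  have h7 : opDet (1 : H N M) j κ = NormedSpace.exp (L 0 j) κ := by
    rw [opDet_eq_ext isUnit_one, fiberDet_one, exp_eq_comp, hL0]
    exact Complex.exp_zero.symm
  change slope (fun t => NormedSpace.exp (L t j)) 0 t κ
    = (opDet (1 + t • A) j κ - opDet (1 : H N M) j κ) / t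
  rw [h5, h7, slope_def_module, sub_zero, div_eq_inv_mul]
  rfl

section Extension

variable {K : Type*} [NormedRing K] [NormedAlgebra ℂ K]

/-- The logarithmic series `τ(ln(1 + x))`. -/
def logSeries (τ : K →L[ℂ] CAlg N) (x : K) : CAlg N :=
  ∑' n : ℕ, ((-1) ^ n / (n + 1) : ℂ) • τ (x ^ (n + 1))

lemma norm_apply_pow_le {τ : K →L[ℂ] CAlg N} (hτ : ∀ x, ‖τ x‖ ≤ ‖x‖) (x : K) (n : ℕ) :
    ‖τ (x ^ (n + 1))‖ ≤ ‖x‖ ^ (n + 1) :=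
  (hτ _).trans (norm_pow_le' x n.succ_pos)

lemma continuousAt_logSeries {τ : K →L[ℂ] CAlg N} (hτ : ∀ x, ‖τ x‖ ≤ ‖x‖) {x : K}
    (hx : ‖x‖ < 1) : ContinuousAt (logSeries τ) x := by
  obtain ⟨r, hr, hr1⟩ := exists_between hx
  have hr0 : 0 ≤ r := (norm_nonneg x).trans hr.le
  refine ContinuousOn.continuousAt (s := Metric.ball 0 r) ?_
    (Metric.isOpen_ball.mem_nhds (by simpa using hr))
  refine continuousOn_tsum (u := fun n : ℕ => r ^ (n + 1)) (fun n => by fun_prop) ?_ fun n y hy => ?_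
  · simpa [pow_succ'] using (summable_geometric_of_lt_one hr0 hr1).mul_left r
  · have hy' : ‖y‖ ≤ r := by simpa using (Metric.mem_ball.1 hy).le
    have h1 : ‖((-1) ^ n / (n + 1) : ℂ)‖ ≤ 1 := by
      rw [norm_div, norm_pow, norm_neg, norm_one, one_pow, ← Nat.cast_succ, Complex.norm_natCast]
      exact (div_le_one (by positivity)).2 (by simp)
    rw [norm_smul]
    calc _ ≤ 1 * r ^ (n + 1) := mul_le_mul h1 ((norm_apply_pow_le hτ y n).trans
          (pow_le_pow_left₀ (norm_nonneg _) hy' _)) (norm_nonneg _) zero_le_one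
      _ = _ := one_mul _

variable {ι : H N M →ₐ[ℂ] K}

lemma IsTrCompletion.exists_rho (hK : IsTrCompletion ι) :
    ∃ ρ : K →ₐ[ℂ] (L2 N M →L[ℂ] L2 N M), (∀ A : H N M, ρ (ι A) = A.1) ∧ ∀ x : K, ‖ρ x‖ ≤ ‖x‖ := by
  have hb : ∀ A : H N M, ‖(H N M).val.toLinearMap A‖ ≤ 1 * ‖ι.toLinearMap A‖ := fun A => by
    rw [one_mul]
    exact (norm_coe_le_trNorm A).trans (hK.norm_eq A).ge
  set ρ := (H N M).val.toLinearMap.extendOfNorm ι.toLinearMap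
  have h1 : ∀ A : H N M, ρ (ι A) = A.1 := LinearMap.extendOfNorm_eq hK.dense ⟨1, hb⟩
  refine ⟨AlgHom.ofLinearMap ρ.toLinearMap ?_ ?_, h1, fun x => ?_⟩
  · rw [← map_one ι]; exact h1 1
  · refine hK.dense.induction_on₂ ?_ fun A B => ?_
    · exact isClosed_eq (by simp only [ContinuousLinearMap.coe_coe]; fun_prop)
        (by simp only [ContinuousLinearMap.coe_coe]; fun_prop)
    · rw [← map_mul]
      exact (h1 _).trans (by rw [ContinuousLinearMap.coe_coe, h1, h1]; rfl)
  · simpa using LinearMap.norm_extendOfNorm_apply_le hK.dense 1 hb x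

lemma IsTrCompletion.exists_tau (hK : IsTrCompletion ι) :
    ∃ τ : K →L[ℂ] CAlg N, (∀ A : H N M, τ (ι A) = tauH A) ∧ ∀ x : K, ‖τ x‖ ≤ ‖x‖ := by
  have hb : ∀ A : H N M, ‖tauH A‖ ≤ 1 * ‖ι.toLinearMap A‖ := fun A => by
    rw [one_mul]
    exact (norm_tauH_le A).trans (hK.norm_eq A).ge
  exact ⟨tauH.extendOfNorm ι.toLinearMap, LinearMap.extendOfNorm_eq hK.dense ⟨1, hb⟩,
    fun x => by simpa using LinearMap.norm_extendOfNorm_apply_le hK.dense 1 hb x⟩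

/-- Invertible elements of the completion are close to invertible elements of `H`. -/
lemma IsTrCompletion.exists_unit_near (hK : IsTrCompletion ι) (hM : 0 < M) (U : Kˣ) :
    ∃ A : (H N M)ˣ, ‖ι (↑A⁻¹ : H N M) * U - 1‖ < 1 := by
  -- `U` and `U⁻¹` are approximated at once by `A`, `B` in `H`. As `AB` and `BA` are then near 1,
  -- they are invertible in `H`, so `B` has a left and a right inverse; the required unit is `B⁻¹`.
  have hc : ContinuousAt (fun x : K × K => max ‖x.1 * x.2 - 1‖ (max ‖x.2 * x.1 - 1‖ ‖x.2 * U - 1‖))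
      ((U : K), ((U⁻¹ : Kˣ) : K)) := by fun_prop
  have hlt := hc.eventually_lt (continuousAt_const (y := (1 : ℝ))) (by simp)
  obtain ⟨⟨A, B⟩, hAB⟩ := (hK.dense.prodMap hK.dense).exists_mem_open
    isOpen_interior ⟨_, mem_interior_iff_mem_nhds.2 hlt⟩
  have h := interior_subset hAB
  simp only [Set.mem_ofPred_eq, Prod.map_apply, max_lt_iff] at h
  have hunit : ∀ C D : H N M, ‖ι C * ι D - 1‖ < 1 → IsUnit (C * D) := fun C D hCD => by
    have : trNorm (C * D - 1) < 1 := by rwa [← hK.norm_eq, map_sub, map_mul, map_one]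
    have h2 := isUnit_one_add_of_trNorm_lt hM this
    rwa [add_sub_cancel] at h2
  obtain ⟨u, hu⟩ := hunit A B h.1
  obtain ⟨v, hv⟩ := hunit B A h.2.1
  have h1 : B * (A * ↑v⁻¹) = 1 := by rw [← mul_assoc, ← hv, v.mul_inv]
  have h2 : ↑u⁻¹ * A * B = 1 := by rw [mul_assoc, ← hu, u.inv_mul]
  obtain ⟨W, rfl⟩ : IsUnit B :=
    ⟨⟨B, A * ↑v⁻¹, h1, by rw [← left_inv_eq_right_inv h2 h1, h2]⟩, rfl⟩
  exact ⟨W⁻¹, by simpa using h.2.2⟩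

open Classical in
/-- The determinant on `H`, with value `0` at non-invertible elements. -/
def detOrZero (A : H N M) : CAlg N := if h : IsUnit A then detH h.unit else 0

lemma detOrZero_unit (U : (H N M)ˣ) : detOrZero (U : H N M) = detH U := by
  rw [detOrZero, dif_pos U.isUnit]
  congr 1
  ext
  rfl

/-- The extension of the determinant by continuity. -/
def detK (ι : H N M →ₐ[ℂ] K) (x : K) : CAlg N := (comap ι (𝓝 x)).limUnder detOrZero

/-- For `G` in `H` near `x`, `G = A (1 + C)` with `C = A⁻¹G - 1` small, so `π(G) = π(A) exp τ(ln(1 +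
C))`. The right side is continuous on the completion, hence is the limit at `x` for every admissible
`A`. -/
lemma IsTrCompletion.detK_eq (hK : IsTrCompletion ι) (hM : 0 < M) {τ : K →L[ℂ] CAlg N}
    (hτι : ∀ A : H N M, τ (ι A) = tauH A) (hτ : ∀ x, ‖τ x‖ ≤ ‖x‖) (A : (H N M)ˣ) {x : K}
    (hx : ‖ι (↑A⁻¹ : H N M) * x - 1‖ < 1) :
    detK ι x = detH A * expC (logSeries τ (ι (↑A⁻¹ : H N M) * x - 1)) := by
  have : (comap ι (𝓝 x)).NeBot := comap_neBot fun s hs => by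
    obtain ⟨y, hy, B, rfl⟩ := mem_closure_iff_nhds.1 (hK.dense x) s hs
    exact ⟨B, hy⟩
  refine Tendsto.limUnder_eq ?_
  have hc : ContinuousAt (fun y : K => detH A * expC (logSeries τ (ι (↑A⁻¹ : H N M) * y - 1))) x := by
    have h1 : ContinuousAt (fun y : K => ι (↑A⁻¹ : H N M) * y - 1) x := by fun_prop
    have h2 : ContinuousAt (fun y : K => logSeries τ (ι (↑A⁻¹ : H N M) * y - 1)) x :=
      ContinuousAt.comp (f := fun y : K => ι (↑A⁻¹ : H N M) * y - 1)
        (continuousAt_logSeries hτ hx) h1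
    exact continuousAt_const.mul (continuous_expC.continuousAt.comp h2)
  refine (hc.tendsto.comp tendsto_comap).congr' ?_
  have h1 : ContinuousAt (fun y : K => ‖ι (↑A⁻¹ : H N M) * y - 1‖) x := by fun_prop
  have hev := tendsto_comap.eventually (h1.eventually_lt (continuousAt_const (y := (1 : ℝ))) hx)
    (f := ι)
  filter_upwards [hev] with G hG
  have hG' : trNorm ((↑A⁻¹ : H N M) * G - 1) < 1 := by
    rwa [← hK.norm_eq, map_sub, map_mul, map_one]
  obtain ⟨W, hW⟩ := isUnit_one_add_of_trNorm_lt hM hG'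
  have hGW : G = ((A * W : (H N M)ˣ) : H N M) := by
    rw [Units.val_mul, hW, add_sub_cancel, ← mul_assoc, A.mul_inv, one_mul]
  have hlog : logSeries τ (ι (↑A⁻¹ : H N M) * ι G - 1)
      = ∑' n : ℕ, ((-1) ^ n / (n + 1) : ℂ) • tauH (((↑A⁻¹ : H N M) * G - 1) ^ (n + 1)) := by
    simp only [logSeries, ← hτι, map_pow, map_sub, map_mul, map_one]
  rw [Function.comp_apply, hlog, ← detH_one_add hM hG' hW, ← map_mul, hGW, detOrZero_unit]

lemma detH_mul_detH_inv (A : (H N M)ˣ) : detH A * detH A⁻¹ = 1 := by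
  rw [← map_mul, mul_inv_cancel, map_one]

end Extension

end

/-! ### The determinant on invertible elements of the completion -/

section

open InnerProductSpace

variable {N M : ℕ}

section Determinant

variable {K : Type*} [NormedRing K] [NormedAlgebra ℂ K] {ι : H N M →ₐ[ℂ] K}

lemma IsTrCompletion.isUnit_detK (hK : IsTrCompletion ι) (hM : 0 < M) (U : Kˣ) :
    IsUnit (detK ι U) := by
  obtain ⟨τ, hτι, hτ⟩ := hK.exists_tau
  obtain ⟨A, hA⟩ := hK.exists_unit_near hM U
  rw [hK.detK_eq hM hτι hτ A hA]
  exact (IsUnit.of_mul_eq_one _ (detH_mul_detH_inv A)).mul (isUnit_expC _)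

/-- One and the same `A` serves all points near `U`, and the explicit formula with that `A` is
continuous. -/
lemma IsTrCompletion.continuous_detK (hK : IsTrCompletion ι) (hM : 0 < M) :
    Continuous fun U : Kˣ => detK ι U := by
  obtain ⟨τ, hτι, hτ⟩ := hK.exists_tau
  refine continuous_iff_continuousAt.2 fun U => ?_
  obtain ⟨A, hA⟩ := hK.exists_unit_near hM U
  have h1 : ContinuousAt (fun y : K => ι (↑A⁻¹ : H N M) * y - 1) U := by fun_prop
  have h2 : ContinuousAt (fun y : K => logSeries τ (ι (↑A⁻¹ : H N M) * y - 1)) U :=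
    ContinuousAt.comp (f := fun y : K => ι (↑A⁻¹ : H N M) * y - 1)
      (continuousAt_logSeries hτ hA) h1
  have h3 : ContinuousAt
      (fun y : K => detH A * expC (logSeries τ (ι (↑A⁻¹ : H N M) * y - 1))) U :=
    continuousAt_const.mul (continuous_expC.continuousAt.comp h2)
  have h4 : ContinuousAt (detK ι) (U : K) := by
    refine h3.congr ?_
    filter_upwards [h1.norm.eventually_lt (continuousAt_const (y := (1 : ℝ))) hA] with y hy
    exact (hK.detK_eq hM hτι hτ A hy).symm
  exact h4.comp Units.continuous_val.continuousAt

lemma logSeries_zero (τ : K →L[ℂ] CAlg N) : logSeries τ 0 = 0 := by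
  simp only [logSeries, ne_eq, Nat.add_one_ne_zero, not_false_eq_true, zero_pow, map_zero]
  exact (tsum_congr fun n => smul_zero _).trans tsum_zero

lemma IsTrCompletion.detK_map (hK : IsTrCompletion ι) (hM : 0 < M) (A : (H N M)ˣ) :
    detK ι (ι (A : H N M)) = detH A := by
  obtain ⟨τ, hτι, hτ⟩ := hK.exists_tau
  have h : ι (↑A⁻¹ : H N M) * ι (A : H N M) - 1 = 0 := by
    rw [← map_mul, A.inv_mul, map_one, sub_self]
  rw [hK.detK_eq hM hτι hτ A (by rw [h]; simp), h, logSeries_zero, expC_zero, mul_one]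

/-- The unit `z • 1`. -/
def scalarUnit {z : ℂ} (hz : z ≠ 0) : (H N M)ˣ where
  val := z • 1
  inv := z⁻¹ • 1
  val_inv := by rw [smul_mul_smul_comm, mul_one, mul_inv_cancel₀ hz, one_smul]
  inv_val := by rw [smul_mul_smul_comm, mul_one, inv_mul_cancel₀ hz, one_smul]

lemma detH_scalarUnit {z : ℂ} (hz : z ≠ 0) {l : ℂ} (hl : Complex.exp l = z) :
    detH (scalarUnit hz : (H N M)ˣ) = expC (l • tauH (1 : H N M)) := by
  funext j; ext κ
  rw [detH_apply, opDet_eq_ext (Units.isUnit _)]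
  change fiberDet _ _ (z • 1) = Complex.exp (l * tauH (1 : H N M) j κ)
  rw [fiberDet_smul_one _ _ hz, tauH_apply, fiberTr_one]
  split_ifs
  · rw [mul_comm, Complex.exp_nat_mul, hl]
  · rw [mul_zero, Complex.exp_zero]

/-- Factor `z - x = z (1 + y)` with `y = -x/z` of norm below one, and use the scalar `z` as the
reference element in `IsTrCompletion.detK_eq`. Its determinant is `exp (l τ(1))` for any logarithm
`l` of `z`. -/
lemma IsTrCompletion.log_formula (hK : IsTrCompletion ι) (hM : 0 < M) {τ : K →L[ℂ] CAlg N}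
    (hτι : ∀ A : H N M, τ (ι A) = tauH A) (hτ : ∀ x, ‖τ x‖ ≤ ‖x‖) {x : K} {z : ℂ}
    (hx : ‖x‖ < ‖z‖) :
    ∃ (U : Kˣ) (S : CAlg N), (U : K) = z • (1 : K) - x ∧
      HasSum (fun n : ℕ => (((n : ℂ) + 1) * z ^ (n + 1))⁻¹ • τ (x ^ (n + 1))) S ∧
      ∀ l : ℂ, Complex.exp l = z → detK ι U = expC (l • τ 1 - S) := by
  have := hK.complete
  have hz0 : 0 < ‖z‖ := (norm_nonneg x).trans_lt hx
  have hz : z ≠ 0 := norm_pos_iff.1 hz0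
  set y : K := -(z⁻¹ • x) with hy
  have hy1 : ‖y‖ < 1 := by
    rw [hy, norm_neg, norm_smul, norm_inv, inv_mul_lt_iff₀ hz0, mul_one]; exact hx
  have hterm : ∀ n : ℕ, (((n : ℂ) + 1) * z ^ (n + 1))⁻¹ • τ (x ^ (n + 1))
      = -(((-1) ^ n / (n + 1) : ℂ) • τ (y ^ (n + 1))) := fun n => by
    have h1 : y ^ (n + 1) = ((-1) ^ (n + 1) * (z ^ (n + 1))⁻¹ : ℂ) • x ^ (n + 1) := by
      rw [hy, ← neg_smul, smul_pow, neg_pow, inv_pow]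
    rw [h1, map_smul, smul_smul]
    have h2 : ((-1 : ℂ) ^ n) * (-1) ^ n = 1 := by rw [← mul_pow]; simp
    have h3 : ((n : ℂ) + 1)⁻¹ * (z ^ (n + 1))⁻¹
        = -((-1) ^ n * ((n : ℂ) + 1)⁻¹ * ((-1) ^ n * -1 * (z ^ (n + 1))⁻¹)) := by
      linear_combination -(((n : ℂ) + 1)⁻¹ * (z ^ (n + 1))⁻¹) * h2
    rw [mul_inv, div_eq_mul_inv, pow_succ (-1 : ℂ), h3]
    funext j; ext κ
    exact neg_mul _ _
  have hsum : HasSum (fun n : ℕ => (((n : ℂ) + 1) * z ^ (n + 1))⁻¹ • τ (x ^ (n + 1)))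
      (-logSeries τ y) := by
    simp only [hterm]
    exact (summable_logSeries (norm_nonneg y) hy1 (norm_apply_pow_le hτ y)).hasSum.neg
  have hunit : z • (1 : K) - x = z • (1 + y) := by
    rw [hy, smul_add, smul_neg, smul_smul, mul_inv_cancel₀ hz, one_smul, sub_eq_add_neg]
  obtain ⟨W, hW⟩ : IsUnit (z • (1 : K) - x) := by
    rw [hunit, ← smul_one_mul]
    refine IsUnit.mul ?_ (isUnit_one_add_of_norm_lt hy1)
    exact ⟨⟨z • 1, z⁻¹ • 1, by rw [smul_mul_smul_comm, mul_one, mul_inv_cancel₀ hz, one_smul],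
      by rw [smul_mul_smul_comm, mul_one, inv_mul_cancel₀ hz, one_smul]⟩, rfl⟩
  refine ⟨W, _, hW, hsum, fun l hl => ?_⟩
  have h1 : ι (↑(scalarUnit hz : (H N M)ˣ)⁻¹ : H N M) * (W : K) - 1 = y := by
    change ι (z⁻¹ • 1) * _ - 1 = y
    rw [hW, hunit, map_smul, map_one, smul_mul_smul_comm, inv_mul_cancel₀ hz, one_smul, one_mul,
      add_sub_cancel_left]
  rw [hK.detK_eq hM hτι hτ (scalarUnit hz) (by rw [h1]; exact hy1), h1, detH_scalarUnit hz hl,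
    ← hτι, map_one, sub_neg_eq_add]
  funext j; ext κ
  exact (Complex.exp_add _ _).symm

lemma tauH_one (j : Fin (N + 1)) (κ : Cube (N - j.1)) :
    tauH (1 : H N M) j κ = if j = 0 then (M : ℂ) else 0 := by
  rw [tauH_apply, fiberTr_one]
  simp only [Fin.ext_iff, Fin.val_zero]

/-- The bound is attained at the identity: `τ(1)` has norm at least `M`, and the norm of 1 is at
most `M`. -/
lemma IsTrCompletion.norm_tau (hK : IsTrCompletion ι) (hM : 0 < M) {τ : K →L[ℂ] CAlg N}
    (hτι : ∀ A : H N M, τ (ι A) = tauH A) (hτ : ∀ x, ‖τ x‖ ≤ ‖x‖) : ‖τ‖ = 1 := by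
  refine le_antisymm (τ.opNorm_le_bound zero_le_one fun x => by rw [one_mul]; exact hτ x) ?_
  have hM' : (0 : ℝ) < M := Nat.cast_pos.2 hM
  have h1 : (M : ℝ) ≤ ‖τ 1‖ := by
    have h2 : τ 1 0 (fun _ => 0) = (M : ℂ) := by
      rw [← map_one ι, hτι, tauH_one, if_pos rfl]
    have h3 := ((τ 1 0).norm_coe_le_norm fun _ => 0).trans (norm_le_pi_norm (τ 1) 0)
    rw [h2, Complex.norm_natCast] at h3
    exact h3
  have h4 : ‖(1 : K)‖ ≤ M := by
    rw [← map_one ι, hK.norm_eq]; exact trNorm_one_le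
  have h5 : (M : ℝ) ≤ ‖τ‖ * M :=
    h1.trans ((τ.le_opNorm 1).trans (mul_le_mul_of_nonneg_left h4 (norm_nonneg _)))
  exact le_of_mul_le_mul_right (by rwa [one_mul]) hM'

end Determinant

lemma trNorm_neg (A : H N M) : trNorm (-A) = trNorm A := by
  rw [← neg_one_smul ℂ A, trNorm_smul, norm_neg, norm_one, one_mul]

/-- The algebra `H`, to be normed by the trace norm. -/
def TrH (N M : ℕ) : Type := H N M

/-- Only the algebraic structure is carried over, since as a subalgebra `H N M` already has the
operator norm. -/
instance : Ring (TrH N M) := inferInstanceAs (Ring (H N M))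

instance : Algebra ℂ (TrH N M) := inferInstanceAs (Algebra ℂ (H N M))

/-- The trace norm as a group norm. -/
def trGroupNorm (N M : ℕ) : AddGroupNorm (TrH N M) where
  toFun := trNorm (N := N) (M := M)
  map_zero' := (trNorm_eq_zero_iff (0 : H N M)).2 rfl
  add_le' := trNorm_add_le
  neg' := trNorm_neg
  eq_zero_of_map_eq_zero' A := (trNorm_eq_zero_iff A).1

instance : NormedRing (TrH N M) where
  __ := (inferInstance : Ring (TrH N M))
  __ := (trGroupNorm N M).toNormedAddCommGroup
  norm_mul_le := trNorm_mul_le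

instance : NormedAlgebra ℂ (TrH N M) where
  __ := (inferInstance : Algebra ℂ (TrH N M))
  norm_smul_le c A := (trNorm_smul c A).le

lemma exists_completion (N M : ℕ) :
    ∃ (K : Type) (_ : NormedRing K) (_ : NormedAlgebra ℂ K) (ι : H N M →ₐ[ℂ] K),
      IsTrCompletion ι := by
  let inst : NormedAlgebra ℂ (UniformSpace.Completion (TrH N M)) :=
    { (inferInstance : Algebra ℂ (UniformSpace.Completion (TrH N M))) with
      norm_smul_le := norm_smul_le }
  let ι : TrH N M →ₐ[ℂ] UniformSpace.Completion (TrH N M) :=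
    { (UniformSpace.Completion.coeRingHom : TrH N M →+* UniformSpace.Completion (TrH N M)) with
      commutes' := fun _ => rfl }
  have hnorm : ∀ A : TrH N M, ‖ι A‖ = ‖A‖ := UniformSpace.Completion.norm_coe
  have hdense : DenseRange ι := UniformSpace.Completion.denseRange_coe
  exact ⟨UniformSpace.Completion (TrH N M), inferInstance, inst, ι, inferInstance, hnorm, hdense⟩

end

end

end PeriodicDefect

open PeriodicDefect
theorem theorem6 (N M : ℕ) (hM : 0 < M) :
    -- every element of `H` has a representation; norm and determinant do not depend on it
    (∀ A : H N M, ∃ a : OpForm N M, a.Represents A.1) ∧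
    (∀ (A : H N M) (a : OpForm N M), a.Represents A.1 → trNorm A = a.trNorm) ∧
    (∀ (A : (H N M)ˣ) (a : OpForm N M), a.Represents A.1.1 → opDet A.1 = a.det) ∧
    -- the trace norm is a submultiplicative norm on `H` that dominates the operator norm
    (∀ A : H N M, trNorm A = 0 ↔ A = 0) ∧
    (∀ A B : H N M, trNorm (A + B) ≤ trNorm A + trNorm B) ∧
    (∀ (c : ℂ) (A : H N M), trNorm (c • A) = ‖c‖ * trNorm A) ∧
    (∀ A B : H N M, trNorm (A * B) ≤ trNorm A * trNorm B) ∧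
    (∀ A : H N M, ‖(A : L2 N M →L[ℂ] L2 N M)‖ ≤ trNorm A) ∧
    -- there is a completion, and it is a Banach algebra
    (∃ (K : Type) (_ : NormedRing K) (_ : NormedAlgebra ℂ K) (ι : H N M →ₐ[ℂ] K),
      IsTrCompletion ι) ∧
    -- properties of the completion
    (∀ (K : Type*) [NormedRing K] [NormedAlgebra ℂ K] (ι : H N M →ₐ[ℂ] K), IsTrCompletion ι →
      -- elements of the completion act as operators with `‖A‖ ≤ ‖A‖_tr`
      (∃ ρ : K →ₐ[ℂ] (L2 N M →L[ℂ] L2 N M),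
        (∀ A : H N M, ρ (ι A) = A.1) ∧ ∀ x : K, ‖ρ x‖ ≤ ‖x‖) ∧
      -- continuous extensions of the trace and of the determinant
      ∃ (τ : K →L[ℂ] CAlg N) (π : Kˣ → (CAlg N)ˣ),
        Continuous π ∧
        (∀ A : H N M, IsTrace A (fun j k => τ (ι A) j k)) ∧
        (∀ (A : (H N M)ˣ) (j : Fin (N + 1)) (k : Cube (N - j.1)),
          (π (Units.map (ι : H N M →* K) A) : CAlg N) j k = opDet A.1 j k) ∧
        ‖τ‖ = 1 ∧
        (∀ (j : Fin (N + 1)) (k : Cube (N - j.1)), τ 1 j k = if j = 0 then (M : ℂ) else 0) ∧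
        -- `ln π(λ - A) = (ln λ) τ(1) - ∑ τ(Aⁿ) / (n λⁿ)`
        ∀ (x : K) (z : ℂ), ‖x‖ < ‖z‖ →
          ∃ (U : Kˣ) (S : CAlg N), (U : K) = z • (1 : K) - x ∧
            HasSum (fun n : ℕ => (((n : ℂ) + 1) * z ^ (n + 1))⁻¹ • τ (x ^ (n + 1))) S ∧
            ∀ l : ℂ, Complex.exp l = z → ∀ (j : Fin (N + 1)) (k : Cube (N - j.1)),
              (π U : CAlg N) j k = Complex.exp (l * τ 1 j k - S j k)) := by
  refine ⟨exists_represents, fun A a h => trNorm_eq h, fun A a h => opDet_eq A.isUnit h,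
    trNorm_eq_zero_iff, trNorm_add_le, trNorm_smul, trNorm_mul_le, norm_coe_le_trNorm,
    exists_completion N M, fun K _ _ ι hK => ⟨hK.exists_rho, ?_⟩⟩
  obtain ⟨τ, hτι, hτ⟩ := hK.exists_tau
  refine ⟨τ, fun U => (hK.isUnit_detK hM U).unit, ?_, fun A => ?_, fun A j k => ?_,
    hK.norm_tau hM hτι hτ, fun j k => ?_, fun x z hx => ?_⟩
  -- In the complete normed ring `CAlg N` the units carry the subspace topology, so continuity of
  -- the values suffices.
  · exact Units.isOpenEmbedding_val.isEmbedding.continuous_iff.2 (hK.continuous_detK hM)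
  · simp only [hτι]
    exact isTrace_tauH hM A
  · exact congrFun (congrArg DFunLike.coe (congrFun (hK.detK_map hM A) j)) k
  · rw [← map_one ι, hτι, tauH_one]
  · obtain ⟨U, S, hU, hS, h⟩ := hK.log_formula hM hτι hτ hx
    exact ⟨U, S, hU, hS, fun l hl j k => congrFun (congrArg DFunLike.coe (congrFun (h l hl) j)) k⟩
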